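/- Put $\epsilon_1=\epsilon_2=1$, $\epsilon_3=-1$; $s$ is any index in $\{1,2,3\}$ and $(i,j,k)$ any cyclic permutation of $(1,2,3)$. Let $n\ge 1$ and let $M$ be a paraquaternionic contact (pqc) manifold of dimension $4n+3$ with a fixed metric $g$ in its conformal class: $H\subset TM$ is a distribution of codimension three carrying a metric $g$ of signature $(2n,2n)$ and a bundle $\mathbb{PQ}$ of endomorphisms of $H$, and locally $H=\bigcap_s\ker\eta_s$ for 1-forms $\eta_s$ and $\mathbb{PQ}=\mathrm{span}\{I_1,I_2,I_3\}$ with $$I_s^2=\epsilon_s\,\mathrm{id},\quad I_iI_j=-I_jI_i=-\epsilon_kI_k,\quad g(I_sX,I_sY)=-\epsilon_sg(X,Y),\quad -2\epsilon_sg(I_sX,Y)=d\eta_s(X,Y)$$ for $X,Y\in H$, where $d\eta(A,B)=A\eta(B)-B\eta(A)-\eta([A,B])$. Let $\nabla$, with torsion $T$ and curvature $R=[\nabla,\nabla]-\nabla_{[\cdot,\cdot]}$, be the canonical pqc connection and $V$ the associated complement, $TM=H\oplus V$. They are characterised by: $\nabla$ preserves $H$, $V$, $g$ and $\mathbb{PQ}$;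 $T(X,Y)=-[X,Y]_V$ for $X,Y\in H$; for $\xi\in V$, $T(\xi,\cdot)$ maps $H$ to $H$ and, as an endomorphism of $H$, is orthogonal to $sp(n,\mathbb R)\oplus sp(1,\mathbb R)$ in $gl(H)$; and the identification $\varphi:V\to\mathbb{PQ}$, $\varphi(\xi)=\sum_s\eta_s(\xi)I_s$, is parallel. (If $n=1$ it is assumed that such $V$ and $\nabla$ exist.) For a local choice of $(\eta_s,I_s)$ let $\xi_s$ be the Reeb vector fields, i.e. the sections of $V$ with $\eta_s(\xi_t)=\delta_{st}$. Extend $g$ to $TM$ by $H\perp V$ and $g(\xi_s,\xi_t)=-\epsilon_s\delta_{st}$, put $\omega_s(X,Y)=g(I_sX,Y)$ for $X,Y\in H$, extended by zero on $V$, and $R(A,B,C,D)=g(R(A,B)C,D)$, $T(A,B,C)=g(T(A,B),C)$. With summation over an orthonormal basis $e_a$ of $H$, each term weighted by $g(e_a,e_a)$, define $$Ric(B,C)=R(e_a,B,C,e_a),\quad Scal=Ric(e_a,e_a),\quad \rho_s(B,C)=\tfrac1{4n}R(B,C,e_a,I_se_a),$$ $$\zeta_s(B,C)=\tfrac1{4n}R(e_a,B,C,I_se_a),\quad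 \varrho_s(B,C)=\tfrac1{4n}R(e_a,I_se_a,B,C).$$ Let $T^0$ and $T^a$ be the symmetric and skew-symmetric parts of $(X,Y)\mapsto T(\xi,X,Y)$ on $H$, and put $\tau(X,Y)=-\sum_s\epsilon_sT^0(\xi_s,I_sX,Y)$, $\mu(X,Y)=\epsilon_sT^a(\xi_s,I_sX,Y)$ (the same tensor for each $s$), and $$\lambda=\tfrac1{2n}g\big((\mathbb L_{\xi_i}I_k)e_a,I_je_a\big)-\epsilon_id\eta_i(\xi_j,\xi_k)+\epsilon_jd\eta_j(\xi_k,\xi_i)+\epsilon_kd\eta_k(\xi_i,\xi_j).$$ Theorem. For all horizontal $X,Y$: the function $Scal$ is smooth; $Ric(X,Y)$ and $\zeta_s(X,I_sY)$ are symmetric; $\rho_s(X,I_sY)$ and $\varrho_s(X,I_sY)$ are symmetric and of type $(1,1)$ with respect to $I_s$ (a bilinear form $P$ on $H$ being of type $(1,1)$ when $P(I_sX,I_sY)=-\epsilon_sP(X,Y)$), $\rho_s(X,I_sY)=-\rho_s(I_sX,Y)$, $\varrho_s(X,I_sY)=-\varrho_s(I_sX,Y)$; and $$Ric(X,Y)=\tfrac{Scal}{4n}g(X,Y)+(2n+2)\tau(X,Y)+(4n+10)\mu(X,Y),$$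 $$\rho_s(X,I_sY)=\epsilon_s\tfrac{Scal}{8n(n+2)}g(X,Y)+\tfrac12\big[\epsilon_s\tau(X,Y)-\tau(I_sX,I_sY)\big]+2\epsilon_s\mu(X,Y),$$ $$\varrho_s(X,I_sY)=\epsilon_s\tfrac{Scal}{8n(n+2)}g(X,Y)+\tfrac{n+2}{2n}\big[\epsilon_s\tau(X,Y)-\tau(I_sX,I_sY)\big],$$ $$-\epsilon_s\zeta_s(X,I_sY)=\tfrac{Scal}{16n(n+2)}g(X,Y)+\tfrac{2n+1}{4n}\tau(X,Y)-\epsilon_s\tfrac1{4n}\tau(I_sX,I_sY)+\tfrac{2n+1}{2n}\mu(X,Y),$$ $$Scal=-8n(n+2)\,g(T(\xi_1,\xi_2),\xi_3)=8n(n+2)\lambda,\qquad T(\xi_i,\xi_j)=\epsilon_k\tfrac{Scal}{8n(n+2)}\xi_k-[\xi_i,\xi_j]_H,$$ $$T(\xi_i,\xi_j,I_kX)=\rho_k(I_jX,\xi_i)=-\rho_k(I_iX,\xi_j)=\omega_k([\xi_i,\xi_j],X),$$ $$-\epsilon_i\rho_i(X,\xi_i)=-\tfrac{X(Scal)}{32n(n+2)}+\tfrac12\big(-\rho_i(\xi_j,I_kX)+\rho_j(\xi_k,I_iX)+\rho_k(\xi_i,I_jX)\big),$$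 $$-\epsilon_i\rho_i(\xi_i,\xi_j)-\epsilon_k\rho_k(\xi_k,\xi_j)=\tfrac1{16n(n+2)}\xi_j(Scal).$$ For $n=1$ the same formulas hold with $\mu=0$. -/

import Mathlib

open scoped Manifold ContDiff
open Bundle VectorField

noncomputable section

namespace PQC

/-! ### Vector fields, one-forms and curvature on a manifold of dimension `4n+3` -/

section General

variable {n : ℕ} {M : Type*} [TopologicalSpace M]
  [ChartedSpace (EuclideanSpace ℝ (Fin (4 * n + 3))) M]

variable (n) in
/-- The tangent space of the `(4n+3)`-dimensional manifold `M` at `x`. -/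
abbrev Tan (x : M) : Type := TangentSpace (𝓡 (4 * n + 3)) x

instance tanFiniteDimensional (x : M) : FiniteDimensional ℝ (Tan n x) :=
  inferInstanceAs (FiniteDimensional ℝ (EuclideanSpace ℝ (Fin (4 * n + 3))))

variable [IsManifold (𝓡 (4 * n + 3)) ∞ M]

/-- The vector field `X` is smooth on `U`. -/
def SmoothField (U : Set M) (X : Π x : M, Tan n x) : Prop :=
  ContMDiffOn (𝓡 (4 * n + 3)) (𝓡 (4 * n + 3)).tangent ∞
    (fun x ↦ (⟨x, X x⟩ : TangentBundle (𝓡 (4 * n + 3)) M)) U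

/-- The 1-form `η` is smooth on `U`. -/
def SmoothForm (U : Set M) (η : Π x : M, Tan n x →L[ℝ] ℝ) : Prop :=
  ContMDiffOn (𝓡 (4 * n + 3))
    ((𝓡 (4 * n + 3)).prod 𝓘(ℝ, EuclideanSpace ℝ (Fin (4 * n + 3)) →L[ℝ] ℝ)) ∞
    (fun x ↦ TotalSpace.mk' (EuclideanSpace ℝ (Fin (4 * n + 3)) →L[ℝ] ℝ)
      (E := fun x : M ↦ (Tan n x →L[ℝ] Trivial M ℝ x)) x (η x)) U

/-- The real function `f` is smooth on `U`. -/
abbrev SmoothFun (n : ℕ) {M : Type*} [TopologicalSpace M]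
    [ChartedSpace (EuclideanSpace ℝ (Fin (4 * n + 3))) M] (U : Set M) (f : M → ℝ) : Prop :=
  ContMDiffOn (𝓡 (4 * n + 3)) 𝓘(ℝ) ∞ f U

/-- The derivative `v(f)` of the function `f` along the tangent vector `v`. -/
abbrev dirDeriv (n : ℕ) {M : Type*} [TopologicalSpace M]
    [ChartedSpace (EuclideanSpace ℝ (Fin (4 * n + 3))) M] (f : M → ℝ) (x : M) (v : Tan n x) : ℝ :=
  mvfderiv (𝓡 (4 * n + 3)) f x v

/-- A vector field extending the tangent vector `v` at `x`, smooth near `x`. -/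
abbrev ext {x : M} (v : Tan n x) : Π y : M, Tan n y :=
  FiberBundle.extend (EuclideanSpace ℝ (Fin (4 * n + 3))) v

/-- Lie bracket of vector fields. -/
abbrev bracket (X Y : Π x : M, Tan n x) (x : M) : Tan n x :=
  mlieBracket (𝓡 (4 * n + 3)) X Y x

/-- The exterior derivative `dη(u,v) = u(η(V)) - v(η(U)) - η([U,V])` of a 1-form, where `U`, `V`
are fields extending the tangent vectors `u`, `v`. -/
def extDer (η : Π x : M, Tan n x →L[ℝ] ℝ) (x : M) (u v : Tan n x) : ℝ :=
  dirDeriv n (fun y ↦ η y (ext v y)) x u - dirDeriv n (fun y ↦ η y (ext u y)) x v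
    - η x (bracket (ext u) (ext v) x)

variable (n M) in
/-- Linear connections on `M`; `cov Y x u` is `∇_u Y` at the point `x`. -/
abbrev Conn : Type _ := CovariantDerivative (𝓡 (4 * n + 3)) (EuclideanSpace ℝ (Fin (4 * n + 3)))
  (fun x : M ↦ Tan n x)

/-- The curvature `R(u,v)w = ∇_u ∇_v W - ∇_v ∇_u W - ∇_{[u,v]} W` of a connection, where the
tangent vectors are extended to fields. -/
def curv (cov : Conn n M) (x : M) (u v w : Tan n x) : Tan n x :=
  cov (fun y ↦ cov (ext w) y (ext v y)) x u - cov (fun y ↦ cov (ext w) y (ext u y)) x v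
    - cov (ext w) x (bracket (ext u) (ext v) x)

end General

/-! ### Linear algebra of a (possibly indefinite) inner product space -/

section LinearAlgebra

variable {W : Type*} [AddCommGroup W] [Module ℝ W]

/-- The contraction `∑ g^{ab} P(w_a, w_b)` of a bilinear `P` by means of a nondegenerate `g`. If
`e` is a basis with `g(e_a, e_b) = ±δ_{ab}` this is `∑ g(e_a, e_a) P(e_a, e_a)`. -/
def contr [FiniteDimensional ℝ W] (g : LinearMap.BilinForm ℝ W) (P : W → W → ℝ) : ℝ :=
  ∑ a, ∑ b, (LinearMap.BilinForm.toMatrix (Module.finBasis ℝ W) g)⁻¹ a b *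
    P (Module.finBasis ℝ W a) (Module.finBasis ℝ W b)

/-- The Lie algebra `sp(n, ℝ)`: the `g`-skew endomorphisms commuting with the paraquaternionic
structure `Q`. -/
def spn (g : LinearMap.BilinForm ℝ W) (Q : Submodule ℝ (Module.End ℝ W)) :
    Submodule ℝ (Module.End ℝ W) where
  carrier := {B | (∀ X Y, g (B X) Y = - g X (B Y)) ∧ ∀ J ∈ Q, B * J = J * B}
  zero_mem' := by simp
  add_mem' := by
    rintro A B ⟨hA, hA'⟩ ⟨hB, hB'⟩
    refine ⟨fun X Y ↦ ?_, fun J hJ ↦ ?_⟩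
    · simp [hA, hB]; ring
    · rw [add_mul, mul_add, hA' J hJ, hB' J hJ]
  smul_mem' := by
    rintro c A ⟨hA, hA'⟩
    refine ⟨fun X Y ↦ ?_, fun J hJ ↦ ?_⟩
    · simp [hA]
    · rw [smul_mul_assoc, mul_smul_comm, hA' J hJ]

/-- `A` lies in the orthogonal complement of `sp(n, ℝ) ⊕ sp(1, ℝ)` in `gl(W)` with respect to the
inner product `⟨A, B⟩ = ∑ g(e_a, e_a) g(A e_a, B e_a)`; here `sp(1, ℝ)` is `Q` itself. -/
def PerpSp [FiniteDimensional ℝ W] (g : LinearMap.BilinForm ℝ W)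
    (Q : Submodule ℝ (Module.End ℝ W)) (A : Module.End ℝ W) : Prop :=
  ∀ B ∈ spn g Q ⊔ Q, contr g (fun X Y ↦ g (A X) (B Y)) = 0

end LinearAlgebra

/-- `ε₁ = ε₂ = 1`, `ε₃ = -1`. The indices `1, 2, 3` are `0, 1, 2 : Fin 3`, so that the cyclic
permutations of `(1, 2, 3)` are the triples `(i, i + 1, i + 2)`. -/
def eps : Fin 3 → ℝ := ![1, 1, -1]

/-! ### Paraquaternionic contact manifolds -/

variable (n : ℕ) (M : Type*) [TopologicalSpace M]
  [ChartedSpace (EuclideanSpace ℝ (Fin (4 * n + 3))) M]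

/-- A distribution `H` on `M`, a bilinear form `g` on `H`, and a family `PQ` of spaces of
endomorphisms of `H`. -/
structure HorizontalData where
  /-- The horizontal distribution. -/
  H : Π x : M, Submodule ℝ (Tan n x)
  /-- The horizontal metric. -/
  g : Π x : M, LinearMap.BilinForm ℝ (H x)
  /-- The paraquaternionic bundle. -/
  PQ : Π x : M, Submodule ℝ (Module.End ℝ (H x))

variable {n M} [IsManifold (𝓡 (4 * n + 3)) ∞ M]

namespace HorizontalData

variable (S : HorizontalData n M)

/-- The section `X` of `H` is smooth on `U`. -/
def SmoothHor (U : Set M) (X : Π x : M, S.H x) : Prop :=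
  SmoothField U (fun x ↦ (X x : Tan n x))

/-- The field `σ` of endomorphisms of `H` is smooth on `U`. -/
def SmoothEnd (U : Set M) (σ : Π x : M, Module.End ℝ (S.H x)) : Prop :=
  ∀ W : Set M, IsOpen W → W ⊆ U → ∀ X : Π x : M, S.H x, S.SmoothHor W X →
    S.SmoothHor W (fun x ↦ σ x (X x))

/-- A local choice, on an open set `U`, of contact forms `η₁, η₂, η₃` and of generators
`I₁, I₂, I₃` of the paraquaternionic bundle, compatible with each other and with the metric. -/
structure Frame where
  U : Set M
  η : Fin 3 → Π x : M, Tan n x →L[ℝ] ℝ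
  I : Fin 3 → Π x : M, Module.End ℝ (S.H x)
  isOpen_U : IsOpen U
  smooth_η : ∀ s, SmoothForm U (η s)
  smooth_I : ∀ s, S.SmoothEnd U (I s)
  ker_η : ∀ x ∈ U, ∀ v : Tan n x, v ∈ S.H x ↔ ∀ s, η s x v = 0
  span_I : ∀ x ∈ U, S.PQ x = Submodule.span ℝ (Set.range (fun s ↦ I s x))
  sq_I : ∀ x ∈ U, ∀ s, I s x * I s x = eps s • (1 : Module.End ℝ (S.H x))
  mul_I : ∀ x ∈ U, ∀ i, I i x * I (i + 1) x = -(eps (i + 2) • I (i + 2) x)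
  mul_I' : ∀ x ∈ U, ∀ i, I (i + 1) x * I i x = eps (i + 2) • I (i + 2) x
  metric_I : ∀ x ∈ U, ∀ s, ∀ X Y : S.H x, S.g x (I s x X) (I s x Y) = -(eps s * S.g x X Y)
  contact : ∀ x ∈ U, ∀ s, ∀ X Y : S.H x, -2 * eps s * S.g x (I s x X) Y = extDer (η s) x X Y

end HorizontalData

variable (n M) in
/-- A paraquaternionic contact manifold of dimension `4n+3` with a fixed metric `g` in its
conformal class (the class being that of `g`). The metric `g` automatically has signature
`(2n, 2n)`, because it is nondegenerate and `I₁` changes its sign. -/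
structure Structure extends HorizontalData n M where
  finrank_H : ∀ x : M, Module.finrank ℝ (H x) = 4 * n
  g_symm : ∀ x : M, ∀ X Y : H x, g x X Y = g x Y X
  g_nondegenerate : ∀ x : M, (g x).Nondegenerate
  g_smooth : ∀ W : Set M, IsOpen W → ∀ X Y : Π x : M, H x,
    toHorizontalData.SmoothHor W X → toHorizontalData.SmoothHor W Y →
    SmoothFun n W (fun x ↦ g x (X x) (Y x))
  exists_frame : ∀ x : M, ∃ F : toHorizontalData.Frame, x ∈ F.U

/-- A smooth distribution `V` of rank three supplementary to `H`. -/
structure Complement (S : Structure n M) where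
  V : Π x : M, Submodule ℝ (Tan n x)
  isCompl : ∀ x, IsCompl (S.H x) (V x)
  smooth : ∀ x : M, ∃ U : Set M, IsOpen U ∧ x ∈ U ∧ ∃ ζ : Fin 3 → Π y : M, Tan n y,
    (∀ s, SmoothField U (ζ s)) ∧ ∀ y ∈ U, V y = Submodule.span ℝ (Set.range (fun s ↦ ζ s y))

namespace Complement

variable {S : Structure n M} (C : Complement S)

/-- The projection of `TM = H ⊕ V` onto `H`. -/
def hor (x : M) : Tan n x →ₗ[ℝ] S.H x := (S.H x).projectionOnto (C.V x) (C.isCompl x)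

/-- The projection of `TM = H ⊕ V` onto `V`. -/
def ver (x : M) : Tan n x →ₗ[ℝ] C.V x := (C.V x).projectionOnto (S.H x) (C.isCompl x).symm

/-- The endomorphism `X ↦ T(ξ, X)_H` of `H`, where `T` is the torsion of the connection. -/
def torEnd (cov : Conn n M) (x : M) (ξ : Tan n x) : Module.End ℝ (S.H x) :=
  C.hor x ∘ₗ (cov.torsion x ξ).toLinearMap ∘ₗ (S.H x).subtype

/-- The canonical paraquaternionic contact connection, characterised by its defining properties
together with the supplementary distribution `V`. -/
structure IsCanonical (cov : Conn n M) : Prop where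
  /-- the connection is smooth -/
  smooth : cov.ContMDiffCovariantDerivative ∞
  /-- `∇` preserves `H` -/
  preserves_H : ∀ W : Set M, IsOpen W → ∀ X : Π x : M, S.H x, S.SmoothHor W X →
    ∀ x ∈ W, ∀ u : Tan n x, cov (fun y ↦ (X y : Tan n y)) x u ∈ S.H x
  /-- `∇` preserves `V` -/
  preserves_V : ∀ W : Set M, IsOpen W → ∀ ξ : Π x : M, C.V x,
    SmoothField W (fun y ↦ (ξ y : Tan n y)) →
    ∀ x ∈ W, ∀ u : Tan n x, cov (fun y ↦ (ξ y : Tan n y)) x u ∈ C.V x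
  /-- `∇ g = 0` -/
  metric : ∀ W : Set M, IsOpen W → ∀ X Y : Π x : M, S.H x, S.SmoothHor W X → S.SmoothHor W Y →
    ∀ x ∈ W, ∀ u : Tan n x, dirDeriv n (fun y ↦ S.g y (X y) (Y y)) x u =
      S.g x (C.hor x (cov (fun y ↦ (X y : Tan n y)) x u)) (Y x) +
      S.g x (X x) (C.hor x (cov (fun y ↦ (Y y : Tan n y)) x u))
  /-- `∇σ` is a section of `PQ` for every section `σ` of `PQ` -/
  preserves_PQ : ∀ W : Set M, IsOpen W → ∀ σ : Π x : M, Module.End ℝ (S.H x),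
    S.SmoothEnd W σ → (∀ x ∈ W, σ x ∈ S.PQ x) → ∀ x ∈ W, ∀ u : Tan n x,
    ∃ B ∈ S.PQ x, ∀ X : Π x : M, S.H x, S.SmoothHor W X →
      C.hor x (cov (fun y ↦ (σ y (X y) : Tan n y)) x u) -
        σ x (C.hor x (cov (fun y ↦ (X y : Tan n y)) x u)) = B (X x)
  /-- `T(X, Y) = -[X, Y]_V` for horizontal `X`, `Y` -/
  torsion_hor : ∀ W : Set M, IsOpen W → ∀ X Y : Π x : M, S.H x, S.SmoothHor W X →
    S.SmoothHor W Y → ∀ x ∈ W, cov.torsion x (X x : Tan n x) (Y x : Tan n x) =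
      -(C.ver x (bracket (fun y ↦ (X y : Tan n y)) (fun y ↦ (Y y : Tan n y)) x) : Tan n x)
  /-- for vertical `ξ`, `T(ξ, ·)` maps `H` to itself -/
  torsion_mem : ∀ x : M, ∀ ξ ∈ C.V x, ∀ X : S.H x, cov.torsion x ξ (X : Tan n x) ∈ S.H x
  /-- for vertical `ξ`, the endomorphism `T(ξ, ·)` of `H` lies in `(sp(n, ℝ) ⊕ sp(1, ℝ))^⊥` -/
  torsion_perp : ∀ x : M, ∀ ξ ∈ C.V x, PerpSp (S.g x) (S.PQ x) (C.torEnd cov x ξ)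
  /-- `∇φ = 0` for the natural identification `φ : V → PQ`, `φ(ξ) = ∑ η_s(ξ) I_s` -/
  parallel_phi : ∀ F : S.Frame, ∀ ξ : Π x : M, C.V x,
    SmoothField F.U (fun y ↦ (ξ y : Tan n y)) →
    ∀ X : Π x : M, S.H x, S.SmoothHor F.U X → ∀ x ∈ F.U, ∀ u : Tan n x,
      ∑ s, F.η s x (cov (fun y ↦ (ξ y : Tan n y)) x u) • F.I s x (X x) =
        C.hor x (cov (fun y ↦ ((∑ s, F.η s y (ξ y) • F.I s y (X y) : S.H y) : Tan n y)) x u) -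
        ∑ s, F.η s x (ξ x) • F.I s x (C.hor x (cov (fun y ↦ (X y : Tan n y)) x u))

/-- The vector fields `ξ₁, ξ₂, ξ₃` are, on the domain of the frame, the sections of `V` with
`η_s(ξ_t) = δ_{st}`. -/
def IsReeb (F : S.Frame) (ξ : Fin 3 → Π x : M, Tan n x) : Prop :=
  ∀ x ∈ F.U, ∀ t, ξ t x ∈ C.V x ∧ ∀ s, F.η s x (ξ t x) = if s = t then 1 else 0

/-! ### Curvature contractions -/

/-- `R(A,B,D,Z) = g(R(A,B)D, Z)` for the extended metric (for which `H ⊥ V`) and horizontal `Z`. -/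
def curv4 (cov : Conn n M) (x : M) (A B D : Tan n x) (Z : S.H x) : ℝ :=
  S.g x (C.hor x (curv cov x A B D)) Z

/-- `Ric(A,B) = R(e_a, A, B, e_a)`. -/
def ric (cov : Conn n M) (x : M) (A B : Tan n x) : ℝ :=
  contr (S.g x) (fun e e' ↦ C.curv4 cov x e A B e')

/-- `Scal = Ric(e_a, e_a)`. -/
def scal (cov : Conn n M) (x : M) : ℝ :=
  contr (S.g x) (fun e e' ↦ C.ric cov x e e')

variable (F : S.Frame)

/-- The Ricci 2-forms `ρ_s(A,B) = (1/4n) R(A, B, e_a, I_s e_a)`. -/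
def rho (cov : Conn n M) (s : Fin 3) (x : M) (A B : Tan n x) : ℝ :=
  1 / (4 * (n : ℝ)) * contr (S.g x) (fun e e' ↦ C.curv4 cov x A B e (F.I s x e'))

/-- `ζ_s(A,B) = (1/4n) R(e_a, A, B, I_s e_a)`. -/
def zeta (cov : Conn n M) (s : Fin 3) (x : M) (A B : Tan n x) : ℝ :=
  1 / (4 * (n : ℝ)) * contr (S.g x) (fun e e' ↦ C.curv4 cov x e A B (F.I s x e'))

/-- `ϱ_s(X,Y) = (1/4n) R(e_a, I_s e_a, X, Y)`. -/
def varrho (cov : Conn n M) (s : Fin 3) (x : M) (X Y : S.H x) : ℝ :=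
  1 / (4 * (n : ℝ)) * contr (S.g x) (fun e e' ↦ C.curv4 cov x e (F.I s x e') X Y)

/-! ### The torsion tensors and the function `λ` -/

/-- The extended metric `g + η₃² - η₁² - η₂²` on `TM = H ⊕ V`. -/
def extMetric (x : M) (A B : Tan n x) : ℝ :=
  S.g x (C.hor x A) (C.hor x B) - ∑ s, eps s * F.η s x A * F.η s x B

variable (ξ : Fin 3 → Π x : M, Tan n x)

/-- `T(ξ_s, X, Y) = g(T(ξ_s, X), Y)`. -/
def tor (cov : Conn n M) (s : Fin 3) (x : M) (X Y : S.H x) : ℝ :=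
  S.g x (C.torEnd cov x (ξ s x) X) Y

/-- `τ(X,Y) = -∑ ε_s T⁰(ξ_s, I_s X, Y)`, with `T⁰` the symmetric part of the torsion. -/
def tau (cov : Conn n M) (x : M) (X Y : S.H x) : ℝ :=
  -∑ s, eps s *
    ((C.tor ξ cov s x (F.I s x X) Y + C.tor ξ cov s x Y (F.I s x X)) / 2)

/-- `μ_s(X,Y) = ε_s Tᵃ(ξ_s, I_s X, Y)`, with `Tᵃ` the skew-symmetric part of the torsion. -/
def mu (cov : Conn n M) (s : Fin 3) (x : M) (X Y : S.H x) : ℝ :=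
  eps s * ((C.tor ξ cov s x (F.I s x X) Y - C.tor ξ cov s x Y (F.I s x X)) / 2)

/-- The horizontal part of the Lie derivative `(L_{ξ_s} I_t) X = [ξ_s, I_t X] - I_t [ξ_s, X]`, where
`X` is extended to a horizontal field. -/
def lieDer (s t : Fin 3) (x : M) (X : S.H x) : S.H x :=
  C.hor x (bracket (ξ s) (fun y ↦ (F.I t y (C.hor y (ext (X : Tan n x) y)) : Tan n y)) x) -
    F.I t x (C.hor x (bracket (ξ s) (fun y ↦ (C.hor y (ext (X : Tan n x) y) : Tan n y)) x))

/-- `λ = (1/2n) g((L_{ξ_i} I_k) e_a, I_j e_a) - ε_i dη_i(ξ_j, ξ_k) + ε_j dη_j(ξ_k, ξ_i)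
+ ε_k dη_k(ξ_i, ξ_j)` for the cyclic permutation `(i, j, k) = (i, i + 1, i + 2)`. -/
def lam (i : Fin 3) (x : M) : ℝ :=
  1 / (2 * (n : ℝ)) * contr (S.g x)
      (fun e e' ↦ S.g x (C.lieDer F ξ i (i + 2) x e) (F.I (i + 1) x e'))
    - eps i * extDer (F.η i) x (ξ (i + 1) x) (ξ (i + 2) x)
    + eps (i + 1) * extDer (F.η (i + 1)) x (ξ (i + 2) x) (ξ i x)
    + eps (i + 2) * extDer (F.η (i + 2)) x (ξ i x) (ξ (i + 1) x)

end Complement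

end PQC

end

open scoped Manifold ContDiff
open Bundle VectorField

set_option linter.unusedSectionVars false
set_option linter.unusedSimpArgs false

noncomputable section

namespace PQC

open scoped Topology

section Manifold

variable {n : ℕ} {M : Type*} [TopologicalSpace M]
  [ChartedSpace (EuclideanSpace ℝ (Fin (4 * n + 3))) M] [IsManifold (𝓡 (4 * n + 3)) ∞ M]

/-! Everything follows from the first Bianchi identity with torsion (`first_bianchi`), split
according to the number of vertical arguments, together with one observation. The curvature `R(u,v)`
acts on `H` as a `g`-skew endomorphism normalising the span of the `I_s`, and because `φ` is
parallel its action on `V` is given by the commutators `[R(u,v), I_s]`, that is, by the Ricci forms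
`ρ_s` (`curvH_I`, `η_curv_ξ`). On `H` the torsion is `-2 ∑ ε_s ω_s ⊗ ξ_s`, which is parallel
(`covTorsion_hor`).

One vertical argument (`vertical_bianchi`, `IsPara.exists_ricciForm`): the vertical component of the
identity gives nine relations between the `ρ_s`, the endomorphisms `T_i = T(ξ_i, ·)` and the
vertical part of `T(ξ_i, ξ_j)`. Taking traces against the `I_s` forces `T(ξ_i, ξ_j)_V = ε_k c ξ_k`
with a single function `c` (`normScal`). What remains, together with orthogonality to `sp(n) ⊕
sp(1)`, gives `T_i = ε_k N_j I_k - ε_j N_k I_j + U I_i`, where `U` is symmetric and traceless, the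
`N_s` are skew and all of them commute with every `I_s` (`IsPara.exists_split`). Then `ρ_s` is
represented by `-c I_s + 2 ε_s N_s - 2 U I_s`, while `μ` is `U` and `τ` is `-2 ∑ N_s I_s`.

No vertical argument (`IsCurv`): contracting the identity shows that `Ric` is symmetric and computes
the skew part of `ζ_i`; moving `I_i` through `R` expresses `ζ_i(X, I_i Y)` by `Ric` and the Ricci
forms. Comparing the two determines `Ric` up to a form `Q` with `Q(I_i X, I_i Y) = ε_i Q(X, Y)` for
all `i`, and such a `Q` vanishes (`IsCurv.ric_eq`). Tracing gives `Scal = 8n(n+2)c`; the formulas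
for `ζ_s` and `ϱ_s` follow.

Two or three vertical arguments (`mixed_bianchi`, `reeb_bianchi`): the vertical components give
`ρ_s` on the remaining arguments, and the derivative of `c` enters through `∇T`. Writing Lie
derivatives by means of the connection shows `λ = c` (`lam_eq`). For `n = 1` the endomorphism `U` is
a multiple of the identity and traceless, so `μ = 0` (`IsSplit.U_eq_zero`). -/

lemma isManifold_one : IsManifold (𝓡 (4 * n + 3)) 1 M :=
  .of_le (n := ∞) (WithTop.coe_le_coe.2 (le_top : (1 : ℕ∞) ≤ ⊤))

lemma isManifold_two : IsManifold (𝓡 (4 * n + 3)) 2 M :=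
  .of_le (n := ∞) (WithTop.coe_le_coe.2 (le_top : (2 : ℕ∞) ≤ ⊤))

end Manifold

attribute [local instance] isManifold_one isManifold_two

section Calculus

variable {n : ℕ} {M : Type*} [TopologicalSpace M]
  [ChartedSpace (EuclideanSpace ℝ (Fin (4 * n + 3))) M] [IsManifold (𝓡 (4 * n + 3)) ∞ M]
    {U : Set M} {x : M}

/-! ### Calculus of smooth functions, fields and forms -/

lemma SmoothField.mdiffAt {X : Π x : M, Tan n x} (h : SmoothField U X) (hU : IsOpen U)
    (hx : x ∈ U) : MDifferentiableAt (𝓡 (4 * n + 3)) (𝓡 (4 * n + 3)).tangent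
      (fun x ↦ (⟨x, X x⟩ : TangentBundle (𝓡 (4 * n + 3)) M)) x :=
  ((h x hx).contMDiffAt (hU.mem_nhds hx)).mdifferentiableAt (by simp)

lemma SmoothField.contMDiffAt {X : Π x : M, Tan n x} (h : SmoothField U X) (hU : IsOpen U)
    (hx : x ∈ U) : ContMDiffAt (𝓡 (4 * n + 3)) (𝓡 (4 * n + 3)).tangent ∞
      (fun x ↦ (⟨x, X x⟩ : TangentBundle (𝓡 (4 * n + 3)) M)) x :=
  (h x hx).contMDiffAt (hU.mem_nhds hx)

lemma SmoothFun.mdiffAt {f : M → ℝ} (h : SmoothFun n U f) (hU : IsOpen U) (hx : x ∈ U) :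
    MDifferentiableAt (𝓡 (4 * n + 3)) 𝓘(ℝ) f x :=
  ((h x hx).contMDiffAt (hU.mem_nhds hx)).mdifferentiableAt (by simp)

lemma SmoothField.mono {V : Set M} {X : Π x : M, Tan n x} (h : SmoothField U X) (hV : V ⊆ U) :
    SmoothField V X := ContMDiffOn.mono h hV

lemma SmoothField.congr {X Y : Π x : M, Tan n x} (h : SmoothField U X) (hXY : ∀ x ∈ U, Y x = X x) :
    SmoothField U Y :=
  ContMDiffOn.congr h fun y hy ↦ by rw [hXY y hy]

lemma SmoothField.add {X Y : Π x : M, Tan n x} (hX : SmoothField U X) (hY : SmoothField U Y) :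
    SmoothField U (fun x ↦ X x + Y x) := ContMDiffOn.add_section hX hY

lemma SmoothField.sub {X Y : Π x : M, Tan n x} (hX : SmoothField U X) (hY : SmoothField U Y) :
    SmoothField U (fun x ↦ X x - Y x) := ContMDiffOn.sub_section hX hY

lemma SmoothField.neg {X : Π x : M, Tan n x} (hX : SmoothField U X) :
    SmoothField U (fun x ↦ - X x) := ContMDiffOn.neg_section hX

lemma SmoothField.smul {f : M → ℝ} {X : Π x : M, Tan n x} (hf : SmoothFun n U f)
    (hX : SmoothField U X) : SmoothField U (fun x ↦ f x • X x) := ContMDiffOn.smul_section hf hX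

lemma SmoothField.sum {ι : Type*} {s : Finset ι} {X : ι → Π x : M, Tan n x}
    (hX : ∀ i ∈ s, SmoothField U (X i)) : SmoothField U (fun x ↦ ∑ i ∈ s, X i x) :=
  ContMDiffOn.sum_section hX

lemma SmoothForm.mono {V : Set M} {η : Π x : M, Tan n x →L[ℝ] ℝ} (h : SmoothForm U η)
    (hV : V ⊆ U) : SmoothForm V η := ContMDiffOn.mono h hV

lemma SmoothForm.apply {η : Π x : M, Tan n x →L[ℝ] ℝ} {X : Π x : M, Tan n x}
    (hη : SmoothForm U η) (hX : SmoothField U X) : SmoothFun n U (fun x ↦ η x (X x)) := by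
  have := ContMDiffOn.clm_bundle_apply (F₁ := EuclideanSpace ℝ (Fin (4 * n + 3))) (F₂ := ℝ)
    (E₁ := fun x : M ↦ Tan n x) (E₂ := Trivial M ℝ) (ϕ := η) (v := X) (b := fun x ↦ x) hη hX
  intro x hx
  have h2 := this x hx
  rw [Bundle.contMDiffWithinAt_section] at h2
  exact h2

lemma SmoothFun.add {f h : M → ℝ} (hf : SmoothFun n U f) (hh : SmoothFun n U h) :
    SmoothFun n U (fun x ↦ f x + h x) := ContMDiffOn.add hf hh

lemma SmoothFun.sub {f h : M → ℝ} (hf : SmoothFun n U f) (hh : SmoothFun n U h) :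
    SmoothFun n U (fun x ↦ f x - h x) := ContMDiffOn.sub hf hh

lemma SmoothFun.mul {f h : M → ℝ} (hf : SmoothFun n U f) (hh : SmoothFun n U h) :
    SmoothFun n U (fun x ↦ f x * h x) := ContMDiffOn.mul hf hh

lemma smoothFun_const (c : ℝ) : SmoothFun n U (fun _ ↦ c) := contMDiffOn_const

lemma smoothField_bracket {X Y : Π x : M, Tan n x} (hX : SmoothField U X) (hY : SmoothField U Y)
    (hU : IsOpen U) : SmoothField U (bracket X Y) := fun x hx ↦ by
  have : IsManifold (𝓡 (4 * n + 3)) ((⊤ : ℕ∞) + 1) M := by simpa using ‹IsManifold _ ∞ M›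
  have : IsManifold (𝓡 (4 * n + 3)) (minSmoothness ℝ 2) M := by
    simpa using IsManifold.of_le (m := 2) (n := ∞) (WithTop.coe_le_coe.2 (le_top : (2 : ℕ∞) ≤ ⊤))
  refine (ContMDiffAt.mlieBracket_vectorField (m := (⊤ : ℕ∞)) (n := (⊤ : ℕ∞))
    (hX.contMDiffAt hU hx) (hY.contMDiffAt hU hx) ?_).contMDiffWithinAt
  simp

/-- `ext v` is constant in the trivialisation at `x`, so one domain `W` serves all `v` at once.
Frames are later restricted to such a `W`. -/
lemma exists_smooth_ext (x : M) : ∃ W : Set M, IsOpen W ∧ x ∈ W ∧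
    ∀ v : Tan n x, SmoothField W (ext v) := by
  refine ⟨(trivializationAt (EuclideanSpace ℝ (Fin (4 * n + 3))) (fun x : M ↦ Tan n x) x).baseSet,
    Trivialization.open_baseSet _, FiberBundle.mem_baseSet_trivializationAt' x, fun v y hy ↦ ?_⟩
  set t := trivializationAt (EuclideanSpace ℝ (Fin (4 * n + 3))) (fun x : M ↦ Tan n x) x
  suffices h : ContMDiffOn (𝓡 (4 * n + 3)) 𝓘(ℝ, EuclideanSpace ℝ (Fin (4 * n + 3))) ∞
      (fun y ↦ (t ⟨y, ext v y⟩).2) t.baseSet by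
    have := h y hy
    rwa [← t.contMDiffWithinAt_section _ hy] at this
  have : ContMDiffOn (𝓡 (4 * n + 3)) 𝓘(ℝ, EuclideanSpace ℝ (Fin (4 * n + 3))) ∞
    (fun _ ↦ (t ⟨x, v⟩).2) t.baseSet := contMDiffOn_const
  refine this.congr (fun z hz ↦ ?_)
  change (t ⟨z, t.symm z (t ⟨x, v⟩).2⟩).2 = _
  rw [t.apply_mk_symm hz]

lemma ext_self (v : Tan n x) : ext v x = v := FiberBundle.extend_apply_self ..

section

variable {f h : M → ℝ}

lemma dirDeriv_add (hf : SmoothFun n U f) (hh : SmoothFun n U h) (hU : IsOpen U) (hx : x ∈ U)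
    (u : Tan n x) : dirDeriv n (fun y ↦ f y + h y) x u = dirDeriv n f x u + dirDeriv n h x u := by
  have := mvfderiv_add (hf.mdiffAt hU hx) (hh.mdiffAt hU hx)
  exact congr($this u)

lemma dirDeriv_mul (hf : SmoothFun n U f) (hh : SmoothFun n U h) (hU : IsOpen U) (hx : x ∈ U)
    (u : Tan n x) : dirDeriv n (fun y ↦ f y * h y) x u =
      f x * dirDeriv n h x u + h x * dirDeriv n f x u := by
  have := mvfderiv_mul (hf.mdiffAt hU hx) (hh.mdiffAt hU hx)
  exact congr($this u)

lemma dirDeriv_const (c : ℝ) (u : Tan n x) : dirDeriv n (fun _ ↦ c) x u = 0 := by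
  have := mvfderiv_const (I := 𝓡 (4 * n + 3)) (x := x) c
  exact congr($this u)

lemma dirDeriv_congr (hfh : ∀ y ∈ U, f y = h y) (hU : IsOpen U) (hx : x ∈ U) (u : Tan n x) :
    dirDeriv n f x u = dirDeriv n h x u := by
  have h1 : f =ᶠ[𝓝 x] h := Filter.eventuallyEq_of_mem (hU.mem_nhds hx) hfh
  simp only [dirDeriv, mvfderiv, h1.mfderiv_eq]
  rfl

end

variable {X Y Z : Π x : M, Tan n x} {f : M → ℝ}

lemma bracket_congr {X' Y' : Π x : M, Tan n x} (hX : ∀ y ∈ U, X y = X' y)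
    (hY : ∀ y ∈ U, Y y = Y' y) (hU : IsOpen U) (hx : x ∈ U) :
    bracket X Y x = bracket X' Y' x :=
  Filter.EventuallyEq.mlieBracket_vectorField_eq
    (Filter.eventuallyEq_of_mem (hU.mem_nhds hx) hX)
    (Filter.eventuallyEq_of_mem (hU.mem_nhds hx) hY)

lemma bracket_smul_right (hf : SmoothFun n U f) (hY : SmoothField U Y) (hU : IsOpen U)
    (hx : x ∈ U) : bracket X (fun y ↦ f y • Y y) x =
      dirDeriv n f x (X x) • Y x + f x • bracket X Y x :=
  mlieBracket_smul_right (hf.mdiffAt hU hx) (hY.mdiffAt hU hx)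

lemma bracket_add_right (hY : SmoothField U Y) (hZ : SmoothField U Z) (hU : IsOpen U)
    (hx : x ∈ U) : bracket X (fun y ↦ Y y + Z y) x = bracket X Y x + bracket X Z x :=
  mlieBracket_add_right (hY.mdiffAt hU hx) (hZ.mdiffAt hU hx)

lemma bracket_swap : bracket X Y x = - bracket Y X x := mlieBracket_swap_apply

/-- The Jacobi identity, in cyclic form. -/
lemma bracket_jacobi (hX : SmoothField U X) (hY : SmoothField U Y) (hZ : SmoothField U Z)
    (hU : IsOpen U) (hx : x ∈ U) :
    bracket X (bracket Y Z) x = bracket (bracket X Y) Z x + bracket Y (bracket X Z) x := by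
  have : IsManifold (𝓡 (4 * n + 3)) (minSmoothness ℝ 3) M := by
    simpa using IsManifold.of_le (m := 3) (n := ∞) (WithTop.coe_le_coe.2 (le_top : (3 : ℕ∞) ≤ ⊤))
  have key : ∀ {X : Π x : M, Tan n x}, SmoothField U X →
    ContMDiffAt (𝓡 (4 * n + 3)) (𝓡 (4 * n + 3)).tangent (minSmoothness ℝ 2)
      (fun x ↦ (⟨x, X x⟩ : TangentBundle (𝓡 (4 * n + 3)) M)) x := fun h ↦ by
    simp only [minSmoothness_of_isRCLikeNormedField]
    exact (h.contMDiffAt hU hx).of_le (WithTop.coe_le_coe.2 (le_top : (2 : ℕ∞) ≤ ⊤))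
  exact leibniz_identity_mlieBracket_apply (key hX) (key hY) (key hZ)

end Calculus

section Connection

variable {n : ℕ} {M : Type*} [TopologicalSpace M]
  [ChartedSpace (EuclideanSpace ℝ (Fin (4 * n + 3))) M] [IsManifold (𝓡 (4 * n + 3)) ∞ M]
  {U : Set M} {x : M}

/-! ### Calculus of connections -/

lemma smoothFun_dirDeriv {f : M → ℝ} {X : Π x : M, Tan n x} (hf : SmoothFun n U f)
    (hX : SmoothField U X) (hU : IsOpen U) : SmoothFun n U (fun y ↦ dirDeriv n f y (X y)) := by
  have h1 := ContMDiffOn.contMDiffOn_tangentMapWithin (m := ∞) hf (by simp) hU.uniqueMDiffOn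
  have h2 := h1.comp hX (fun y hy ↦ hy)
  intro y hy
  have h3 := (h2 y hy)
  rw [contMDiffWithinAt_totalSpace] at h3
  have h4 := h3.2
  simp at h4
  refine h4.congr (fun z hz ↦ ?_) ?_
  · simp only [dirDeriv, mvfderiv, mfderivWithin_of_isOpen hU hz]
    rfl
  · simp only [dirDeriv, mvfderiv, mfderivWithin_of_isOpen hU hy]
    rfl

variable (cov : Conn n M) {X Y Z : Π x : M, Tan n x} {f : M → ℝ}

lemma cov_add (hX : SmoothField U X) (hY : SmoothField U Y) (hU : IsOpen U) (hx : x ∈ U)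
    (u : Tan n x) : cov (fun y ↦ X y + Y y) x u = cov X x u + cov Y x u :=
  congr($(cov.isCovariantDerivativeOn.add (hX.mdiffAt hU hx) (hY.mdiffAt hU hx)) u)

lemma cov_smul (hf : SmoothFun n U f) (hX : SmoothField U X) (hU : IsOpen U) (hx : x ∈ U)
    (u : Tan n x) : cov (fun y ↦ f y • X y) x u = f x • cov X x u + dirDeriv n f x u • X x :=
  congr($(cov.isCovariantDerivativeOn.leibniz (hX.mdiffAt hU hx) (hf.mdiffAt hU hx)) u)

lemma cov_congr (hX : SmoothField U X) (hXY : ∀ y ∈ U, Y y = X y) (hU : IsOpen U) (hx : x ∈ U)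
    (u : Tan n x) : cov Y x u = cov X x u :=
  congr($(cov.isCovariantDerivativeOn.congr_of_eqOn (s := U) ((hX.congr hXY).mdiffAt hU hx)
    (hX.mdiffAt hU hx) (hU.mem_nhds hx) hXY) u)

lemma cov_neg (hX : SmoothField U X) (hU : IsOpen U) (hx : x ∈ U)
    (u : Tan n x) : cov (fun y ↦ -X y) x u = -cov X x u := by
  have := cov_smul cov (smoothFun_const (-1)) hX hU hx u
  simpa [dirDeriv_const] using this

lemma cov_sub (hX : SmoothField U X) (hY : SmoothField U Y) (hU : IsOpen U) (hx : x ∈ U)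
    (u : Tan n x) : cov (fun y ↦ X y - Y y) x u = cov X x u - cov Y x u := by
  have := cov_add cov hX hY.neg hU hx u
  rw [cov_neg cov hY hU hx] at this
  simpa [sub_eq_add_neg] using this

lemma cov_sum {ι : Type*} {s : Finset ι} {X : ι → Π x : M, Tan n x}
    (hX : ∀ i ∈ s, SmoothField U (X i)) (hU : IsOpen U) (hx : x ∈ U) (u : Tan n x) :
    cov (fun y ↦ ∑ i ∈ s, X i y) x u = ∑ i ∈ s, cov (X i) x u := by
  classical
  induction s using Finset.induction_on with
  | empty =>
    have h0 : (fun y : M ↦ (∑ i ∈ (∅ : Finset ι), X i y : Tan n y)) = 0 := by ext1; simp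
    rw [h0]; simp
  | insert a s ha ih =>
    simp only [Finset.mem_insert, forall_eq_or_imp] at hX
    simp only [Finset.sum_insert ha]
    rw [cov_add cov hX.1 (SmoothField.sum hX.2) hU hx, ih hX.2]

variable [T2Space M] (hc : cov.ContMDiffCovariantDerivative ∞)

include hc

/-- The covariant differential of a smooth field is a smooth section of the bundle of
endomorphisms. -/
lemma contMDiffAt_cov (hX : SmoothField U X) (hU : IsOpen U) (hx : x ∈ U) :
    ContMDiffAt (𝓡 (4 * n + 3)) ((𝓡 (4 * n + 3)).prod 𝓘(ℝ, EuclideanSpace ℝ (Fin (4 * n + 3)) →L[ℝ]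
      EuclideanSpace ℝ (Fin (4 * n + 3)))) ∞
      (fun x ↦ TotalSpace.mk' (EuclideanSpace ℝ (Fin (4 * n + 3)) →L[ℝ]
      EuclideanSpace ℝ (Fin (4 * n + 3)))
      (E := fun x : M ↦ (Tan n x →L[ℝ] Tan n x)) x (cov X x)) x := by
  -- Smoothness of the connection is used in the form that speaks of fields smooth on all of `M`, so
  -- `X` is multiplied by a bump function supported in `U`. Near `x` the function is `1`, and `cov`
  -- is local.
  obtain ⟨b, -, hb⟩ := (SmoothBumpFunction.nhds_basis_tsupport (I := 𝓡 (4 * n + 3)) x).mem_iff.1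
    (hU.mem_nhds hx)
  have hs : ContMDiff (𝓡 (4 * n + 3)) (𝓡 (4 * n + 3)).tangent ∞
      (fun y ↦ (⟨y, ((b : M → ℝ) • X) y⟩ : TangentBundle (𝓡 (4 * n + 3)) M)) :=
    ContMDiffOn.smul_section_of_tsupport b.contMDiff.contMDiffOn hU hb hX
  have h1 := hc.contMDiff.contMDiff (σ := (b : M → ℝ) • X) (hs.contMDiffOn)
  refine ((h1 x trivial).contMDiffAt Filter.univ_mem).congr_of_eventuallyEq ?_
  obtain ⟨W, hW, hWo, hxW⟩ := eventually_nhds_iff.1 (b.eventuallyEq_one)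
  filter_upwards [(hWo.inter hU).mem_nhds ⟨hxW, hx⟩] with y hy
  congr 1
  ext u
  refine (cov_congr cov (U := W ∩ U) (hX.mono Set.inter_subset_right) (fun z hz ↦ ?_)
    (hWo.inter hU) hy u).symm
  simp [hW z hz.1]

lemma smoothField_cov (hX : SmoothField U X) (hY : SmoothField U Y) (hU : IsOpen U) :
    SmoothField U (fun y ↦ cov X y (Y y)) := fun _ hx ↦
  (ContMDiffAt.clm_bundle_apply (contMDiffAt_cov cov hc hX hU hx)
    (hY.contMDiffAt hU hx)).contMDiffWithinAt

omit hc [T2Space M] in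
lemma exists_smooth_ne_zero (x : M) : ∃ W : Set M, IsOpen W ∧ x ∈ W ∧
    ∃ X : Π x : M, Tan n x, SmoothField W X ∧ X x ≠ 0 := by
  obtain ⟨W, hW, hx, h⟩ := exists_smooth_ext (n := n) x
  have : Nontrivial (Tan n x) := Module.nontrivial_of_finrank_pos (R := ℝ)
    ((finrank_euclideanSpace_fin (𝕜 := ℝ) (n := 4 * n + 3)).symm ▸ Nat.succ_pos _)
  obtain ⟨v, hv⟩ := exists_ne (0 : Tan n x)
  exact ⟨W, hW, hx, ext v, h v, (ext_self v).symm ▸ hv⟩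

omit hc [T2Space M] in
/-- The Lie bracket acts on functions as the commutator of derivations. -/
lemma dirDeriv_bracket (hX : SmoothField U X) (hY : SmoothField U Y) (hf : SmoothFun n U f)
    (hU : IsOpen U) (hx : x ∈ U) :
    dirDeriv n f x (bracket X Y x) = dirDeriv n (fun y ↦ dirDeriv n f y (Y y)) x (X x) -
      dirDeriv n (fun y ↦ dirDeriv n f y (X y)) x (Y x) := by
  -- The Jacobi identity for `X, Y, f Z`, reduced by the one for `X, Y, Z`, leaves the difference of
  -- the two sides as the coefficient of `Z x`, which is nonzero.
  obtain ⟨W, hW, hxW, Z, hZ, hZ0⟩ := exists_smooth_ne_zero (n := n) x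
  have hU' := hU.inter hW
  have hx' : x ∈ U ∩ W := ⟨hx, hxW⟩
  replace hX := hX.mono (Set.inter_subset_left (t := W))
  replace hY := hY.mono (Set.inter_subset_left (t := W))
  replace hZ := hZ.mono (Set.inter_subset_right (s := U))
  replace hf : SmoothFun n (U ∩ W) f := ContMDiffOn.mono hf Set.inter_subset_left
  generalize U ∩ W = U' at *
  have hXf := smoothFun_dirDeriv hf hX hU'
  have hYf := smoothFun_dirDeriv hf hY hU'
  have e : ∀ {A : Π x : M, Tan n x}, ∀ y ∈ U', bracket A (fun y ↦ f y • Z y) y =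
      dirDeriv n f y (A y) • Z y + f y • bracket A Z y :=
    fun y hy ↦ bracket_smul_right hf hZ hU' hy
  have j1 := bracket_jacobi hX hY (hZ.smul hf) hU' hx'
  have j0 := bracket_jacobi hX hY hZ hU' hx'
  rw [bracket_congr (X' := X) (fun _ _ ↦ rfl) (e (A := Y)) hU' hx',
    bracket_congr (X' := Y) (fun _ _ ↦ rfl) (e (A := X)) hU' hx', e x hx',
    bracket_add_right (hZ.smul hYf) (.smul hf (smoothField_bracket hY hZ hU')) hU' hx',
    bracket_add_right (hZ.smul hXf) (.smul hf (smoothField_bracket hX hZ hU')) hU' hx',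
    bracket_smul_right hYf hZ hU' hx', bracket_smul_right hXf hZ hU' hx',
    bracket_smul_right hf (smoothField_bracket hY hZ hU') hU' hx',
    bracket_smul_right hf (smoothField_bracket hX hZ hU') hU' hx', j0] at j1
  have key : (dirDeriv n f x (bracket X Y x) - (dirDeriv n (fun y ↦ dirDeriv n f y (Y y)) x (X x) -
      dirDeriv n (fun y ↦ dirDeriv n f y (X y)) x (Y x))) • Z x = 0 := by
    rw [← sub_eq_zero] at j1
    rw [← neg_eq_zero, ← j1]
    module
  exact sub_eq_zero.1 ((smul_eq_zero.1 key).resolve_right hZ0)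

/-! ### Curvature on fields -/

/-- The curvature of a connection as an operation on vector fields. -/
noncomputable def fieldCurv (X Y Z : Π x : M, Tan n x) (x : M) : Tan n x :=
  cov (fun y ↦ cov Z y (Y y)) x (X x) - cov (fun y ↦ cov Z y (X y)) x (Y x)
    - cov Z x (bracket X Y x)

omit hc [T2Space M] in
lemma curv_eq_fieldCurv (u v w : Tan n x) :
    curv cov x u v w = fieldCurv cov (ext u) (ext v) (ext w) x := by
  simp only [curv, fieldCurv, ext_self]

omit hc [T2Space M] in
lemma fieldCurv_swap : fieldCurv cov X Y Z x = - fieldCurv cov Y X Z x := by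
  simp only [fieldCurv]
  rw [bracket_swap, map_neg]
  abel

lemma mdiffAt_cov_apply (hZ : SmoothField U Z) (hU : IsOpen U) (hx : x ∈ U)
    (hX : MDifferentiableAt (𝓡 (4 * n + 3)) (𝓡 (4 * n + 3)).tangent
      (fun x ↦ (⟨x, X x⟩ : TangentBundle (𝓡 (4 * n + 3)) M)) x) :
    MDifferentiableAt (𝓡 (4 * n + 3)) (𝓡 (4 * n + 3)).tangent
      (fun x ↦ (⟨x, cov Z x (X x)⟩ : TangentBundle (𝓡 (4 * n + 3)) M)) x :=
  MDifferentiableAt.clm_bundle_apply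
    ((contMDiffAt_cov cov hc hZ hU hx).mdifferentiableAt (by simp)) hX

/-- The derivative of `f` produced by the Leibniz rule in the second term cancels the one produced
by the bracket. `TensorialAt` tests functions and fields that are merely differentiable at `x`,
hence the pointwise `mdiffAt_cov_apply` in place of smoothness on open sets. -/
lemma tensorialAt_fieldCurv (hZ : SmoothField U Z) (hU : IsOpen U) (hx : x ∈ U)
    (Y : Π x : M, Tan n x) : TensorialAt (𝓡 (4 * n + 3)) (EuclideanSpace ℝ (Fin (4 * n + 3)))
      (V := fun x : M ↦ Tan n x) (fun X ↦ fieldCurv cov X Y Z x) x where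
  smul := by
    intro f X hf hX
    have h1 := congr($(cov.isCovariantDerivativeOn.leibniz
      (mdiffAt_cov_apply cov hc hZ hU hx hX) hf) (Y x))
    have h2 : cov (fun y ↦ cov Z y ((f • X) y)) x (Y x) =
      f x • cov (fun y ↦ cov Z y (X y)) x (Y x) + dirDeriv n f x (Y x) • cov Z x (X x) := by
      refine Eq.trans ?_ h1
      congr 2
      ext1 y
      simp
    simp only [fieldCurv, bracket]
    rw [h2, mlieBracket_smul_left hf hX]
    simp only [Pi.smul_apply', map_smul, map_add, dirDeriv]
    module
  add := by
    intro X X' hX hX'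
    have h1 := congr($(cov.isCovariantDerivativeOn.add
      (mdiffAt_cov_apply cov hc hZ hU hx hX) (mdiffAt_cov_apply cov hc hZ hU hx hX')) (Y x))
    have h2 : cov (fun y ↦ cov Z y ((X + X') y)) x (Y x) =
      cov (fun y ↦ cov Z y (X y)) x (Y x) + cov (fun y ↦ cov Z y (X' y)) x (Y x) := by
      refine Eq.trans ?_ h1
      congr 2
      ext1 y
      simp
    simp only [fieldCurv, bracket]
    rw [h2, mlieBracket_add_left hX hX']
    simp only [Pi.add_apply, map_add]
    module

lemma fieldCurv_congr₁₂ {X' Y' : Π x : M, Tan n x} (hX : SmoothField U X) (hX' : SmoothField U X')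
    (hY : SmoothField U Y) (hY' : SmoothField U Y') (hZ : SmoothField U Z) (hU : IsOpen U)
    (hx : x ∈ U) (h : X x = X' x) (h' : Y x = Y' x) :
    fieldCurv cov X Y Z x = fieldCurv cov X' Y' Z x := by
  rw [(tensorialAt_fieldCurv cov hc hZ hU hx Y).pointwise (hX.mdiffAt hU hx) (hX'.mdiffAt hU hx) h,
    fieldCurv_swap, fieldCurv_swap (X := X'),
    (tensorialAt_fieldCurv cov hc hZ hU hx X').pointwise (hY.mdiffAt hU hx) (hY'.mdiffAt hU hx) h']

lemma fieldCurv_add₃ {Z' : Π x : M, Tan n x} (hX : SmoothField U X) (hY : SmoothField U Y)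
    (hZ : SmoothField U Z) (hZ' : SmoothField U Z') (hU : IsOpen U) (hx : x ∈ U) :
    fieldCurv cov X Y (fun y ↦ Z y + Z' y) x = fieldCurv cov X Y Z x + fieldCurv cov X Y Z' x := by
  have e : ∀ {A : Π x : M, Tan n x}, SmoothField U A → ∀ u : Tan n x,
      cov (fun y ↦ cov (fun y ↦ Z y + Z' y) y (A y)) x u =
      cov (fun y ↦ cov Z y (A y)) x u + cov (fun y ↦ cov Z' y (A y)) x u := fun {A} hA u ↦ by
    rw [← cov_add cov (smoothField_cov cov hc hZ hA hU) (smoothField_cov cov hc hZ' hA hU) hU hx]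
    exact cov_congr cov (.add (smoothField_cov cov hc hZ hA hU) (smoothField_cov cov hc hZ' hA hU))
      (fun y hy ↦ cov_add cov hZ hZ' hU hy _) hU hx u
  simp only [fieldCurv, e hX, e hY, cov_add cov hZ hZ' hU hx]
  abel

/-- First derivatives of `f` are symmetric in `X, Y`, and the second derivatives combine to the
commutator of derivations, which `dirDeriv_bracket` cancels against the bracket term. -/
lemma fieldCurv_smul₃ (hX : SmoothField U X) (hY : SmoothField U Y)
    (hZ : SmoothField U Z) (hf : SmoothFun n U f) (hU : IsOpen U) (hx : x ∈ U) :
    fieldCurv cov X Y (fun y ↦ f y • Z y) x = f x • fieldCurv cov X Y Z x := by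
  have e : ∀ {A : Π x : M, Tan n x}, SmoothField U A → ∀ u : Tan n x,
      cov (fun y ↦ cov (fun y ↦ f y • Z y) y (A y)) x u =
      f x • cov (fun y ↦ cov Z y (A y)) x u + dirDeriv n f x u • cov Z x (A x) +
      (dirDeriv n f x (A x) • cov Z x u +
        dirDeriv n (fun y ↦ dirDeriv n f y (A y)) x u • Z x) := fun {A} hA u ↦ by
    have h1 := smoothField_cov cov hc hZ hA hU
    have h2 := smoothFun_dirDeriv hf hA hU
    rw [← cov_smul cov h2 hZ hU hx, ← cov_smul cov hf h1 hU hx,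
      ← cov_add cov (.smul hf h1) (.smul h2 hZ) hU hx]
    exact cov_congr cov (.add (.smul hf h1) (.smul h2 hZ))
      (fun y hy ↦ cov_smul cov hf hZ hU hy _) hU hx u
  simp only [fieldCurv, e hX, e hY, cov_smul cov hf hZ hU hx, dirDeriv_bracket hX hY hf hU hx]
  module

lemma fieldCurv_sum₃ {ι : Type*} {s : Finset ι} {Z : ι → Π x : M, Tan n x}
    (hX : SmoothField U X) (hY : SmoothField U Y)
    (hZ : ∀ i ∈ s, SmoothField U (Z i)) (hU : IsOpen U) (hx : x ∈ U) :
    fieldCurv cov X Y (fun y ↦ ∑ i ∈ s, Z i y) x = ∑ i ∈ s, fieldCurv cov X Y (Z i) x := by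
  classical
  induction s using Finset.induction_on with
  | empty =>
    have h0 : (fun y : M ↦ (∑ i ∈ (∅ : Finset ι), Z i y : Tan n y)) = 0 := by ext1; simp
    rw [h0, Finset.sum_empty]
    have h1 : ∀ A : Π x : M, Tan n x, cov (fun y ↦ cov (0 : Π x : M, Tan n x) y (A y)) = 0 := by
      intro A
      rw [show (fun y ↦ cov (0 : Π x : M, Tan n x) y (A y)) = 0 by ext1 y; simp, cov.zero]
    simp only [fieldCurv]
    rw [h1, h1, cov.zero]
    simp
  | insert a s ha ih =>
    simp only [Finset.mem_insert, forall_eq_or_imp] at hZ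
    simp only [Finset.sum_insert ha]
    rw [fieldCurv_add₃ cov hc hX hY hZ.1 (SmoothField.sum hZ.2) hU hx, ih hZ.2]

omit hc [T2Space M] in
lemma fieldCurv_congr_of_eqOn {Z' : Π x : M, Tan n x} (hX : SmoothField U X) (hY : SmoothField U Y)
    (hZ : SmoothField U Z) (hc : cov.ContMDiffCovariantDerivative ∞) [T2Space M] (hU : IsOpen U)
    (hx : x ∈ U) (h : ∀ y ∈ U, Z' y = Z y) : fieldCurv cov X Y Z' x = fieldCurv cov X Y Z x := by
  simp only [fieldCurv]
  rw [cov_congr cov (smoothField_cov cov hc hZ hX hU) (fun y hy ↦ cov_congr cov hZ h hU hy _) hU hx,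
    cov_congr cov (smoothField_cov cov hc hZ hY hU) (fun y hy ↦ cov_congr cov hZ h hU hy _) hU hx,
    cov_congr cov hZ h hU hx]

/-- The third argument is differentiated twice, so a tensoriality criterion for differentiable
fields does not apply. Instead `Z` is expanded in a smooth local frame, and linearity over smooth
functions leaves only the coefficients at `x`. -/
lemma fieldCurv_congr₃ {Z' : Π x : M, Tan n x} (hX : SmoothField U X) (hY : SmoothField U Y)
    (hZ : SmoothField U Z) (hZ' : SmoothField U Z') (hU : IsOpen U) (hx : x ∈ U)
    (h : Z x = Z' x) : fieldCurv cov X Y Z x = fieldCurv cov X Y Z' x := by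
  set t := trivializationAt (EuclideanSpace ℝ (Fin (4 * n + 3))) (fun x : M ↦ Tan n x) x
  have x_mem : x ∈ t.baseSet := FiberBundle.mem_baseSet_trivializationAt' x
  let b := (EuclideanSpace.basisFun (Fin (4 * n + 3)) ℝ).toBasis
  have hW : IsOpen (U ∩ t.baseSet) := hU.inter t.open_baseSet
  have hxW : x ∈ U ∩ t.baseSet := ⟨hx, x_mem⟩
  have hs : ∀ i, SmoothField (U ∩ t.baseSet) (t.localFrame b i) := fun i ↦
    (t.contMDiffOn_localFrame_baseSet (I := 𝓡 (4 * n + 3)) (b := b) ∞ i).mono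
      Set.inter_subset_right
  have hX' := hX.mono (Set.inter_subset_left (t := t.baseSet))
  have hY' := hY.mono (Set.inter_subset_left (t := t.baseSet))
  have key : ∀ {A : Π x : M, Tan n x}, SmoothField U A → fieldCurv cov X Y A x =
      ∑ i, t.localFrameCoeff (𝓡 (4 * n + 3)) b i x (A x) •
        fieldCurv cov X Y (t.localFrame b i) x := fun {A} hA ↦ by
    replace hA := hA.mono (Set.inter_subset_left (t := t.baseSet))
    have hcf : ∀ i, SmoothFun n (U ∩ t.baseSet)
        (fun y ↦ t.localFrameCoeff (𝓡 (4 * n + 3)) b i y (A y)) := fun i ↦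
      contMDiffOn_localFrameCoeff b hW Set.inter_subset_right hA i
    rw [fieldCurv_congr_of_eqOn cov hX' hY' (SmoothField.sum (s := Finset.univ)
      (fun i _ ↦ SmoothField.smul (hcf i) (hs i))) hc hW hxW
      (fun y hy ↦ t.eq_sum_localFrameCoeff_smul (I := 𝓡 (4 * n + 3)) (b := b) (s := A) hy.2),
      fieldCurv_sum₃ cov hc hX' hY' (fun i _ ↦ SmoothField.smul (hcf i) (hs i)) hW hxW]
    exact Finset.sum_congr rfl fun i _ ↦ fieldCurv_smul₃ cov hc hX' hY' (hs i) (hcf i) hW hxW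
  rw [key hZ, key hZ', h]

/-- The curvature tensor may be computed with arbitrary smooth extensions. -/
lemma fieldCurv_eq_curv (hX : SmoothField U X) (hY : SmoothField U Y)
    (hZ : SmoothField U Z) (hU : IsOpen U) (hx : x ∈ U) :
    fieldCurv cov X Y Z x = curv cov x (X x) (Y x) (Z x) := by
  obtain ⟨W, hW, hxW, he⟩ := exists_smooth_ext (n := n) x
  have l := Set.inter_subset_left (s := U) (t := W)
  have r := Set.inter_subset_right (s := U) (t := W)
  rw [curv_eq_fieldCurv, fieldCurv_congr₁₂ cov hc (hX.mono l) ((he (X x)).mono r) (hY.mono l)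
      ((he (Y x)).mono r) (hZ.mono l) (hU.inter hW) ⟨hx, hxW⟩ (ext_self _).symm (ext_self _).symm,
    fieldCurv_congr₃ cov hc ((he (X x)).mono r) ((he (Y x)).mono r) (hZ.mono l)
      ((he (Z x)).mono r) (hU.inter hW) ⟨hx, hxW⟩ (ext_self _).symm]

omit hc [T2Space M] in
lemma curv_swap (u v w : Tan n x) : curv cov x u v w = - curv cov x v u w := by
  rw [curv_eq_fieldCurv, fieldCurv_swap, curv_eq_fieldCurv]

lemma curv_add₁ (u u' v w : Tan n x) :
    curv cov x (u + u') v w = curv cov x u v w + curv cov x u' v w := by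
  obtain ⟨W, hW, hxW, he⟩ := exists_smooth_ext (n := n) x
  have h1 := (tensorialAt_fieldCurv cov hc (he w) hW hxW (ext v)).add
    ((he u).mdiffAt hW hxW) ((he u').mdiffAt hW hxW)
  have h2 := fieldCurv_eq_curv cov hc ((he u).add (he u')) (he v) (he w) hW hxW
  simp only [ext_self] at h2
  rw [← h2, curv_eq_fieldCurv, curv_eq_fieldCurv, ← h1]
  rfl

lemma curv_smul₁ (c : ℝ) (u v w : Tan n x) :
    curv cov x (c • u) v w = c • curv cov x u v w := by
  obtain ⟨W, hW, hxW, he⟩ := exists_smooth_ext (n := n) x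
  have h1 := (tensorialAt_fieldCurv cov hc (he w) hW hxW (ext v)).smul
    ((smoothFun_const c).mdiffAt hW hxW) ((he u).mdiffAt hW hxW)
  have h2 := fieldCurv_eq_curv cov hc (.smul (smoothFun_const c) (he u)) (he v) (he w) hW hxW
  simp only [ext_self] at h2
  rw [← h2, curv_eq_fieldCurv, ← h1]
  rfl

lemma curv_add₃ (u v w w' : Tan n x) :
    curv cov x u v (w + w') = curv cov x u v w + curv cov x u v w' := by
  obtain ⟨W, hW, hxW, he⟩ := exists_smooth_ext (n := n) x
  have h1 := fieldCurv_add₃ cov hc (he u) (he v) (he w) (he w') hW hxW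
  have h2 := fieldCurv_eq_curv cov hc (he u) (he v) ((he w).add (he w')) hW hxW
  simp only [ext_self] at h2
  rw [← h2, curv_eq_fieldCurv, curv_eq_fieldCurv, ← h1]

lemma curv_smul₃ (c : ℝ) (u v w : Tan n x) :
    curv cov x u v (c • w) = c • curv cov x u v w := by
  obtain ⟨W, hW, hxW, he⟩ := exists_smooth_ext (n := n) x
  have h1 := fieldCurv_smul₃ cov hc (he u) (he v) (he w) (smoothFun_const c) hW hxW
  have h2 := fieldCurv_eq_curv cov hc (he u) (he v) (.smul (smoothFun_const c) (he w)) hW hxW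
  simp only [ext_self] at h2
  rw [← h2, curv_eq_fieldCurv, ← h1]

lemma curv_add₂ (u v v' w : Tan n x) :
    curv cov x u (v + v') w = curv cov x u v w + curv cov x u v' w := by
  rw [curv_swap cov u (v + v'), curv_swap cov u v, curv_swap cov u v', curv_add₁ cov hc, neg_add]

lemma curv_smul₂ (c : ℝ) (u v w : Tan n x) :
    curv cov x u (c • v) w = c • curv cov x u v w := by
  rw [curv_swap cov u (c • v), curv_swap cov u v, curv_smul₁ cov hc, smul_neg]

/-- The curvature at a point as an endomorphism of the tangent space. -/
noncomputable def curvEnd (x : M) (u v : Tan n x) : Module.End ℝ (Tan n x) where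
  toFun w := curv cov x u v w
  map_add' w w' := curv_add₃ cov hc u v w w'
  map_smul' c w := curv_smul₃ cov hc c u v w

/-- The curvature tensor at a point as a trilinear map. -/
noncomputable def curvLin (x : M) : Tan n x →ₗ[ℝ] Tan n x →ₗ[ℝ] Module.End ℝ (Tan n x) :=
  LinearMap.mk₂ ℝ (curvEnd cov hc x)
    (fun u u' v ↦ LinearMap.ext fun w ↦ curv_add₁ cov hc u u' v w)
    (fun c u v ↦ LinearMap.ext fun w ↦ curv_smul₁ cov hc c u v w)
    (fun u v v' ↦ LinearMap.ext fun w ↦ curv_add₂ cov hc u v v' w)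
    (fun c u v ↦ LinearMap.ext fun w ↦ curv_smul₂ cov hc c u v w)

/-! ### Torsion and the first Bianchi identity -/

omit hc [T2Space M] in
lemma torsion_eq (hX : SmoothField U X) (hY : SmoothField U Y) (hU : IsOpen U) (hx : x ∈ U) :
    cov.torsion x (X x) (Y x) = cov Y x (X x) - cov X x (Y x) - bracket X Y x :=
  cov.torsion_apply (hX.mdiffAt hU hx) (hY.mdiffAt hU hx)

lemma smoothField_torsion (hX : SmoothField U X) (hY : SmoothField U Y) (hU : IsOpen U) :
    SmoothField U (fun y ↦ cov.torsion y (X y) (Y y)) :=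
  SmoothField.congr ((((smoothField_cov cov hc hY hX hU).sub (smoothField_cov cov hc hX hY hU)).sub
    (smoothField_bracket hX hY hU))) fun _ hy ↦ torsion_eq cov hX hY hU hy

/-- The covariant derivative `(∇_u T)(Y, Z)` of the torsion, on fields. -/
noncomputable def covTorsion (Y Z : Π x : M, Tan n x) (x : M) (u : Tan n x) : Tan n x :=
  cov (fun y ↦ cov.torsion y (Y y) (Z y)) x u - cov.torsion x (cov Y x u) (Z x)
    - cov.torsion x (Y x) (cov Z x u)

omit hc [T2Space M] in
lemma bracket_cyclic (hX : SmoothField U X) (hY : SmoothField U Y) (hZ : SmoothField U Z)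
    (hU : IsOpen U) (hx : x ∈ U) :
    bracket (bracket X Y) Z x + bracket (bracket Y Z) X x + bracket (bracket Z X) Y x = 0 := by
  have j := bracket_jacobi hX hY hZ hU hx
  rw [bracket_swap (X := X) (Y := bracket Y Z), bracket_swap (X := Y) (Y := bracket X Z)] at j
  have h1 : SmoothField U (bracket Z X) := smoothField_bracket hZ hX hU
  have h2 : bracket (bracket X Z) Y x = bracket (fun y ↦ (-1 : ℝ) • bracket Z X y) Y x :=
    bracket_congr (fun y hy ↦ by rw [bracket_swap]; simp) (fun _ _ ↦ rfl) hU hx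
  rw [h2, bracket_swap (X := fun y ↦ (-1 : ℝ) • bracket Z X y),
    bracket_smul_right (smoothFun_const (-1)) h1 hU hx, dirDeriv_const,
    bracket_swap (X := Y)] at j
  rw [← sub_eq_zero] at j
  rw [← neg_eq_zero, ← j]
  module

omit [T2Space M] hc in
lemma torsion_torsion_eq (hX : SmoothField U X) (hY : SmoothField U Y) (hZ : SmoothField U Z)
    (hU : IsOpen U) (hx : x ∈ U) : cov.torsion x (cov.torsion x (X x) (Y x)) (Z x) =
      cov.torsion x (cov Y x (X x)) (Z x) + cov.torsion x (Z x) (cov X x (Y x)) -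
      (cov Z x (bracket X Y x) - cov (bracket X Y) x (Z x) - bracket (bracket X Y) Z x) := by
  rw [torsion_eq cov hX hY hU hx, map_sub, map_sub, sub_apply,
    sub_apply, torsion_eq cov (smoothField_bracket hX hY hU) hZ hU hx,
    cov.torsion_antisymm (Z x) (cov X x (Y x))]
  abel

lemma covTorsion_eq (hY : SmoothField U Y) (hZ : SmoothField U Z) (hU : IsOpen U) (hx : x ∈ U)
    (u : Tan n x) : covTorsion cov Y Z x u = cov (fun y ↦ cov Z y (Y y)) x u -
        cov (fun y ↦ cov Y y (Z y)) x u - cov (bracket Y Z) x u -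
        cov.torsion x (cov Y x u) (Z x) - cov.torsion x (Y x) (cov Z x u) := by
  have h1 := smoothField_cov cov hc hZ hY hU
  have h2 := smoothField_cov cov hc hY hZ hU
  have h3 := smoothField_bracket hY hZ hU
  rw [covTorsion, cov_congr cov ((h1.sub h2).sub h3) (fun y hy ↦ torsion_eq cov hY hZ hU hy) hU hx,
    cov_sub cov (h1.sub h2) h3 hU hx, cov_sub cov h1 h2 hU hx]

/-- The first Bianchi identity for a connection with torsion. -/
lemma first_bianchi (hX : SmoothField U X) (hY : SmoothField U Y) (hZ : SmoothField U Z)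
    (hU : IsOpen U) (hx : x ∈ U) :
    curv cov x (X x) (Y x) (Z x) + curv cov x (Y x) (Z x) (X x) + curv cov x (Z x) (X x) (Y x) =
      covTorsion cov Y Z x (X x) + covTorsion cov Z X x (Y x) + covTorsion cov X Y x (Z x) +
      cov.torsion x (cov.torsion x (X x) (Y x)) (Z x) +
      cov.torsion x (cov.torsion x (Y x) (Z x)) (X x) +
      cov.torsion x (cov.torsion x (Z x) (X x)) (Y x) := by
  have j := bracket_cyclic hX hY hZ hU hx
  rw [← fieldCurv_eq_curv cov hc hX hY hZ hU hx, ← fieldCurv_eq_curv cov hc hY hZ hX hU hx,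
    ← fieldCurv_eq_curv cov hc hZ hX hY hU hx, covTorsion_eq cov hc hX hY hU hx,
    covTorsion_eq cov hc hY hZ hU hx, covTorsion_eq cov hc hZ hX hU hx,
    torsion_torsion_eq cov hX hY hZ hU hx, torsion_torsion_eq cov hY hZ hX hU hx,
    torsion_torsion_eq cov hZ hX hY hU hx]
  simp only [fieldCurv]
  -- All covariant derivatives cancel in the cyclic sum; the double brackets that remain sum to zero
  -- by `bracket_cyclic`.
  rw [← sub_eq_zero, ← neg_eq_zero, ← j]
  abel

end Connection

section Contraction

variable {W : Type*} [AddCommGroup W] [Module ℝ W] [FiniteDimensional ℝ W]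

/-! ### Contractions -/

section

variable (g : LinearMap.BilinForm ℝ W) (P Q : W → W → ℝ)

lemma contr_add : contr g (fun X Y ↦ P X Y + Q X Y) = contr g P + contr g Q := by
  simp only [contr, mul_add, Finset.sum_add_distrib]

lemma contr_smul (c : ℝ) : contr g (fun X Y ↦ c * P X Y) = c * contr g P := by
  simp only [contr, Finset.mul_sum, mul_left_comm]

lemma contr_neg : contr g (fun X Y ↦ -P X Y) = - contr g P := by
  simp only [contr, mul_neg, Finset.sum_neg_distrib]

lemma contr_sub : contr g (fun X Y ↦ P X Y - Q X Y) = contr g P - contr g Q := by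
  simp only [contr, mul_sub, Finset.sum_sub_distrib]

lemma contr_sum {ι : Type*} (s : Finset ι) (P : ι → W → W → ℝ) :
    contr g (fun X Y ↦ ∑ i ∈ s, P i X Y) = ∑ i ∈ s, contr g (P i) := by
  simp only [contr, Finset.mul_sum]
  symm
  rw [Finset.sum_comm]
  exact Finset.sum_congr rfl fun a _ ↦ Finset.sum_comm

variable {P Q} in
lemma contr_congr (h : ∀ X Y, P X Y = Q X Y) : contr g P = contr g Q := by
  simp only [contr, h]

end

variable {g : LinearMap.BilinForm ℝ W} (hs : ∀ X Y, g X Y = g Y X) (hg : g.Nondegenerate)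

include hs in
lemma contr_flip (P : W → W → ℝ) : contr g (fun X Y ↦ P Y X) = contr g P := by
  have h : (LinearMap.BilinForm.toMatrix (Module.finBasis ℝ W) g).transpose =
      LinearMap.BilinForm.toMatrix (Module.finBasis ℝ W) g := by
    ext a b
    simp [LinearMap.BilinForm.toMatrix_apply, hs]
  have h2 : ∀ a b, (LinearMap.BilinForm.toMatrix (Module.finBasis ℝ W) g)⁻¹ a b =
      (LinearMap.BilinForm.toMatrix (Module.finBasis ℝ W) g)⁻¹ b a := fun a b ↦ by
    conv_lhs => rw [← h, ← Matrix.transpose_nonsing_inv]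
    rfl
  simp only [contr]
  rw [Finset.sum_comm]
  simp only [h2]

include hs hg in
/-- The contraction of `g(A·, ·)` is the trace of `A`. -/
lemma contr_apply_eq_trace (A : Module.End ℝ W) :
    contr g (fun X Y ↦ g (A X) Y) = LinearMap.trace ℝ W A := by
  set b := Module.finBasis ℝ W
  have hdet : IsUnit (LinearMap.BilinForm.toMatrix b g).det :=
    isUnit_iff_ne_zero.2 ((LinearMap.BilinForm.nondegenerate_iff_det_ne_zero b).1 hg)
  have h1 : ∀ a c, g (A (b a)) (b c) =
      (LinearMap.BilinForm.toMatrix b g * LinearMap.toMatrix b b A) c a := fun a c ↦ by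
    conv_lhs => rw [← b.sum_repr (A (b a))]
    rw [map_sum, LinearMap.sum_apply, Matrix.mul_apply]
    refine Finset.sum_congr rfl fun d _ ↦ ?_
    rw [map_smul, LinearMap.smul_apply, smul_eq_mul, LinearMap.toMatrix_apply,
      LinearMap.BilinForm.toMatrix_apply, hs, mul_comm]
  rw [LinearMap.trace_eq_matrix_trace ℝ b]
  change ∑ a, ∑ c, (LinearMap.BilinForm.toMatrix b g)⁻¹ a c * g (A (b a)) (b c) = ∑ a, _
  refine Finset.sum_congr rfl fun a _ ↦ ?_
  simp only [h1]
  rw [← Matrix.mul_apply, ← Matrix.mul_assoc, Matrix.nonsing_inv_mul _ hdet, Matrix.one_mul]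
  rfl

/-- The endomorphism representing a bilinear form with respect to `g`. -/
noncomputable def sharp (P : LinearMap.BilinForm ℝ W) : Module.End ℝ W :=
  (g.toDual hg).symm.toLinearMap ∘ₗ P

lemma sharp_apply (P : LinearMap.BilinForm ℝ W) (X Y : W) : g (sharp hg P X) Y = P X Y := by
  rw [sharp, LinearMap.comp_apply]
  exact LinearMap.BilinForm.apply_toDual_symm_apply ..

include hg in
lemma eq_of_forall_g {X X' : W} (h : ∀ Y, g X Y = g X' Y) : X = X' :=
  (g.toDual hg).injective (LinearMap.ext h)

include hs hg in
-- Both sides are traces of products of `A` with the endomorphism representing `P`, in the two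
-- possible orders.
lemma contr_comp_left (P : LinearMap.BilinForm ℝ W) {A A' : Module.End ℝ W}
    (hA : ∀ X Y, g (A X) Y = g X (A' Y)) :
    contr g (fun X Y ↦ P (A X) Y) = contr g (fun X Y ↦ P X (A' Y)) := by
  have h1 := contr_apply_eq_trace hs hg (sharp hg P * A)
  have h2 := contr_apply_eq_trace hs hg (A * sharp hg P)
  rw [LinearMap.trace_mul_comm, ← h2] at h1
  simpa only [Module.End.mul_apply, hA, sharp_apply] using h1

include hs hg in
-- This is the trace of a rank-one endomorphism. It evaluates the terms of a contracted identity in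
-- which the two contracted slots are separated.
lemma contr_rank_one (f : Module.Dual ℝ W) (X : W) : contr g (fun e e' ↦ g e X * f e') = f X := by
  have h1 := contr_apply_eq_trace hs hg
    (((g.flip X) : Module.Dual ℝ W).smulRight ((g.toDual hg).symm f))
  rw [LinearMap.trace_smulRight] at h1
  simp only [LinearMap.smulRight_apply, map_smul, LinearMap.smul_apply, smul_eq_mul,
    LinearMap.BilinForm.apply_toDual_symm_apply] at h1
  rw [LinearMap.BilinForm.flip_apply, LinearMap.BilinForm.apply_toDual_symm_apply] at h1
  simpa using h1

include hs hg in
lemma contr_rank_one' (f : Module.Dual ℝ W) (X : W) : contr g (fun e e' ↦ f e * g X e') = f X := by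
  rw [← contr_rank_one hs hg f X, ← contr_flip hs]
  exact contr_congr g fun a b ↦ by rw [mul_comm, hs]

/-- The adjoint of an endomorphism with respect to `g`. -/
noncomputable def adj (A : Module.End ℝ W) : Module.End ℝ W := sharp hg (g.flip.comp LinearMap.id A)

include hs in
lemma adj_apply (A : Module.End ℝ W) (X Y : W) : g (adj hg A X) Y = g X (A Y) := by
  rw [adj, sharp_apply]
  simp [hs]

include hs in
lemma trace_adj (A : Module.End ℝ W) :
    LinearMap.trace ℝ W (adj hg A) = LinearMap.trace ℝ W A := by
  rw [← contr_apply_eq_trace hs hg, ← contr_apply_eq_trace hs hg, ← contr_flip hs]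
  exact contr_congr g fun a b ↦ by rw [adj_apply hs, hs]

include hs in
lemma eq_adj {A B : Module.End ℝ W} (h : ∀ X Y, g (B X) Y = g X (A Y)) : adj hg A = B :=
  LinearMap.ext fun X ↦ eq_of_forall_g hg fun Y ↦ by rw [adj_apply hs, h]

include hs in
lemma adj_mul (A B : Module.End ℝ W) : adj hg (A * B) = adj hg B * adj hg A :=
  eq_adj hs hg fun X Y ↦ by
    rw [Module.End.mul_apply, Module.End.mul_apply, adj_apply hs, adj_apply hs]

include hs in
lemma adj_sub (A B : Module.End ℝ W) : adj hg (A - B) = adj hg A - adj hg B :=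
  eq_adj hs hg fun X Y ↦ by simp [adj_apply hs]

include hs in
lemma adj_adj (A : Module.End ℝ W) : adj hg (adj hg A) = A :=
  eq_adj hs hg fun X Y ↦ by rw [hs X, adj_apply hs, hs]

include hs hg in
-- It suffices to test with the rank-one `C = g(·, Y) X`, for which the trace is `g(A X, Y)`.
lemma eq_zero_of_trace_mul {A : Module.End ℝ W}
    (h : ∀ C : Module.End ℝ W, LinearMap.trace ℝ W (A * C) = 0) : A = 0 := by
  refine LinearMap.ext fun X ↦ eq_of_forall_g hg fun Y ↦ ?_
  have h1 := h (((g.flip Y) : Module.Dual ℝ W).smulRight X)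
  have h2 : A * ((g.flip Y) : Module.Dual ℝ W).smulRight X =
      ((g.flip Y) : Module.Dual ℝ W).smulRight (A X) := by ext; simp
  rw [h2, LinearMap.trace_smulRight] at h1
  simpa using h1

end Contraction

/-! ### Linear algebra of a paraquaternionic structure -/

lemma eps_sq (s : Fin 3) : eps s * eps s = 1 := by
  fin_cases s <;> simp [eps]

lemma eps_ne_zero (s : Fin 3) : eps s ≠ 0 := fun h ↦ by simpa [h] using eps_sq s

/-- Up to the cyclic shift only the position of the sign `-1` matters. Replacing the three signs by
numerals reduces every identity with a generic `i` to three that `module` or `ring` can decide. -/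
lemma eps_cases (i : Fin 3) : (eps i = 1 ∧ eps (i + 1) = 1 ∧ eps (i + 2) = -1) ∨
    (eps i = 1 ∧ eps (i + 1) = -1 ∧ eps (i + 2) = 1) ∨
    (eps i = -1 ∧ eps (i + 1) = 1 ∧ eps (i + 2) = 1) := by
  fin_cases i <;> simp [eps]

lemma fin3_add (i : Fin 3) : i + 1 + 1 = i + 2 ∧ i + 1 + 2 = i ∧ i + 2 + 1 = i ∧
    i + 2 + 2 = i + 1 := by
  fin_cases i <;> decide

lemma fin3_sum {A : Type*} [AddCommMonoid A] (f : Fin 3 → A) (i : Fin 3) :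
    ∑ s, f s = f i + f (i + 1) + f (i + 2) := by
  rw [Fin.sum_univ_three]
  fin_cases i
  · rfl
  · change f 0 + f 1 + f 2 = f 1 + f 2 + f 0
    abel
  · change f 0 + f 1 + f 2 = f 2 + f 0 + f 1
    abel

section Para

variable {W : Type*} [AddCommGroup W] [Module ℝ W] [FiniteDimensional ℝ W]

/-- A neutral metric with three compatible paraquaternionic structures. -/
structure IsPara (g : LinearMap.BilinForm ℝ W) (I : Fin 3 → Module.End ℝ W) : Prop where
  symm : ∀ X Y, g X Y = g Y X
  nondeg : g.Nondegenerate
  sq : ∀ s X, I s (I s X) = eps s • X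
  mul₀₁ : ∀ i X, I i (I (i + 1) X) = -(eps (i + 2) • I (i + 2) X)
  mul₁₀ : ∀ i X, I (i + 1) (I i X) = eps (i + 2) • I (i + 2) X
  metric : ∀ s X Y, g (I s X) (I s Y) = -(eps s * g X Y)

namespace IsPara

variable {g : LinearMap.BilinForm ℝ W} {I : Fin 3 → Module.End ℝ W} (h : IsPara g I)
include h

/-- With `mul₂₁`, `mul₂₀` and `mul₀₂` this completes the multiplication table relative to a base
index `i`, so that simplification reduces any word in `I i`, `I (i + 1)`, `I (i + 2)`. -/
lemma mul₁₂ (i : Fin 3) (X : W) : I (i + 1) (I (i + 2) X) = -(eps i • I i X) := by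
  have := h.mul₀₁ (i + 1) X
  rwa [(fin3_add i).1, (fin3_add i).2.1] at this

lemma mul₂₁ (i : Fin 3) (X : W) : I (i + 2) (I (i + 1) X) = eps i • I i X := by
  have := h.mul₁₀ (i + 1) X
  rwa [(fin3_add i).1, (fin3_add i).2.1] at this

lemma mul₂₀ (i : Fin 3) (X : W) : I (i + 2) (I i X) = -(eps (i + 1) • I (i + 1) X) := by
  have := h.mul₀₁ (i + 2) X
  rwa [(fin3_add i).2.2.1, (fin3_add i).2.2.2] at this

lemma mul₀₂ (i : Fin 3) (X : W) : I i (I (i + 2) X) = eps (i + 1) • I (i + 1) X := by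
  have := h.mul₁₀ (i + 2) X
  rwa [(fin3_add i).2.2.1, (fin3_add i).2.2.2] at this

lemma skew (s : Fin 3) (X Y : W) : g (I s X) Y = - g X (I s Y) := by
  have h1 := h.metric s X (I s Y)
  rw [h.sq, map_smul, smul_eq_mul] at h1
  have := eps_sq s
  linear_combination eps s * h1 - (g (I s X) Y + g X (I s Y)) * this

end IsPara

end Para

/-! ### Decomposition of the torsion endomorphisms. -/

section Split

variable {W : Type*} [AddCommGroup W] [Module ℝ W] [FiniteDimensional ℝ W]
  {g : LinearMap.BilinForm ℝ W} {I : Fin 3 → Module.End ℝ W}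

/-- Four times the projection of `A` onto the commutant of `I₁, I₂, I₃`. -/
noncomputable def paraProj (I : Fin 3 → Module.End ℝ W) (A : Module.End ℝ W) : Module.End ℝ W :=
  A + ∑ s, eps s • (I s * A * I s)

lemma paraProj_apply (A : Module.End ℝ W) (i : Fin 3) (X : W) : paraProj I A X =
    A X + eps i • I i (A (I i X)) + eps (i + 1) • I (i + 1) (A (I (i + 1) X)) +
      eps (i + 2) • I (i + 2) (A (I (i + 2) X)) := by
  rw [paraProj, fin3_sum _ i]
  simp [add_assoc]

namespace IsPara

variable (h : IsPara g I)
include h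

lemma paraProj_comm (A : Module.End ℝ W) (s : Fin 3) (X : W) :
    paraProj I A (I s X) = I s (paraProj I A X) := by
  rw [paraProj_apply A s, paraProj_apply A s]
  rcases eps_cases s with ⟨h1, h2, h3⟩ | ⟨h1, h2, h3⟩ | ⟨h1, h2, h3⟩ <;>
  simp only [h1, h2, h3, h.sq, h.mul₀₁, h.mul₀₂, h.mul₁₀, h.mul₁₂, h.mul₂₀, h.mul₂₁, map_add,
    map_smul, map_neg] <;> module

lemma adj_I (s : Fin 3) : adj h.nondeg (I s) = - I s :=
  eq_adj h.symm h.nondeg fun X Y ↦ by simp [h.skew s X Y]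

lemma adj_paraProj (A : Module.End ℝ W) :
    adj h.nondeg (paraProj I A) = paraProj I (adj h.nondeg A) :=
  eq_adj h.symm h.nondeg fun X Y ↦ by
    rw [paraProj_apply _ 0, paraProj_apply _ 0]
    simp only [map_add, map_smul, LinearMap.add_apply, LinearMap.smul_apply, smul_eq_mul, h.skew,
      adj_apply h.symm, map_neg]
    simp only [← h.skew, mul_neg, neg_neg]
    simp only [h.skew, adj_apply h.symm, mul_neg, neg_neg]

omit h in
lemma trace_paraProj_mul (A C : Module.End ℝ W) :
    LinearMap.trace ℝ W (paraProj I A * C) = LinearMap.trace ℝ W (A * paraProj I C) := by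
  simp only [paraProj, add_mul, mul_add, Finset.sum_mul, Finset.mul_sum, map_add, map_sum,
    smul_mul_assoc, mul_smul_comm, map_smul]
  congr 1
  refine Finset.sum_congr rfl fun s _ ↦ ?_
  rw [mul_assoc, mul_assoc, LinearMap.trace_mul_comm, mul_assoc, mul_assoc]

/-- Multiplying `C * I s` by `I (s + 1)` on both sides gives `-ε_{s+1} C I_s`, by anticommutation,
while cyclicity of the trace gives the factor `+ε_{s+1}`. -/
lemma trace_comm_I {C : Module.End ℝ W} (hC : ∀ s X, C (I s X) = I s (C X)) (s : Fin 3) :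
    LinearMap.trace ℝ W (C * I s) = 0 := by
  have h1 : I (s + 1) * (C * I s) * I (s + 1) = -(eps (s + 1) • (C * I s)) := by
    ext X
    simp only [Module.End.mul_apply, LinearMap.neg_apply, LinearMap.smul_apply, ← hC, h.mul₀₁,
      map_neg, map_smul, h.mul₁₂]
    rcases eps_cases s with ⟨h1, h2, h3⟩ | ⟨h1, h2, h3⟩ | ⟨h1, h2, h3⟩ <;>
      simp [h1, h2, h3]
  have h2 : LinearMap.trace ℝ W (I (s + 1) * (C * I s) * I (s + 1)) =
      eps (s + 1) * LinearMap.trace ℝ W (C * I s) := by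
    rw [LinearMap.trace_mul_comm, ← mul_assoc,
      show I (s + 1) * I (s + 1) = eps (s + 1) • 1 from LinearMap.ext fun X ↦ h.sq _ X,
      smul_mul_assoc, one_mul, map_smul, smul_eq_mul]
  rw [h1, map_neg, map_smul, smul_eq_mul] at h2
  have : eps (s + 1) * LinearMap.trace ℝ W (C * I s) = 0 := by linarith
  exact (mul_eq_zero.1 this).resolve_left (eps_ne_zero _)

lemma trace_I (s : Fin 3) : LinearMap.trace ℝ W (I s) = 0 := by
  simpa using h.trace_comm_I (C := 1) (fun _ _ ↦ rfl) s

/-- Write `A = B + ∑ B_r I_r` with coefficients commuting with every `I_t`. The hypothesis is `B =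
0`, and then `A I_s + I_s A = 2 ε_s B_s`, since distinct `I_r` anticommute. -/
lemma anticomm_comm {A : Module.End ℝ W} (hA : paraProj I A = 0) (s t : Fin 3) (X : W) :
    A (I s (I t X)) + I s (A (I t X)) = I t (A (I s X) + I s (A X)) := by
  have ht : t = s ∨ t = s + 1 ∨ t = s + 2 := by clear hA; revert s t; decide
  have hA' : ∀ X, A X + eps s • I s (A (I s X)) + eps (s + 1) • I (s + 1) (A (I (s + 1) X)) +
      eps (s + 2) • I (s + 2) (A (I (s + 2) X)) = 0 := fun X ↦ by
    rw [← paraProj_apply, hA, LinearMap.zero_apply]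
  rcases ht with rfl | rfl | rfl
  · simp only [h.sq, map_add, map_smul]
    module
  · have e := hA' (I (s + 2) X)
    rcases eps_cases s with ⟨h1, h2, h3⟩ | ⟨h1, h2, h3⟩ | ⟨h1, h2, h3⟩ <;>
    simp only [h1, h2, h3, h.sq, h.mul₀₁, h.mul₀₂, h.mul₁₀, h.mul₁₂, h.mul₂₀, h.mul₂₁, map_add,
      map_smul, map_neg] at e ⊢ <;>
    first
    | linear_combination (norm := module) e
    | linear_combination (norm := module) -e
  · have e := hA' (I (s + 1) X)
    rcases eps_cases s with ⟨h1, h2, h3⟩ | ⟨h1, h2, h3⟩ | ⟨h1, h2, h3⟩ <;>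
    simp only [h1, h2, h3, h.sq, h.mul₀₁, h.mul₀₂, h.mul₁₀, h.mul₁₂, h.mul₂₀, h.mul₂₁, map_add,
      map_smul, map_neg] at e ⊢ <;>
    first
    | linear_combination (norm := module) e
    | linear_combination (norm := module) -e

end IsPara

/-- The decomposition of the torsion endomorphisms `T_s = T(ξ_s, ·)` in terms of a symmetric
endomorphism `U` and skew-symmetric endomorphisms `N_s`, all commuting with `I₁, I₂, I₃`. -/
structure IsSplit (g : LinearMap.BilinForm ℝ W) (I T : Fin 3 → Module.End ℝ W)
    (U : Module.End ℝ W) (N : Fin 3 → Module.End ℝ W) : Prop where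
  U_comm : ∀ s X, I s (U X) = U (I s X)
  U_symm : ∀ X Y, g (U X) Y = g X (U Y)
  U_trace : LinearMap.trace ℝ W U = 0
  N_comm : ∀ t s X, I s (N t X) = N t (I s X)
  N_skew : ∀ t X Y, g (N t X) Y = - g X (N t Y)
  T_trace : ∀ i s, LinearMap.trace ℝ W (T i * I s) = 0
  T_eq : ∀ i X, T i X = eps (i + 2) • N (i + 1) (I (i + 2) X) -
    eps (i + 1) • N (i + 2) (I (i + 1) X) + U (I i X)

namespace IsPara

variable (h : IsPara g I) {T : Fin 3 → Module.End ℝ W}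
include h

/-- By `hA` the adjoint of `A` is `-ε_i I_i A I_i`, so the part of `A` commuting with the `I_s` is
skew, hence in `sp(n)`. But `A` is orthogonal to `sp(n)`. In trace form: testing against `C` is, up
to a factor, testing `A` against the projection of `C - C*`, which is skew and commutes with the
`I_s`. -/
lemma paraProj_eq_zero {A : Module.End ℝ W} {i : Fin 3}
    (hA : ∀ X, I i (A X) + adj h.nondeg A (I i X) = 0)
    (hB : ∀ B : Module.End ℝ W, (∀ X Y, g (B X) Y = - g X (B Y)) →
      (∀ s X, B (I s X) = I s (B X)) → LinearMap.trace ℝ W (A * B) = 0) :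
    paraProj I A = 0 := by
  have hadj : ∀ X, adj h.nondeg A X = -(eps i • I i (A (I i X))) := fun X ↦ by
    have := hA (I i X)
    rw [h.sq, map_smul] at this
    rw [eq_neg_of_add_eq_zero_left this, smul_neg, neg_neg, smul_smul, eps_sq, one_smul]
  have hskew : adj h.nondeg (paraProj I A) = - paraProj I A := by
    ext X
    rw [h.adj_paraProj, LinearMap.neg_apply, paraProj_apply _ i, paraProj_apply _ i]
    simp only [hadj]
    rcases eps_cases i with ⟨h1, h2, h3⟩ | ⟨h1, h2, h3⟩ | ⟨h1, h2, h3⟩ <;>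
    simp only [h1, h2, h3, h.sq, h.mul₀₁, h.mul₀₂, h.mul₁₀, h.mul₁₂, h.mul₂₀, h.mul₂₁, map_add,
      map_smul, map_neg] <;> module
  refine eq_zero_of_trace_mul h.symm h.nondeg fun C ↦ ?_
  have h1 : LinearMap.trace ℝ W (paraProj I A * adj h.nondeg C) =
      - LinearMap.trace ℝ W (paraProj I A * C) := by
    rw [← trace_adj h.symm h.nondeg, adj_mul h.symm, adj_adj h.symm, hskew, mul_neg, map_neg,
      LinearMap.trace_mul_comm]
  have h2 := hB (paraProj I (C - adj h.nondeg C)) (fun X Y ↦ by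
      have : adj h.nondeg (paraProj I (C - adj h.nondeg C)) =
          - paraProj I (C - adj h.nondeg C) := by
        rw [h.adj_paraProj, adj_sub h.symm, adj_adj h.symm]
        simp only [paraProj, mul_sub, sub_mul, smul_sub, Finset.sum_sub_distrib]
        abel
      rw [← adj_apply h.symm h.nondeg, this]
      simp) (h.paraProj_comm _)
  rw [← trace_paraProj_mul, mul_sub, map_sub, h1] at h2
  linarith

/-- Existence of the torsion decomposition. -/
lemma exists_split (hT : ∀ i s, LinearMap.trace ℝ W (T i * I s) = 0)
    (hB : ∀ i, ∀ B : Module.End ℝ W, (∀ X Y, g (B X) Y = - g X (B Y)) →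
      (∀ s X, B (I s X) = I s (B X)) → LinearMap.trace ℝ W (T i * B) = 0)
    (hK : ∀ i X, I i (T i X) + adj h.nondeg (T i) (I i X) = 0)
    (hE : ∀ i X, I (i + 2) (T i X) + adj h.nondeg (T i) (I (i + 2) X) =
      -(I i (T (i + 2) X) + adj h.nondeg (T (i + 2)) (I i X))) :
    ∃ U N, IsSplit g I T U N := by
  have hP : ∀ i, paraProj I (T i) = 0 := fun i ↦ h.paraProj_eq_zero (hK i) (hB i)
  have hP' : ∀ i X, T i X + eps i • I i (T i (I i X)) +
      eps (i + 1) • I (i + 1) (T i (I (i + 1) X)) +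
      eps (i + 2) • I (i + 2) (T i (I (i + 2) X)) = 0 := fun i X ↦ by
    rw [← paraProj_apply, hP, LinearMap.zero_apply]
  have hadj : ∀ i X, adj h.nondeg (T i) X = -(eps i • I i (T i (I i X))) := fun i X ↦ by
    have := hK i (I i X)
    rw [h.sq, map_smul] at this
    rw [eq_neg_of_add_eq_zero_left this, smul_neg, neg_neg, smul_smul, eps_sq, one_smul]
  -- Half the anticommutators of `T_i` with `I_s`: they commute with every `I_t` by `anticomm_comm`,
  -- and `T_i = ∑ ε_s D_{is} I_s` because the commutant part of `T_i` vanishes.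
  obtain ⟨D, hD⟩ : ∃ D : Fin 3 → Fin 3 → Module.End ℝ W, ∀ i s X,
    D i s X = (1 / 2 : ℝ) • (T i (I s X) + I s (T i X)) :=
    ⟨fun i s ↦ (1 / 2 : ℝ) • (T i * I s + I s * T i), fun i s X ↦ rfl⟩
  have hDc : ∀ i s t X, I t (D i s X) = D i s (I t X) := fun i s t X ↦ by
    rw [hD, hD, map_smul, h.anticomm_comm (hP i)]
  have hTD : ∀ i X, T i X = eps (i + 2) • D i (i + 2) (I (i + 2) X) +
      eps (i + 1) • D i (i + 1) (I (i + 1) X) + eps i • D i i (I i X) := fun i X ↦ by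
    have e := hP' i X
    simp only [hD, h.sq, map_smul]
    rcases eps_cases i with ⟨h1, h2, h3⟩ | ⟨h1, h2, h3⟩ | ⟨h1, h2, h3⟩ <;>
    simp only [h1, h2, h3] at e ⊢ <;>
    linear_combination (norm := module) (-(1 / 2 : ℝ)) • e
  have hK2 : ∀ i X, I (i + 2) (T i X) + adj h.nondeg (T i) (I (i + 2) X) =
      (2 : ℝ) • (D i (i + 2) X - (eps (i + 1) * eps i) • D i i (I (i + 1) X)) := fun i X ↦ by
    rw [hadj]
    simp only [hTD]
    rcases eps_cases i with ⟨h1, h2, h3⟩ | ⟨h1, h2, h3⟩ | ⟨h1, h2, h3⟩ <;>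
    simp only [h1, h2, h3, h.sq, h.mul₀₁, h.mul₀₂, h.mul₁₀, h.mul₁₂, h.mul₂₀, h.mul₂₁, map_add,
      map_smul, map_neg, hDc] <;> module
  have hK1 : ∀ i X, I (i + 1) (T i X) + adj h.nondeg (T i) (I (i + 1) X) =
      (2 : ℝ) • (D i (i + 1) X + (eps (i + 2) * eps i) • D i i (I (i + 2) X)) := fun i X ↦ by
    rw [hadj]
    simp only [hTD]
    rcases eps_cases i with ⟨h1, h2, h3⟩ | ⟨h1, h2, h3⟩ | ⟨h1, h2, h3⟩ <;>
    simp only [h1, h2, h3, h.sq, h.mul₀₁, h.mul₀₂, h.mul₁₀, h.mul₁₂, h.mul₂₀, h.mul₂₁, map_add,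
      map_smul, map_neg, hDc] <;> module
  have hE' : ∀ i X, D i (i + 2) X + D (i + 2) i X =
      eps (i + 1) • (eps i • D i i (I (i + 1) X) -
        eps (i + 2) • D (i + 2) (i + 2) (I (i + 1) X)) := fun i X ↦ by
    have e1 := hE i X
    have e2 := hK1 (i + 2) X
    rw [(fin3_add i).2.2.1, (fin3_add i).2.2.2] at e2
    rw [hK2, e2] at e1
    linear_combination (norm := module) (1 / 2 : ℝ) • e1
  -- In `hE'` the left side commutes with `I_i` and the right side anticommutes with it, so both
  -- vanish. The right side shows that `ε_i D_{ii}` is independent of `i`; the left side makes the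
  -- off-diagonal `D` antisymmetric.
  have hU : ∀ i X, eps i • D i i X = eps (i + 2) • D (i + 2) (i + 2) X := fun i X ↦ by
    have e1 := congrArg (I i) (hE' i (I (i + 2) X))
    have e2 := hE' i (I i (I (i + 2) X))
    simp only [map_add, hDc] at e1
    rw [e2] at e1
    rcases eps_cases i with ⟨h1, h2, h3⟩ | ⟨h1, h2, h3⟩ | ⟨h1, h2, h3⟩ <;>
    simp only [h1, h2, h3, h.sq, h.mul₀₁, h.mul₀₂, h.mul₁₀, h.mul₁₂, h.mul₂₀, h.mul₂₁, map_add,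
      map_sub, map_smul, map_neg, hDc] at e1 ⊢ <;>
    first
    | linear_combination (norm := module) (1 / 2 : ℝ) • e1
    | linear_combination (norm := module) (-(1 / 2) : ℝ) • e1
  have hzero : ∀ i X, D i (i + 1) X = - D (i + 1) i X := fun i X ↦ by
    have e := hE' (i + 1) X
    have e2 := hU (i + 1) (I (i + 1 + 1) X)
    rw [e2, sub_self, smul_zero, (fin3_add i).2.1] at e
    exact eq_neg_of_add_eq_zero_right e
  have hU' : ∀ i X, eps i • D i i X = eps 0 • D 0 0 X := fun i X ↦ by
    fin_cases i
    · rfl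
    · exact hU 1 X
    · exact (hU 2 X).trans (hU 1 X)
  have g_adj : ∀ i X Y, g (T i X) Y = g X (adj h.nondeg (T i) Y) := fun i X Y ↦ by
    rw [h.symm X, adj_apply h.symm, h.symm]
  have hDadj : ∀ i s X Y, g (D i s X) Y = -g X ((1 / 2 : ℝ) • (I s (adj h.nondeg (T i) Y) +
      adj h.nondeg (T i) (I s Y))) := fun i s X Y ↦ by
    simp only [hD, map_add, map_smul, LinearMap.add_apply, LinearMap.smul_apply, smul_eq_mul,
      h.skew, g_adj]
    ring
  have hNs : ∀ i X Y, g (D i (i + 2) X) Y = -g X (D i (i + 2) Y) := fun i X Y ↦ by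
    rw [hDadj]
    congr 2
    simp only [hadj, hTD]
    rcases eps_cases i with ⟨h1, h2, h3⟩ | ⟨h1, h2, h3⟩ | ⟨h1, h2, h3⟩ <;>
    simp only [h1, h2, h3, h.sq, h.mul₀₁, h.mul₀₂, h.mul₁₀, h.mul₁₂, h.mul₂₀, h.mul₂₁, map_add,
      map_smul, map_neg, hDc] <;> module
  have hUs : ∀ i X Y, g (D i i X) Y = g X (D i i Y) := fun i X Y ↦ by
    rw [hDadj, ← map_neg]
    congr 1
    simp only [hadj, hTD]
    rcases eps_cases i with ⟨h1, h2, h3⟩ | ⟨h1, h2, h3⟩ | ⟨h1, h2, h3⟩ <;>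
    simp only [h1, h2, h3, h.sq, h.mul₀₁, h.mul₀₂, h.mul₁₀, h.mul₁₂, h.mul₂₀, h.mul₂₁, map_add,
      map_smul, map_neg, hDc] <;> module
  -- With this choice `N_{i+1} = D_{i,i+2}` and `N_{i+2} = D_{i+1,i} = -D_{i,i+1}`, which matches
  -- the expansion `hTD`.
  refine ⟨eps 0 • D 0 0, fun s ↦ D (s + 2) (s + 1), ?_, ?_, ?_, ?_, ?_, hT, ?_⟩
  · intro s X
    simp only [LinearMap.smul_apply, map_smul, hDc]
  · intro X Y
    simp only [LinearMap.smul_apply, map_smul, hUs]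
  · have e : D 0 0 = (1 / 2 : ℝ) • (T 0 * I 0 + I 0 * T 0) := LinearMap.ext fun X ↦ hD 0 0 X
    rw [map_smul, e, map_smul, map_add, LinearMap.trace_mul_comm ℝ (I 0), hT]
    simp
  · intro t s X
    exact hDc _ _ _ _
  · intro t X Y
    have := hNs (t + 2) X Y
    rwa [(fin3_add t).2.2.2] at this
  · intro i X
    simp only [(fin3_add i).1, (fin3_add i).2.1, (fin3_add i).2.2.1, (fin3_add i).2.2.2]
    rw [hTD i X, hzero i, LinearMap.smul_apply, ← hU' i]
    module

end IsPara

end Split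

/-! ### Algebra of the horizontal curvature: contractions of the Bianchi identity. -/

section CurvatureAlgebra

variable {W : Type*} [AddCommGroup W] [Module ℝ W] [FiniteDimensional ℝ W]
  {g : LinearMap.BilinForm ℝ W} {I T : Fin 3 → Module.End ℝ W} {U : Module.End ℝ W}
  {N : Fin 3 → Module.End ℝ W}

namespace IsSplit

variable (hs : IsSplit g I T U N)
include hs

lemma T_eq₁ (i : Fin 3) (X : W) : T (i + 1) X = eps i • N (i + 2) (I i X) -
    eps (i + 2) • N i (I (i + 2) X) + U (I (i + 1) X) := by
  have := hs.T_eq (i + 1) X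
  rwa [(fin3_add i).1, (fin3_add i).2.1] at this

lemma T_eq₂ (i : Fin 3) (X : W) : T (i + 2) X = eps (i + 1) • N i (I (i + 1) X) -
    eps i • N (i + 1) (I i X) + U (I (i + 2) X) := by
  have := hs.T_eq (i + 2) X
  rwa [(fin3_add i).2.2.1, (fin3_add i).2.2.2] at this

/-- The products `N I` are symmetric, being commuting products of two skew maps, and `U I_i` is
skew. Thus the adjoint of `T_i` is `T_i - 2 U I_i`. -/
lemma g_T (h : IsPara g I) (i : Fin 3) (X Y : W) : g (T i X) Y = g X (T i Y - (2 : ℝ) • U (I i Y)) := by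
  simp only [hs.T_eq, map_add, map_sub, map_smul, LinearMap.add_apply, LinearMap.sub_apply,
    LinearMap.smul_apply, smul_eq_mul, hs.N_skew, hs.U_symm, h.skew, hs.N_comm, hs.U_comm]
  ring

lemma trace_T (h : IsPara g I) (i : Fin 3) : LinearMap.trace ℝ W (T i) = 0 := by
  have e : T i = eps (i + 2) • (N (i + 1) * I (i + 2)) -
      eps (i + 1) • (N (i + 2) * I (i + 1)) + U * I i := LinearMap.ext fun X ↦ hs.T_eq i X
  rw [e, map_add, map_sub, map_smul, map_smul, h.trace_comm_I (fun s X ↦ (hs.N_comm _ s X).symm),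
    h.trace_comm_I (fun s X ↦ (hs.N_comm _ s X).symm),
    h.trace_comm_I (fun s X ↦ (hs.U_comm s X).symm)]
  simp

/-- The torsion side of the Bianchi identity contracted to `Ric`; that it vanishes is the symmetry
of `Ric`. The next two identities play the same role for `ζ_i` and `ϱ_i`. -/
lemma torsion_identity (h : IsPara g I) (X : W) :
    ∑ s, eps s • (I s (T s X) + (T s (I s X) - (2 : ℝ) • U (I s (I s X)))) = 0 := by
  rw [fin3_sum _ 0]
  simp only [hs.T_eq, hs.T_eq₁ 0, hs.T_eq₂ 0]
  rcases eps_cases 0 with ⟨h1, h2, h3⟩ | ⟨h1, h2, h3⟩ | ⟨h1, h2, h3⟩ <;>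
  simp only [h1, h2, h3, h.sq, h.mul₀₁, h.mul₀₂, h.mul₁₀, h.mul₁₂, h.mul₂₀, h.mul₂₁, map_add,
    map_smul, map_neg, map_sub, hs.N_comm, hs.U_comm] <;> module

lemma torsion_identity_I (h : IsPara g I) (i : Fin 3) (X : W) :
    ∑ s, (-2 * eps s) • (I s (I i (T s X)) - (T s (I i (I s X)) - (2 : ℝ) • U (I s (I i (I s X))))) =
      -(8 * eps i) • N i X + (4 : ℝ) • U (I i X) := by
  rw [fin3_sum _ i]
  simp only [hs.T_eq i, hs.T_eq₁ i, hs.T_eq₂ i]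
  rcases eps_cases i with ⟨h1, h2, h3⟩ | ⟨h1, h2, h3⟩ | ⟨h1, h2, h3⟩ <;>
  simp only [h1, h2, h3, h.sq, h.mul₀₁, h.mul₀₂, h.mul₁₀, h.mul₁₂, h.mul₂₀, h.mul₂₁, map_add,
    map_smul, map_neg, map_sub, hs.N_comm, hs.U_comm] <;> module

lemma torsion_identity_I' (h : IsPara g I) (i : Fin 3) (X : W) :
    ∑ s, (-4 * eps s) • T s (I i (I s X)) = (8 * eps i) • N i X + (4 : ℝ) • U (I i X) := by
  rw [fin3_sum _ i]
  simp only [hs.T_eq i, hs.T_eq₁ i, hs.T_eq₂ i]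
  rcases eps_cases i with ⟨h1, h2, h3⟩ | ⟨h1, h2, h3⟩ | ⟨h1, h2, h3⟩ <;>
  simp only [h1, h2, h3, h.sq, h.mul₀₁, h.mul₀₂, h.mul₁₀, h.mul₁₂, h.mul₂₀, h.mul₂₁, map_add,
    map_smul, map_neg, map_sub, hs.N_comm, hs.U_comm] <;> module

end IsSplit

/-- The bilinear form representing the Ricci 2-form `ρ_s`, in terms of the normalised scalar
curvature `c` and the torsion. -/
noncomputable def ricciForm (g : LinearMap.BilinForm ℝ W) (I N : Fin 3 → Module.End ℝ W)
    (U : Module.End ℝ W) (c : ℝ) (s : Fin 3) (X Y : W) : ℝ :=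
  g (-(c • I s X) + (2 * eps s) • N s X - (2 : ℝ) • U (I s X)) Y

/-- The algebraic properties of the horizontal part of the curvature of the canonical
connection. -/
structure IsCurv (g : LinearMap.BilinForm ℝ W) (I T N : Fin 3 → Module.End ℝ W)
    (U : Module.End ℝ W) (c : ℝ) (R : W →ₗ[ℝ] W →ₗ[ℝ] Module.End ℝ W) : Prop where
  alt : ∀ X Y, R X Y = - R Y X
  skew : ∀ X Y Z V, g (R X Y Z) V = - g Z (R X Y V)
  comm_I : ∀ X Y i Z, R X Y (I i Z) = I i (R X Y Z) + (2 * eps i) •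
    (ricciForm g I N U c (i + 1) X Y • I (i + 2) Z - ricciForm g I N U c (i + 2) X Y • I (i + 1) Z)
  contr_I : ∀ X Y s, contr g (fun e e' ↦ g (R X Y e) (I s e')) =
    Module.finrank ℝ W * ricciForm g I N U c s X Y
  bianchi : ∀ X Y Z, R X Y Z + R Y Z X + R Z X Y = ∑ s, (-2 * eps s) •
    (g (I s X) Y • T s Z + g (I s Y) Z • T s X + g (I s Z) X • T s Y)

namespace IsCurv

variable {c : ℝ} {R : W →ₗ[ℝ] W →ₗ[ℝ] Module.End ℝ W} (h : IsPara g I)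
  (hs : IsSplit g I T U N) (hR : IsCurv g I T N U c R)
include h hR

/-- The Bianchi identity on `e, X, Y`, paired with `J e'` and contracted. The choice `J = 1`
concerns `Ric`, and `J = I i` concerns `ζ_i`. -/
lemma contr_bianchi (J : Module.End ℝ W) (X Y : W) :
    contr g (fun e e' ↦ g (R e X Y) (J e')) - contr g (fun e e' ↦ g (R e Y X) (J e')) +
      contr g (fun e e' ↦ g (R X Y e) (J e')) = ∑ s, (-2 * eps s) * (g (T s X) (J (I s Y)) -
        g (T s Y) (J (I s X)) + g (I s X) Y * contr g (fun e e' ↦ g (T s e) (J e'))) := by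
  have e1 : ∀ s, contr g (fun e e' ↦ g (I s e) X * g (T s Y) (J e')) = -g (T s Y) (J (I s X)) :=
    fun s ↦ by
    have := contr_rank_one h.symm h.nondeg (g (T s Y) ∘ₗ J) (-I s X)
    simpa [h.skew] using this
  have e2 : ∀ s, contr g (fun e e' ↦ g (I s Y) e * g (T s X) (J e')) = g (T s X) (J (I s Y)) :=
    fun s ↦ by
    have := contr_rank_one h.symm h.nondeg (g (T s X) ∘ₗ J) (I s Y)
    simpa [h.symm (I s Y)] using this
  have e3 := contr_congr g (P := fun e e' ↦ g (R e X Y) (J e') - g (R e Y X) (J e') +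
      g (R X Y e) (J e')) (Q := fun e e' ↦ ∑ s, (-2 * eps s) *
      (g (I s e) X * g (T s Y) (J e') + g (I s X) Y * g (T s e) (J e') +
        g (I s Y) e * g (T s X) (J e'))) fun e e' ↦ by
    have := congr(g $(hR.bianchi e X Y) (J e'))
    simp only [map_add, map_sum, map_smul, LinearMap.add_apply, LinearMap.sum_apply,
      LinearMap.smul_apply, smul_eq_mul, hR.alt Y e, LinearMap.neg_apply, map_neg] at this
    rw [← this]
    ring
  rw [contr_add, contr_sub, contr_sum] at e3
  rw [e3]
  refine Finset.sum_congr rfl fun s _ ↦ ?_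
  rw [contr_smul, contr_add, contr_add, e1, e2, contr_smul]
  ring

include hs in
lemma ric_symm (X Y : W) : contr g (fun e e' ↦ g (R e X Y) e') =
    contr g (fun e e' ↦ g (R e Y X) e') := by
  have e := hR.contr_bianchi h 1 X Y
  have e1 : contr g (fun e e' ↦ g (R X Y e) e') = 0 := by
    have := contr_congr g (P := fun e e' ↦ g (R X Y e) e') (Q := fun e e' ↦ - g (R X Y e') e)
      fun e e' ↦ by rw [hR.skew, h.symm]
    rw [contr_neg, contr_flip h.symm (fun e e' ↦ g (R X Y e) e')] at this
    linarith
  have e2 : ∀ s, contr g (fun e e' ↦ g (T s e) e') = 0 := fun s ↦ by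
    rw [contr_apply_eq_trace h.symm h.nondeg, hs.trace_T h]
  simp only [Module.End.one_apply, e1, e2] at e
  have e3 := congr(g Y $(hs.torsion_identity h X))
  have e4 : ∑ s, -2 * eps s * (g (T s X) (I s Y) - g (T s Y) (I s X) + g (I s X) Y * 0) =
      2 * g Y (∑ s, eps s • (I s (T s X) + (T s (I s X) - (2 : ℝ) • U (I s (I s X))))) := by
    rw [map_sum, Finset.mul_sum]
    refine Finset.sum_congr rfl fun s _ ↦ ?_
    rw [hs.g_T h s Y, map_smul, map_add, smul_eq_mul, h.symm (T s X), h.skew]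
    ring
  rw [e4, e3, map_zero] at e
  linarith

include hs in
lemma zeta_sub (i : Fin 3) (X Y : W) :
    contr g (fun e e' ↦ g (R e X Y) (I i e')) - contr g (fun e e' ↦ g (R e Y X) (I i e')) +
      Module.finrank ℝ W * ricciForm g I N U c i X Y =
      g (-(8 * eps i) • N i X + (4 : ℝ) • U (I i X)) Y := by
  have e := hR.contr_bianchi h (I i) X Y
  rw [hR.contr_I] at e
  have e2 : ∀ s, contr g (fun e e' ↦ g (T s e) (I i e')) = 0 := fun s ↦ by
    have : contr g (fun e e' ↦ g (T s e) (I i e')) = - contr g (fun e e' ↦ g ((I i * T s) e) e') := by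
      rw [← contr_neg]
      exact contr_congr g fun e e' ↦ by rw [Module.End.mul_apply, h.skew, neg_neg]
    rw [this, contr_apply_eq_trace h.symm h.nondeg, LinearMap.trace_mul_comm, hs.T_trace, neg_zero]
  simp only [e2, mul_zero, add_zero] at e
  rw [e, ← hs.torsion_identity_I h, map_sum, LinearMap.sum_apply]
  refine Finset.sum_congr rfl fun s _ ↦ ?_
  rw [hs.g_T h s Y, h.symm Y]
  simp only [map_smul, map_sub, LinearMap.smul_apply, LinearMap.sub_apply, smul_eq_mul, h.skew]
  ring

/-- Moving `I_i` out of `R(e, X)` costs the two commutator terms of `comm_I`. Once contracted these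
have rank one and simply evaluate the Ricci forms. -/
lemma zeta_I (i : Fin 3) (X Y : W) : contr g (fun e e' ↦ g (R e X (I i Y)) (I i e')) =
    -(eps i * contr g (fun e e' ↦ g (R e X Y) e')) - 2 * eps i *
      (eps (i + 1) * ricciForm g I N U c (i + 1) (I (i + 1) Y) X +
        eps (i + 2) * ricciForm g I N U c (i + 2) (I (i + 2) Y) X) := by
  have lin : ∀ s, ∃ f : Module.Dual ℝ W, ∀ e, f e = ricciForm g I N U c s e X := fun s ↦
    ⟨(g.flip X) ∘ₗ (-(c • I s) + (2 * eps s) • N s - (2 : ℝ) • (U ∘ₗ I s)), fun e ↦ rfl⟩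
  obtain ⟨f1, hf1⟩ := lin (i + 1)
  obtain ⟨f2, hf2⟩ := lin (i + 2)
  have e1 := contr_rank_one' h.symm h.nondeg f1 (I (i + 1) Y)
  have e2 := contr_rank_one' h.symm h.nondeg f2 (I (i + 2) Y)
  have e3 := contr_congr g (P := fun e e' ↦ g (R e X (I i Y)) (I i e'))
    (Q := fun e e' ↦ (-eps i) * g (R e X Y) e' - (2 * eps i) * (eps (i + 1) *
      (f1 e * g (I (i + 1) Y) e') + eps (i + 2) * (f2 e * g (I (i + 2) Y) e'))) fun e e' ↦ by
    rw [hR.comm_I, map_add, LinearMap.add_apply, h.metric, map_smul, map_sub, map_smul, map_smul,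
      LinearMap.smul_apply, LinearMap.sub_apply, LinearMap.smul_apply, LinearMap.smul_apply,
      ← neg_neg (g (I (i + 2) Y) (I i e')), ← h.skew, ← neg_neg (g (I (i + 1) Y) (I i e')),
      ← h.skew, h.mul₀₁, h.mul₀₂, hf1, hf2]
    simp only [map_smul, map_neg, LinearMap.smul_apply, LinearMap.neg_apply, smul_eq_mul]
    ring
  rw [e3, contr_sub, contr_smul, contr_smul, contr_add, contr_smul, contr_smul, e1, e2, hf1, hf2]
  ring

include hs in
omit hR in
lemma eps_mul_ricciForm (s : Fin 3) (X Y : W) : eps s * ricciForm g I N U c s (I s Y) X =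
    g (-(c • X) + (2 : ℝ) • N s (I s X) - (2 : ℝ) • U X) Y := by
  have e : ricciForm g I N U c s (I s Y) X = eps s * (g Y (-(c • X) - (2 : ℝ) • U X)) +
      (2 * eps s) * g Y (N s (I s X)) := by
    simp only [ricciForm, h.sq, map_add, map_sub, map_neg, map_smul, LinearMap.add_apply,
      LinearMap.sub_apply, LinearMap.neg_apply, LinearMap.smul_apply, smul_eq_mul, hs.N_skew,
      h.skew, hs.U_symm, hs.N_comm]
    ring
  rw [e, h.symm _ Y]
  simp only [map_add, map_sub, map_smul, smul_eq_mul]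
  linear_combination (g Y (-(c • X)) - 2 * g Y (U X) + 2 * g Y (N s (I s X))) * eps_sq s

include hs in
omit hR in
lemma g_N_I (s : Fin 3) (X Y : W) : g (N s (I s X)) Y = g (N s (I s Y)) X := by
  rw [hs.N_skew, h.skew, hs.N_comm, h.symm, neg_neg]

include hs in
lemma zeta_I' (i : Fin 3) (X Y : W) : contr g (fun e e' ↦ g (R e X (I i Y)) (I i e')) =
    -(eps i * (contr g (fun e e' ↦ g (R e X Y) e') + g (-((4 * c) • X) +
      (4 : ℝ) • (N (i + 1) (I (i + 1) X) + N (i + 2) (I (i + 2) X)) - (8 : ℝ) • U X) Y)) := by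
  rw [hR.zeta_I h, eps_mul_ricciForm h hs, eps_mul_ricciForm h hs]
  simp only [map_add, map_sub, map_neg, map_smul, LinearMap.add_apply,
      LinearMap.sub_apply, LinearMap.neg_apply, LinearMap.smul_apply, smul_eq_mul]
  ring

include hs in
-- `zeta_sub` relates the two orders of the arguments of `ζ_i`, and `zeta_I'` turns each of them
-- into `Ric`. The result determines `Ric(I_i X, I_i Y) - ε_i Ric(X, Y)`, so the difference `Q` from
-- the claimed value satisfies `Q(I_i X, I_i Y) = ε_i Q(X, Y)` for every `i`.
lemma ric_eq (X Y : W) : contr g (fun e e' ↦ g (R e X Y) e') =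
    g (((Module.finrank ℝ W / 2 + 4) * c) • X - (Module.finrank ℝ W + 4 : ℝ) • ∑ s, N s (I s X) +
      (Module.finrank ℝ W + 10 : ℝ) • U X) Y := by
  set d : ℝ := (Module.finrank ℝ W : ℝ)
  obtain ⟨Q, hQ⟩ : ∃ Q : W → W → ℝ, ∀ X Y, Q X Y = contr g (fun e e' ↦ g (R e X Y) e') -
    g (((d / 2 + 4) * c) • X - (d + 4) • ∑ s, N s (I s X) + (d + 10) • U X) Y :=
    ⟨_, fun X Y ↦ rfl⟩
  have key : ∀ i X Y, Q (I i X) (I i Y) = eps i * Q X Y := fun i X Y ↦ by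
    have e1 := hR.zeta_sub h hs i X (I i Y)
    -- `ε_i I_i` is the inverse of `I_i`; with this argument `zeta_I'` treats the term whose last
    -- argument `X` is not yet of the form `I_i Z`.
    have e2 := hR.zeta_I' h hs i (I i Y) (eps i • I i X)
    have e3 : I i (eps i • I i X) = X := by
      rw [map_smul, h.sq, smul_smul, eps_sq, one_smul]
    rw [hR.zeta_I' h hs, ← e3, e2, e3] at e1
    have e4 := contr_smul g (P := fun e e' ↦ g (R e (I i Y) (I i X)) e') (eps i)
    have e5 := hR.ric_symm h hs (I i Y) (I i X)
    rw [hQ, hQ, ← e5]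
    simp only [map_smul, smul_eq_mul, e4, fin3_sum _ i, ricciForm, h.sq, map_add, map_sub, map_neg,
      LinearMap.add_apply, LinearMap.sub_apply, LinearMap.neg_apply, LinearMap.smul_apply, h.skew,
      h.mul₀₁, h.mul₀₂, h.mul₁₀, h.mul₁₂, h.mul₂₀, h.mul₂₁, hs.U_symm, hs.N_comm,
      hs.N_skew, ← hs.U_comm] at e1 ⊢
    have e6 : g Y (U X) = g X (U Y) := by rw [h.symm, hs.U_symm]
    have e7 : ∀ s, g Y (N s (I s X)) = g X (N s (I s Y)) := fun s ↦ by
      rw [h.symm, g_N_I h hs, h.symm]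
    rw [h.symm Y X, e6, e7, e7] at e1
    rcases eps_cases i with ⟨h1, h2, h3⟩ | ⟨h1, h2, h3⟩ | ⟨h1, h2, h3⟩ <;>
    simp only [h1, h2, h3] at e1 ⊢ <;> linear_combination e1
  have h0 : ∀ X Y, Q X Y = 0 := fun X Y ↦ by
    -- Since `I 2 = I 0 * I 1`, the form is multiplied both by `ε_0 ε_1 = 1` and by `ε_2 = -1`.
    have e : Q (I 2 X) (I 2 Y) = eps 0 * (eps 1 * Q X Y) := by
      have e1 := h.mul₀₁ 0
      have e2 : ∀ X, I 2 X = I 0 (I 1 X) := fun X ↦ by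
        have := h.mul₀₁ 0 X
        simpa [eps] using this.symm
      rw [e2, e2, key, key]
    rw [key] at e
    simp [eps] at e
    linarith
  have := h0 X Y
  rw [hQ] at this
  linarith

include hs in
lemma scal_eq : contr g (fun X Y ↦ contr g (fun e e' ↦ g (R e X Y) e')) =
    Module.finrank ℝ W * ((Module.finrank ℝ W / 2 + 4) * c) := by
  rw [contr_congr g fun X Y ↦ hR.ric_eq h hs X Y]
  have := contr_apply_eq_trace h.symm h.nondeg (((Module.finrank ℝ W / 2 + 4) * c) •
    (1 : Module.End ℝ W) - (Module.finrank ℝ W + 4 : ℝ) • ∑ s, N s * I s +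
      (Module.finrank ℝ W + 10 : ℝ) • U)
  simp only [LinearMap.add_apply, LinearMap.sub_apply, LinearMap.smul_apply, Module.End.one_apply,
    LinearMap.sum_apply, Module.End.mul_apply] at this
  rw [this]
  have e : ∀ s, LinearMap.trace ℝ W (N s * I s) = 0 := fun s ↦
    h.trace_comm_I (fun t X ↦ (hs.N_comm _ t X).symm) s
  simp only [map_add, map_sub, map_smul, map_sum, e, hs.U_trace, LinearMap.trace_one, smul_eq_mul,
    Finset.sum_const_zero]
  ring

include hs in
-- Contract the Bianchi identity on `e, I_i e', X`. The two curvature terms with `X` among the first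
-- two arguments both equal the `ζ_i` contraction, and `tr(I_i I_s) = ε_i δ_{is} dim W` produces the
-- multiple of `T_i`.
lemma varrho_eq (i : Fin 3) (X Y : W) : contr g (fun e e' ↦ g (R e (I i e') X) Y) =
    -2 * contr g (fun e e' ↦ g (R e X Y) (I i e')) + g ((2 * Module.finrank ℝ W : ℝ) • T i X +
      (8 * eps i) • N i X + (4 : ℝ) • U (I i X)) Y := by
  have e1 : contr g (fun e e' ↦ g (R (I i e') X e) Y) = contr g (fun e e' ↦ g (R e X Y) (I i e')) := by
    have := contr_comp_left h.symm h.nondeg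
      (LinearMap.mk₂ ℝ (fun e e' ↦ g (R e X Y) e') (by simp) (by simp) (by simp) (by simp))
      (A := I i) (A' := - I i) (by simp [h.skew])
    simp only [LinearMap.mk₂_apply, LinearMap.neg_apply, map_neg] at this
    rw [contr_neg] at this
    rw [← neg_inj, ← this, ← contr_neg, ← contr_flip h.symm]
    exact contr_congr g fun e e' ↦ by rw [hR.skew, neg_neg, h.symm]
  have e2 : contr g (fun e e' ↦ g (R X e (I i e')) Y) = contr g (fun e e' ↦ g (R e X Y) (I i e')) :=
    contr_congr g fun e e' ↦ by rw [hR.skew, hR.alt, LinearMap.neg_apply, map_neg, neg_neg, h.symm]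
  have e3 := contr_congr g (P := fun e e' ↦ g (R e (I i e') X) Y + g (R (I i e') X e) Y +
      g (R X e (I i e')) Y) (Q := fun e e' ↦ ∑ s, (-2 * eps s) *
      (g (T s X) Y * g (I s e) (I i e') + g e' (I i (I s X)) * g (T s e) Y +
        g e (-I s X) * (-g (T s (I i e')) Y))) fun e e' ↦ by
    have := congr(g $(hR.bianchi e (I i e') X) Y)
    simp only [map_add, map_sum, map_smul, LinearMap.add_apply, LinearMap.sum_apply,
      LinearMap.smul_apply, smul_eq_mul, LinearMap.neg_apply, map_neg] at this
    rw [this]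
    refine Finset.sum_congr rfl fun s _ ↦ ?_
    rw [h.skew s (I i e'), h.skew i e', map_neg, h.symm (I s X) e]
    ring
  have f1 : ∀ s, contr g (fun e e' ↦ g (I s e) (I i e')) = -LinearMap.trace ℝ W (I i * I s) :=
    fun s ↦ by
    rw [← contr_apply_eq_trace h.symm h.nondeg, ← contr_neg]
    exact contr_congr g fun e e' ↦ by rw [Module.End.mul_apply, h.skew i, neg_neg]
  have f2 : ∀ s, contr g (fun e e' ↦ g e' (I i (I s X)) * g (T s e) Y) =
      g (T s (I i (I s X))) Y := fun s ↦ by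
    rw [contr_congr g fun e e' ↦ by rw [mul_comm, h.symm e']]
    exact contr_rank_one' h.symm h.nondeg (g.flip Y ∘ₗ T s) (I i (I s X))
  have f3 : ∀ s, contr g (fun e e' ↦ g e (-I s X) * -g (T s (I i e')) Y) =
      g (T s (I i (I s X))) Y := fun s ↦ by
    have := contr_rank_one h.symm h.nondeg (-(g.flip Y ∘ₗ T s ∘ₗ I i)) (-I s X)
    simpa using this
  have f4 : LinearMap.trace ℝ W (I i * I i) = eps i * Module.finrank ℝ W := by
    rw [show I i * I i = eps i • 1 from LinearMap.ext fun X ↦ h.sq i X, map_smul,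
      LinearMap.trace_one, smul_eq_mul]
  have f5 : LinearMap.trace ℝ W (I i * I (i + 1)) = 0 := by
    rw [show I i * I (i + 1) = -(eps (i + 2) • I (i + 2)) from LinearMap.ext fun X ↦ h.mul₀₁ i X,
      map_neg, map_smul, h.trace_I, smul_zero, neg_zero]
  have f6 : LinearMap.trace ℝ W (I i * I (i + 2)) = 0 := by
    rw [show I i * I (i + 2) = eps (i + 1) • I (i + 1) from LinearMap.ext fun X ↦ h.mul₀₂ i X,
      map_smul, h.trace_I, smul_zero]
  have f7 := congr(g $(hs.torsion_identity_I' h i X) Y)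
  simp only [contr_add, contr_sum, contr_smul, f1, f2, f3, e1, e2] at e3
  simp only [fin3_sum _ i, f4, f5, f6, map_add, map_smul, LinearMap.add_apply,
    LinearMap.smul_apply, smul_eq_mul] at e3 f7 ⊢
  linear_combination e3 + f7 + 2 * Module.finrank ℝ W * g (T i X) Y * eps_sq i

end IsCurv

end CurvatureAlgebra

/-! ### From the vertical Bianchi relations to the torsion splitting and the Ricci forms. -/

section VerticalAlgebra

variable {W : Type*} [AddCommGroup W] [Module ℝ W] [FiniteDimensional ℝ W]
  {g : LinearMap.BilinForm ℝ W} {I T : Fin 3 → Module.End ℝ W}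

lemma fin3_eq (i m : Fin 3) : m = i ∨ m = i + 1 ∨ m = i + 2 := by
  fin_cases i <;> fin_cases m <;> decide

lemma fin3_ne (i : Fin 3) : i ≠ i + 1 ∧ i ≠ i + 2 ∧ i + 1 ≠ i + 2 := by
  fin_cases i <;> decide

namespace IsPara

variable (h : IsPara g I)
include h

lemma mul_self (i : Fin 3) : I i * I i = eps i • 1 := LinearMap.ext fun X ↦ h.sq i X

lemma mul_I₀₁ (i : Fin 3) : I i * I (i + 1) = -(eps (i + 2) • I (i + 2)) :=
  LinearMap.ext fun X ↦ h.mul₀₁ i X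

lemma mul_I₀₂ (i : Fin 3) : I i * I (i + 2) = eps (i + 1) • I (i + 1) :=
  LinearMap.ext fun X ↦ h.mul₀₂ i X

lemma mul_I₁₀ (i : Fin 3) : I (i + 1) * I i = eps (i + 2) • I (i + 2) :=
  LinearMap.ext fun X ↦ h.mul₁₀ i X

lemma mul_I₂₀ (i : Fin 3) : I (i + 2) * I i = -(eps (i + 1) • I (i + 1)) :=
  LinearMap.ext fun X ↦ h.mul₂₀ i X

lemma trace_mul_self (i : Fin 3) :
    LinearMap.trace ℝ W (I i * I i) = eps i * Module.finrank ℝ W := by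
  rw [h.mul_self, map_smul, LinearMap.trace_one, smul_eq_mul]

lemma trace_I_mul_I {r m : Fin 3} (hrm : r ≠ m) : LinearMap.trace ℝ W (I r * I m) = 0 := by
  rcases fin3_eq r m with rfl | rfl | rfl
  · exact absurd rfl hrm
  · rw [h.mul_I₀₁, map_neg, map_smul, h.trace_I, smul_zero, neg_zero]
  · rw [h.mul_I₀₂, map_smul, h.trace_I, smul_zero]

lemma trace_sum_smul_mul (a : Fin 3 → ℝ) (m : Fin 3) :
    LinearMap.trace ℝ W ((∑ r, a r • I r) * I m) = a m * (eps m * Module.finrank ℝ W) := by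
  rw [Finset.sum_mul, map_sum, Finset.sum_eq_single m]
  · rw [smul_mul_assoc, map_smul, h.trace_mul_self, smul_eq_mul]
  · intro r _ hr
    rw [smul_mul_assoc, map_smul, h.trace_I_mul_I hr, smul_zero]
  · simp

lemma contr_I (B : Module.End ℝ W) (s : Fin 3) :
    contr g (fun e e' ↦ g (B e) (I s e')) = -LinearMap.trace ℝ W (B * I s) := by
  rw [LinearMap.trace_mul_comm, ← contr_apply_eq_trace h.symm h.nondeg, ← contr_neg]
  exact contr_congr g fun e e' ↦ by rw [Module.End.mul_apply, h.skew s, neg_neg]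

/-- The components of the commutators `[B, I_i]` with the paraquaternionic structure. -/
lemma commutator_coeff (hd : (Module.finrank ℝ W : ℝ) ≠ 0) {B : Module.End ℝ W}
    {c : Fin 3 → Fin 3 → ℝ} (hB : ∀ i, B * I i - I i * B = ∑ s, c s i • I s) (i : Fin 3) :
    c i i = 0 ∧
    c (i + 2) i * Module.finrank ℝ W = 2 * eps i * contr g (fun e e' ↦ g (B e) (I (i + 1) e')) ∧
    c (i + 1) i * Module.finrank ℝ W =
      -(2 * eps i * contr g (fun e e' ↦ g (B e) (I (i + 2) e'))) := by
  -- The trace of `[B, I_i] I_m` picks out the coefficient of `I_m`, and it equals the trace of `B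
  -- [I_i, I_m]`, a multiple of the trace of `B` with the third generator.
  have key : ∀ m, LinearMap.trace ℝ W (B * (I i * I m)) - LinearMap.trace ℝ W (B * (I m * I i)) =
      c m i * (eps m * Module.finrank ℝ W) := fun m ↦ by
    rw [← h.trace_sum_smul_mul (fun s ↦ c s i), ← hB, sub_mul, map_sub, mul_assoc, mul_assoc (I i),
      LinearMap.trace_mul_comm ℝ (I i), mul_assoc]
  have k0 := key i
  have k1 := key (i + 1)
  have k2 := key (i + 2)
  rw [h.mul_I₀₁, h.mul_I₁₀, mul_neg, map_neg, mul_smul_comm, map_smul, smul_eq_mul] at k1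
  rw [h.mul_I₀₂, h.mul_I₂₀, mul_neg, map_neg, mul_smul_comm, map_smul, smul_eq_mul] at k2
  rw [h.contr_I, h.contr_I]
  rw [sub_self] at k0
  refine ⟨?_, ?_, ?_⟩
  · simpa [eps_ne_zero, hd] using k0.symm
  all_goals
    rcases eps_cases i with ⟨h1, h2, h3⟩ | ⟨h1, h2, h3⟩ | ⟨h1, h2, h3⟩ <;>
    simp only [h1, h2, h3] at k1 k2 ⊢ <;> linarith

/-- The algebraic content of the vertical part of the first Bianchi identity. -/
lemma exists_ricciForm (hd : (Module.finrank ℝ W : ℝ) ≠ 0) {t : Fin 3 → Fin 3 → Fin 3 → ℝ}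
    {ρ : Fin 3 → W → W → ℝ} (ht : ∀ r i s, t r i s = - t i r s)
    (hT : ∀ i s, LinearMap.trace ℝ W (T i * I s) = 0)
    (hB : ∀ i, ∀ B : Module.End ℝ W, (∀ X Y, g (B X) Y = - g X (B Y)) →
      (∀ s X, B (I s X) = I s (B X)) → LinearMap.trace ℝ W (T i * B) = 0)
    (h0 : ∀ i X Y, 0 = -2 * (∑ r, eps r * t r i i * g (I r X) Y) -
      2 * eps i * (g (T i X) (I i Y) * (-1) + g (I i X) (T i Y)))
    (h1 : ∀ i X Y, -(2 * eps i * ρ (i + 2) X Y) = -2 * (∑ r, eps r * t r i (i + 1) * g (I r X) Y) -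
      2 * eps (i + 1) * (g (T i X) (I (i + 1) Y) * (-1) + g (I (i + 1) X) (T i Y)))
    (h2 : ∀ i X Y, 2 * eps i * ρ (i + 1) X Y = -2 * (∑ r, eps r * t r i (i + 2) * g (I r X) Y) -
      2 * eps (i + 2) * (g (T i X) (I (i + 2) Y) * (-1) + g (I (i + 2) X) (T i Y))) :
    ∃ U N, IsSplit g I T U N ∧
      (∀ s X Y, ρ s X Y = ricciForm g I N U (eps 2 * t 0 1 2) s X Y) ∧
      ∀ i, t i (i + 1) i = 0 ∧ t i (i + 1) (i + 1) = 0 ∧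
        t i (i + 1) (i + 2) = eps (i + 2) * (eps 2 * t 0 1 2) := by
  -- `K i s` represents the part of the relations that is quadratic in `I_s` and `T_i`. Its traces
  -- against the `I_m` vanish, for `s ≠ m` because `T_i` is orthogonal to `sp(1)`, so tracing a
  -- relation isolates the numbers `t`.
  obtain ⟨K, hK⟩ : ∃ K : Fin 3 → Fin 3 → Module.End ℝ W,
      ∀ i s, K i s = I s * T i + adj h.nondeg (T i) * I s := ⟨_, fun i s ↦ rfl⟩
  have hKg : ∀ i s X Y, g (T i X) (I s Y) * (-1) + g (I s X) (T i Y) = g (K i s X) Y :=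
    fun i s X Y ↦ by
    simp only [hK, LinearMap.add_apply, Module.End.mul_apply, map_add, h.skew,
      adj_apply h.symm]
    ring
  simp only [hKg] at h0 h1 h2
  have hKtr : ∀ i s m, LinearMap.trace ℝ W (K i s * I m) =
      2 * LinearMap.trace ℝ W (T i * (I m * I s)) := fun i s m ↦ by
    have e := trace_adj h.symm h.nondeg (adj h.nondeg (T i) * I s * I m)
    rw [adj_mul h.symm, adj_mul h.symm, adj_adj h.symm, h.adj_I, h.adj_I, neg_mul, neg_mul,
      mul_neg, neg_neg, ← mul_assoc, LinearMap.trace_mul_comm] at e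
    rw [hK, add_mul, map_add, ← e, mul_assoc (I s), LinearMap.trace_mul_comm ℝ (I s), mul_assoc]
    ring
  have hKne : ∀ i s m, s ≠ m → LinearMap.trace ℝ W (K i s * I m) = 0 := fun i s m hsm ↦ by
    rw [hKtr]
    rcases fin3_eq m s with rfl | rfl | rfl
    · exact absurd rfl hsm
    · rw [h.mul_I₀₁, mul_neg, mul_smul_comm, map_neg, map_smul, hT]; simp
    · rw [h.mul_I₀₂, mul_smul_comm, map_smul, hT]; simp
  have ext : ∀ {A B : Module.End ℝ W}, (∀ X Y, g (A X) Y = g (B X) Y) → A = B := fun hAB ↦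
    LinearMap.ext fun X ↦ eq_of_forall_g h.nondeg (hAB X)
  have hsum : ∀ (a : Fin 3 → ℝ) X Y, g ((∑ r, a r • I r) X) Y = ∑ r, a r * g (I r X) Y :=
    fun a X Y ↦ by
    simp only [LinearMap.sum_apply, map_sum, LinearMap.smul_apply, map_smul, smul_eq_mul]
  have k0 : ∀ i, ∑ r, (eps r * t r i i) • I r + eps i • K i i = 0 := fun i ↦ ext fun X Y ↦ by
    have := h0 i X Y
    rw [LinearMap.add_apply, map_add, LinearMap.add_apply, hsum]
    simp only [LinearMap.smul_apply, map_smul, smul_eq_mul, LinearMap.zero_apply, map_zero]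
    linarith
  have ht0 : ∀ r i, t r i i = 0 := fun r i ↦ by
    by_cases hri : r = i
    · subst hri
      linarith [ht r r r]
    · have e := congr(LinearMap.trace ℝ W ($(k0 i) * I r))
      rw [add_mul, map_add, h.trace_sum_smul_mul, smul_mul_assoc, map_smul, hKne _ _ _ (Ne.symm hri)]
        at e
      simpa [eps_ne_zero, hd] using e
  have hKK : ∀ i, K i i = 0 := fun i ↦ by
    have := k0 i
    simpa [ht0, eps_ne_zero] using this
  have htr : ∀ i, LinearMap.trace ℝ W (T i) = 0 := fun i ↦ by
    have := hKtr i i i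
    rw [hKK, h.mul_self, mul_smul_comm, map_smul] at this
    simpa [eps_ne_zero] using this
  have hKm : ∀ i s m, LinearMap.trace ℝ W (K i s * I m) = 0 := fun i s m ↦ by
    by_cases hsm : s = m
    · subst hsm
      rw [hKtr, h.mul_self, mul_smul_comm, map_smul, mul_one, htr]
      simp
    · exact hKne i s m hsm
  -- The form `ρ_{i+1}` occurs twice, in `h2` at `i` and in `h1` at `i + 2`; it is eliminated here.
  have k12 : ∀ i, ∑ r, (eps r * (eps (i + 2) * t r i (i + 2) + eps i * t r (i + 2) i)) • I r +
      (K i (i + 2) + K (i + 2) i) = 0 := fun i ↦ ext fun X Y ↦ by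
    have e1 := h1 (i + 2) X Y
    have e2 := h2 i X Y
    rw [(fin3_add i).2.2.1, (fin3_add i).2.2.2] at e1
    rw [LinearMap.add_apply, map_add, LinearMap.add_apply, hsum]
    simp only [LinearMap.add_apply, map_add, LinearMap.zero_apply, map_zero, fin3_sum _ i]
      at e1 e2 ⊢
    rcases eps_cases i with ⟨h1, h2, h3⟩ | ⟨h1, h2, h3⟩ | ⟨h1, h2, h3⟩ <;>
    simp only [h1, h2, h3] at e1 e2 ⊢ <;> linarith
  have hts : ∀ i r, eps (i + 2) * t r i (i + 2) + eps i * t r (i + 2) i = 0 := fun i r ↦ by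
    have e := congr(LinearMap.trace ℝ W ($(k12 i) * I r))
    rw [add_mul, map_add, h.trace_sum_smul_mul, add_mul, map_add, hKm, hKm] at e
    simpa [eps_ne_zero, hd] using e
  have hE : ∀ i, K i (i + 2) = - K (i + 2) i := fun i ↦ by
    have e := k12 i
    simp only [hts, mul_zero, zero_smul, Finset.sum_const_zero, zero_add] at e
    exact eq_neg_of_add_eq_zero_left e
  obtain ⟨U, N, hs⟩ := h.exists_split hT hB
    (fun i X ↦ by simpa [hK] using congr($(hKK i) X))
    (fun i X ↦ by simpa [hK] using congr($(hE i) X))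
  -- The weighted skewness `hts` in the last two indices and the skewness `ht` in the first two
  -- leave a single free number, `c = ε_2 t_{012}`.
  have hc : ∀ i, t i (i + 1) (i + 2) = eps (i + 2) * (eps 2 * t 0 1 2) := by
    have c0 := hts 0 1
    have c1 := hts 1 2
    have a0 := ht 1 0 2
    have a1 := ht 2 1 0
    intro i
    fin_cases i
    · simp [eps]
    · simp [eps] at c0 c1 ⊢
      linarith
    · simp [eps] at c0 c1 ⊢
      linarith
  refine ⟨U, N, hs, fun s X Y ↦ ?_, fun i ↦ ⟨?_, ht0 _ _, hc i⟩⟩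
  -- Now that `t` and the splitting are known, `h2` simply expresses `ρ_{i+1}`.
  · obtain ⟨i, rfl⟩ : ∃ i, s = i + 1 := ⟨s + 2, (fin3_add s).2.2.1.symm⟩
    have e := h2 i X Y
    have e1 : t (i + 1) i (i + 2) = -(eps (i + 2) * (eps 2 * t 0 1 2)) := by rw [ht, hc]
    have e2 : t (i + 2) i (i + 2) = 0 := by rw [ht, ht0, neg_zero]
    have e3 : t i i (i + 2) = 0 := by linarith [ht i i (i + 2)]
    have e4 : g (K i (i + 2) X) Y = g ((2 : ℝ) • N (i + 1) X - (2 * eps (i + 1)) • U (I (i + 1) X)) Y := by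
      have e5 : ∀ X, adj h.nondeg (T i) X = T i X - (2 : ℝ) • U (I i X) := fun X ↦
        eq_of_forall_g h.nondeg fun Y ↦ by rw [adj_apply h.symm, h.symm, hs.g_T h, h.symm]
      congr 2
      rw [hK, LinearMap.add_apply, Module.End.mul_apply, Module.End.mul_apply, e5]
      simp only [hs.T_eq]
      rcases eps_cases i with ⟨h1, h2, h3⟩ | ⟨h1, h2, h3⟩ | ⟨h1, h2, h3⟩ <;>
      simp only [h1, h2, h3, h.sq, h.mul₀₁, h.mul₀₂, h.mul₁₀, h.mul₁₂, h.mul₂₀, h.mul₂₁, map_add,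
        map_smul, map_neg, map_sub, hs.N_comm, hs.U_comm] <;> module
    rw [e4, fin3_sum _ i, e1, e2, e3] at e
    simp only [ricciForm, map_add, map_sub, map_smul, map_neg, LinearMap.add_apply,
      LinearMap.sub_apply, LinearMap.smul_apply, LinearMap.neg_apply, smul_eq_mul] at e ⊢
    rcases eps_cases i with ⟨h1, h2, h3⟩ | ⟨h1, h2, h3⟩ | ⟨h1, h2, h3⟩ <;>
    simp only [h1, h2, h3] at e ⊢ <;> linarith
  · rw [ht, ht0, neg_zero]

end IsPara

end VerticalAlgebra

/-! ### Translation into `τ` and `μ`, and the formulas for `ζ_s` and `ϱ_s`. -/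

section RicciFormulas

variable {W : Type*} [AddCommGroup W] [Module ℝ W] [FiniteDimensional ℝ W]
  {g : LinearMap.BilinForm ℝ W} {I T : Fin 3 → Module.End ℝ W} {U : Module.End ℝ W}
  {N : Fin 3 → Module.End ℝ W} (h : IsPara g I) (hs : IsSplit g I T U N)

lemma IsPara.g_I_right (h : IsPara g I) (s : Fin 3) (X Y : W) : g X (I s Y) = - g (I s X) Y := by
  rw [h.skew, neg_neg]

namespace IsSplit
include h hs

/-- By `g_T` the symmetric part of `T_s` consists of its `N` terms and the skew part is `U I_s`.
Each `N_t I_t` arises twice, from the two indices other than `t`, and the sign is `ε_0 ε_1 ε_2 =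
-1`. -/
lemma tau_eq (X Y : W) : -∑ s, eps s * ((g (T s (I s X)) Y + g (T s Y) (I s X)) / 2) =
    -2 * ∑ s, g (N s (I s X)) Y := by
  have e : ∀ s, g (T s (I s X)) Y + g (T s Y) (I s X) =
      g (2 • T s (I s X) - (2 * eps s) • U X) Y := fun s ↦ by
    rw [hs.g_T h s Y, h.symm Y]
    simp only [h.sq, map_smul, map_sub, LinearMap.sub_apply, LinearMap.smul_apply, smul_eq_mul]
    simp only [two_smul, map_add, LinearMap.add_apply]
    ring
  simp only [e]
  simp only [fin3_sum _ (0 : Fin 3), hs.T_eq 0, hs.T_eq₁ 0, hs.T_eq₂ 0]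
  rcases eps_cases 0 with ⟨h1, h2, h3⟩ | ⟨h1, h2, h3⟩ | ⟨h1, h2, h3⟩ <;>
  simp only [h1, h2, h3, h.sq, h.mul₀₁, h.mul₀₂, h.mul₁₀, h.mul₁₂, h.mul₂₀, h.mul₂₁, map_add,
    map_smul, map_neg, map_sub, hs.N_comm, hs.U_comm, LinearMap.add_apply, LinearMap.sub_apply,
    LinearMap.smul_apply, LinearMap.neg_apply, smul_eq_mul, two_smul] <;> ring

lemma mu_eq (s : Fin 3) (X Y : W) :
    eps s * ((g (T s (I s X)) Y - g (T s Y) (I s X)) / 2) = g (U X) Y := by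
  rw [hs.g_T h s Y, h.symm Y]
  simp only [h.sq, map_smul, map_sub, LinearMap.sub_apply, LinearMap.smul_apply, smul_eq_mul]
  linear_combination g (U X) Y * eps_sq s

/-- For a non-null `X` the vectors `X, I_0 X, I_1 X, I_2 X` form an orthogonal basis. As `U I_s` is
skew, `U X` is orthogonal to each `I_s X`, so `U X = a X`; commuting with the `I_s` gives `U = a`,
and the trace gives `a = 0`. -/
lemma U_eq_zero (hd : Module.finrank ℝ W = 4) : U = 0 := by
  have : Nontrivial W := Module.nontrivial_of_finrank_pos (R := ℝ) (by omega)
  obtain ⟨X, hX⟩ : ∃ X, g X X ≠ 0 := by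
    by_contra! h0
    obtain ⟨X, hX⟩ := exists_ne (0 : W)
    refine hX (eq_of_forall_g h.nondeg fun Y ↦ ?_)
    have := h0 (X + Y)
    simp only [map_add, LinearMap.add_apply, h0] at this
    rw [h.symm Y X] at this
    simp only [map_zero, LinearMap.zero_apply]
    linarith
  have hsk : ∀ s, g X (I s X) = 0 := fun s ↦ by
    have := h.skew s X X
    rw [h.symm] at this
    linarith
  have hne : ∀ s, g (I s X) (I s X) ≠ 0 := fun s ↦ by
    rw [h.metric]
    exact neg_ne_zero.2 (mul_ne_zero (eps_ne_zero s) hX)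
  have hIs : ∀ i, g (I i X) (I (i + 1) X) = 0 ∧ g (I i X) (I (i + 2) X) = 0 := fun i ↦ by
    rw [h.skew, h.skew, h.mul₀₁, h.mul₀₂, map_neg, map_smul, map_smul, hsk, hsk]
    simp
  have horth : g.iIsOrtho ![X, I 0 X, I 1 X, I 2 X] := by
    have e := fun i ↦ (hIs i)
    have e0 := e 0
    have e1 := e 1
    have e2 := e 2
    have hsk' : ∀ s, g (I s X) X = 0 := fun s ↦ by rw [h.symm, hsk]
    intro a b hab
    fin_cases a <;> fin_cases b <;> first | exact absurd rfl hab | skip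
    all_goals
      first
      | exact hsk _ | exact hsk' _ | exact e0.1 | exact e0.2 | exact e1.1 | exact e1.2
      | exact e2.1 | exact e2.2
  have hli := LinearMap.BilinForm.linearIndependent_of_iIsOrtho horth (by
    intro a
    fin_cases a
    · exact hX
    all_goals exact hne _)
  set b := basisOfLinearIndependentOfCardEqFinrank hli (by simp [hd])
  have hb : ∀ a, b a = ![X, I 0 X, I 1 X, I 2 X] a := fun a ↦ by
    simp [b]
  have hUI : ∀ s, g (U X) (I s X) = 0 := fun s ↦ by
    have e1 := h.g_I_right s (U X) X
    rw [hs.U_comm, hs.U_symm (I s X), h.symm (I s X)] at e1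
    linarith
  set a : ℝ := g (U X) X / g X X
  have hUX : U X = a • X := by
    refine eq_of_forall_g h.nondeg fun Y ↦ ?_
    refine LinearMap.congr_fun (f := g (U X)) (g := g (a • X)) (b.ext fun r ↦ ?_) Y
    rw [hb]
    fin_cases r
    · simp [a, hX]
    all_goals
      refine (hUI _).trans ?_
      simp [hsk]
  have hU : U = a • 1 := b.ext fun r ↦ by
    rw [hb]
    fin_cases r
    · exact hUX
    all_goals
      refine (hs.U_comm _ X).symm.trans ?_
      simp [hUX]
  have ha := hs.U_trace
  rw [hU, map_smul, LinearMap.trace_one, hd] at ha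
  have : a = 0 := by simpa using ha
  rw [hU, this, zero_smul]

lemma g_N_I_I (s : Fin 3) (X Y : W) : g (N s (I s (I s X))) (I s Y) =
    -(eps s * g (N s (I s X)) Y) := by
  rw [h.g_I_right, hs.N_comm]
  simp only [h.sq, map_smul, LinearMap.smul_apply, smul_eq_mul]

/-- Rotating both arguments by `I_s` gives the terms `t ≠ s` the sign opposite to that of `t = s`.
Hence `ε_s τ - τ(I_s ·, I_s ·)` isolates `N_s I_s`. -/
lemma sum_g_N_I_I (s : Fin 3) (X Y : W) : ∑ t, g (N t (I t (I s X))) (I s Y) =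
    -(eps s * (2 * g (N s (I s X)) Y - ∑ t, g (N t (I t X)) Y)) := by
  simp only [h.g_I_right, hs.N_comm, fin3_sum _ s]
  rcases eps_cases s with ⟨h1, h2, h3⟩ | ⟨h1, h2, h3⟩ | ⟨h1, h2, h3⟩ <;>
  simp only [h1, h2, h3, h.sq, h.mul₀₁, h.mul₀₂, h.mul₁₀, h.mul₁₂, h.mul₂₀, h.mul₂₁, map_add,
    map_smul, map_neg, map_sub, hs.N_comm, hs.U_comm, LinearMap.add_apply, LinearMap.sub_apply,
    LinearMap.smul_apply, LinearMap.neg_apply, smul_eq_mul, two_smul] <;> ring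

lemma g_U_I (s : Fin 3) (X Y : W) : g (U (I s X)) (I s Y) = -(eps s * g (U X) Y) := by
  rw [h.g_I_right, hs.U_comm]
  simp only [h.sq, map_smul, LinearMap.smul_apply, smul_eq_mul]

lemma ricciForm_I (c : ℝ) (s : Fin 3) (X Y : W) : ricciForm g I N U c s X (I s Y) =
    eps s * (c * g X Y - 2 * g (N s (I s X)) Y + 2 * g (U X) Y) := by
  rw [ricciForm, h.g_I_right]
  simp only [h.sq, map_add, map_sub, map_neg, map_smul, LinearMap.add_apply, LinearMap.sub_apply,
    LinearMap.neg_apply, LinearMap.smul_apply, smul_eq_mul, hs.N_comm, hs.U_comm]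
  ring

end IsSplit

namespace IsCurv

variable {c : ℝ} {R : W →ₗ[ℝ] W →ₗ[ℝ] Module.End ℝ W} (hR : IsCurv g I T N U c R)
include h hs hR

lemma zeta_formula (i : Fin 3) (X Y : W) : contr g (fun e e' ↦ g (R e X (I i Y)) (I i e')) =
    -(eps i * ((Module.finrank ℝ W / 2) * c * g X Y - Module.finrank ℝ W * ∑ s, g (N s (I s X)) Y -
      4 * g (N i (I i X)) Y + (Module.finrank ℝ W + 2) * g (U X) Y)) := by
  rw [hR.zeta_I' h hs, hR.ric_eq h hs]
  simp only [map_add, map_sub, map_neg, map_smul, LinearMap.add_apply, LinearMap.sub_apply,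
    LinearMap.neg_apply, LinearMap.smul_apply, smul_eq_mul, fin3_sum _ i]
  ring

lemma varrho_formula (i : Fin 3) (X Y : W) : contr g (fun e e' ↦ g (R e (I i e') X) (I i Y)) =
    eps i * (Module.finrank ℝ W * c * g X Y -
      (2 * Module.finrank ℝ W + 16) * g (N i (I i X)) Y) := by
  rw [hR.varrho_eq h hs, hR.zeta_formula h hs, h.g_I_right, hs.T_eq]
  simp only [fin3_sum _ i]
  rcases eps_cases i with ⟨h1, h2, h3⟩ | ⟨h1, h2, h3⟩ | ⟨h1, h2, h3⟩ <;>
  simp only [h1, h2, h3, h.sq, h.mul₀₁, h.mul₀₂, h.mul₁₀, h.mul₁₂, h.mul₂₀, h.mul₂₁, map_add,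
    map_smul, map_neg, map_sub, hs.N_comm, hs.U_comm, LinearMap.add_apply, LinearMap.sub_apply,
    LinearMap.smul_apply, LinearMap.neg_apply, smul_eq_mul, two_smul] <;> ring

end IsCurv

end RicciFormulas

section Geometry

variable {n : ℕ} {M : Type*} [TopologicalSpace M]
  [ChartedSpace (EuclideanSpace ℝ (Fin (4 * n + 3))) M] [IsManifold (𝓡 (4 * n + 3)) ∞ M]

/-! ### Local frames and Reeb fields -/

lemma SmoothFun.inv {U : Set M} {f : M → ℝ} (hf : SmoothFun n U f) (h0 : ∀ x ∈ U, f x ≠ 0) :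
    SmoothFun n U (fun x ↦ (f x)⁻¹) := ContMDiffOn.inv₀ hf h0

lemma SmoothFun.det {U : Set M} {m : M → Matrix (Fin 3) (Fin 3) ℝ}
    (hm : ∀ s t, SmoothFun n U (fun x ↦ m x s t)) : SmoothFun n U (fun x ↦ (m x).det) := by
  simp only [Matrix.det_fin_three]
  exact ((((((hm 0 0).mul (hm 1 1)).mul (hm 2 2)).sub (((hm 0 0).mul (hm 1 2)).mul (hm 2 1))).sub
    (((hm 0 1).mul (hm 1 0)).mul (hm 2 2))).add (((hm 0 1).mul (hm 1 2)).mul (hm 2 0))).add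
    (((hm 0 2).mul (hm 1 0)).mul (hm 2 1)) |>.sub (((hm 0 2).mul (hm 1 1)).mul (hm 2 0))

lemma SmoothFun.matrix_inv {U : Set M} {m : M → Matrix (Fin 3) (Fin 3) ℝ}
    (hm : ∀ s t, SmoothFun n U (fun x ↦ m x s t)) (h0 : ∀ x ∈ U, (m x).det ≠ 0) (s t : Fin 3) :
    SmoothFun n U (fun x ↦ (m x)⁻¹ s t) := by
  simp only [Matrix.inv_def, Matrix.smul_apply, Ring.inverse_eq_inv', smul_eq_mul,
    Matrix.adjugate_apply]
  refine (SmoothFun.det hm).inv h0 |>.mul (SmoothFun.det fun a b ↦ ?_)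
  by_cases hat : a = t
  · subst hat
    simp only [Matrix.updateRow_self]
    exact smoothFun_const _
  · simp only [Matrix.updateRow_ne hat]
    exact hm a b

/-- The restriction of a frame to a smaller open set. -/
def HorizontalData.Frame.restrict {S : HorizontalData n M} (F : S.Frame) (W : Set M)
    (hW : IsOpen W) : S.Frame where
  U := F.U ∩ W
  η := F.η
  I := F.I
  isOpen_U := F.isOpen_U.inter hW
  smooth_η s := (F.smooth_η s).mono Set.inter_subset_left
  smooth_I s W' hW' hWU := F.smooth_I s W' hW' (hWU.trans Set.inter_subset_left)
  ker_η x hx := F.ker_η x hx.1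
  span_I x hx := F.span_I x hx.1
  sq_I x hx := F.sq_I x hx.1
  mul_I x hx := F.mul_I x hx.1
  mul_I' x hx := F.mul_I' x hx.1
  metric_I x hx := F.metric_I x hx.1
  contact x hx := F.contact x hx.1

variable {S : Structure n M}

lemma isPara (F : S.Frame) {x : M} (hx : x ∈ F.U) : IsPara (S.g x) (fun s ↦ F.I s x) where
  symm := S.g_symm x
  nondeg := S.g_nondegenerate x
  sq s X := congr($(F.sq_I x hx s) X)
  mul₀₁ i X := congr($(F.mul_I x hx i) X)
  mul₁₀ i X := congr($(F.mul_I' x hx i) X)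
  metric := F.metric_I x hx

namespace Complement

variable {C : Complement S}

lemma hor_coe {x : M} (X : S.H x) : C.hor x (X : Tan n x) = X :=
  Submodule.projectionOnto_apply_left _ X

lemma hor_of_mem {x : M} {A : Tan n x} (hA : A ∈ S.H x) : (C.hor x A : Tan n x) = A :=
  congrArg Subtype.val (hor_coe (C := C) ⟨A, hA⟩)

lemma hor_of_mem_V {x : M} {A : Tan n x} (hA : A ∈ C.V x) : C.hor x A = 0 :=
  Submodule.projectionOnto_apply_right (C.isCompl x) ⟨A, hA⟩

lemma ver_coe {x : M} (A : C.V x) : C.ver x (A : Tan n x) = A :=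
  Submodule.projectionOnto_apply_left _ A

lemma ver_of_mem {x : M} {A : Tan n x} (hA : A ∈ C.V x) : (C.ver x A : Tan n x) = A :=
  congrArg Subtype.val (ver_coe (C := C) ⟨A, hA⟩)

lemma hor_add_ver {x : M} (A : Tan n x) : (C.hor x A : Tan n x) + C.ver x A = A := by
  obtain ⟨a, ha, b, hb, rfl⟩ := Submodule.mem_sup.1
    (show A ∈ S.H x ⊔ C.V x by rw [(C.isCompl x).sup_eq_top]; trivial)
  have h : C.ver x a = 0 := Submodule.projectionOnto_apply_right (C.isCompl x).symm ⟨a, ha⟩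
  rw [map_add, map_add, hor_of_mem_V hb, h, add_zero, zero_add, hor_of_mem ha, ver_of_mem hb]

variable {F : S.Frame} {ξ : Fin 3 → Π x : M, Tan n x}

lemma η_of_mem {x : M} (hx : x ∈ F.U) {A : Tan n x} (hA : A ∈ S.H x) (s : Fin 3) :
    F.η s x A = 0 := (F.ker_η x hx A).1 hA s

variable (hξ : C.IsReeb F ξ)
include hξ

lemma ξ_mem {x : M} (hx : x ∈ F.U) (s : Fin 3) : ξ s x ∈ C.V x := (hξ x hx s).1

lemma η_ξ {x : M} (hx : x ∈ F.U) (s t : Fin 3) : F.η s x (ξ t x) = if s = t then 1 else 0 :=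
  (hξ x hx t).2 s

lemma η_sum_ξ {x : M} (hx : x ∈ F.U) (s : Fin 3) (a : Fin 3 → ℝ) :
    F.η s x (∑ t, a t • ξ t x) = a s := by
  simp [map_sum, η_ξ hξ hx]

lemma sum_η_of_mem_V {x : M} (hx : x ∈ F.U) {A : Tan n x} (hA : A ∈ C.V x) :
    ∑ s, F.η s x A • ξ s x = A := by
  refine (sub_eq_zero.1 ?_).symm
  have h1 : A - ∑ s, F.η s x A • ξ s x ∈ C.V x :=
    sub_mem hA (sum_mem fun s _ ↦ Submodule.smul_mem _ _ (ξ_mem hξ hx s))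
  have h2 : A - ∑ s, F.η s x A • ξ s x ∈ S.H x := by
    rw [F.ker_η x hx]
    intro s
    rw [map_sub, η_sum_ξ hξ hx, sub_self]
  exact Submodule.disjoint_def.1 (C.isCompl x).disjoint _ h2 h1

lemma η_ver {x : M} (hx : x ∈ F.U) (A : Tan n x) (s : Fin 3) :
    F.η s x (C.ver x A) = F.η s x A := by
  conv_rhs => rw [← hor_add_ver (C := C) A, map_add, η_of_mem hx (C.hor x A).2, zero_add]

lemma hor_add_sum {x : M} (hx : x ∈ F.U) (A : Tan n x) :
    (C.hor x A : Tan n x) + ∑ s, F.η s x A • ξ s x = A := by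
  conv_rhs => rw [← hor_add_ver (C := C) A]
  rw [← sum_η_of_mem_V hξ hx (C.ver x A).2]
  simp only [η_ver hξ hx]

/-- Only some smooth fields `ζ_t` spanning `V` are given. The Reeb fields are their combinations
with coefficient matrix the inverse of `η_s(ζ_t)`, and this inverse is smooth by Cramer's rule. -/
lemma smooth_ξ (s : Fin 3) : SmoothField F.U (ξ s) := by
  intro x hx
  obtain ⟨U, hU, hxU, ζ, hζ, hV⟩ := C.smooth x
  have l := Set.inter_subset_left (s := F.U) (t := U)
  have r := Set.inter_subset_right (s := F.U) (t := U)
  have hO := F.isOpen_U.inter hU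
  set m : M → Matrix (Fin 3) (Fin 3) ℝ := fun y ↦ Matrix.of fun s t ↦ F.η s y (ζ t y)
  have hm : ∀ s t, SmoothFun n (F.U ∩ U) (fun x ↦ m x s t) := fun s t ↦
    ((F.smooth_η s).mono l).apply ((hζ t).mono r)
  have hinv : ∀ y ∈ F.U ∩ U, ∃ a : Matrix (Fin 3) (Fin 3) ℝ, m y * a = 1 ∧
      ∀ s, ξ s y = ∑ t, a t s • ζ t y := fun y hy ↦ by
    have : ∀ s, ∃ c : Fin 3 → ℝ, ∑ t, c t • ζ t y = ξ s y := fun s ↦ by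
      have h := ξ_mem hξ hy.1 s
      rw [hV y hy.2] at h
      exact (Submodule.mem_span_range_iff_exists_fun ℝ).1 h
    choose c hc using this
    refine ⟨Matrix.of fun t s ↦ c s t, ?_, fun s ↦ (hc s).symm⟩
    ext a b
    have h := η_ξ hξ hy.1 a b
    rw [← hc b] at h
    simp only [map_sum, map_smul, smul_eq_mul] at h
    rw [Matrix.mul_apply, Matrix.one_apply, ← h]
    exact Finset.sum_congr rfl fun t _ ↦ mul_comm _ _
  have hdet : ∀ y ∈ F.U ∩ U, (m y).det ≠ 0 := fun y hy ↦ by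
    obtain ⟨a, ha, -⟩ := hinv y hy
    have := congrArg Matrix.det ha
    rw [Matrix.det_mul, Matrix.det_one] at this
    exact left_ne_zero_of_mul_eq_one this
  have key : SmoothField (F.U ∩ U) (ξ s) := by
    refine SmoothField.congr (SmoothField.sum (s := Finset.univ) fun t _ ↦
      SmoothField.smul (SmoothFun.matrix_inv hm hdet t s) ((hζ t).mono r)) fun y hy ↦ ?_
    obtain ⟨a, ha, ha'⟩ := hinv y hy
    rw [ha', Matrix.inv_eq_right_inv ha]
  exact (key.contMDiffAt hO ⟨hx, hxU⟩).contMDiffWithinAt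

lemma smooth_hor {X : Π x : M, Tan n x} (hX : SmoothField F.U X) :
    SmoothField F.U (fun y ↦ (C.hor y (X y) : Tan n y)) :=
  (hX.sub (SmoothField.sum (s := Finset.univ) fun s _ ↦
    SmoothField.smul ((F.smooth_η s).apply hX) (smooth_ξ hξ s))).congr fun y hy ↦ by
    rw [eq_sub_iff_add_eq, hor_add_sum hξ hy]

end Complement

end Geometry

section CanonicalConnection

variable {n : ℕ} {M : Type*} [TopologicalSpace M]
  [ChartedSpace (EuclideanSpace ℝ (Fin (4 * n + 3))) M] [IsManifold (𝓡 (4 * n + 3)) ∞ M]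
  {S : Structure n M}

/-! ### The canonical connection on fields -/

namespace Complement

variable {C : Complement S} {F : S.Frame} {ξ : Fin 3 → Π x : M, Tan n x} {cov : Conn n M}

variable (C F) in
/-- The action `A · B = ∑ η_s(A) I_s(B_H)` of the identification `V → PQ`. -/
noncomputable def act (x : M) : Tan n x →ₗ[ℝ] Tan n x →ₗ[ℝ] Tan n x :=
  ∑ s, (F.η s x).toLinearMap.smulRight ((S.H x).subtype ∘ₗ F.I s x ∘ₗ C.hor x)

lemma act_apply (x : M) (A B : Tan n x) :
    C.act F x A B = ((∑ s, F.η s x A • F.I s x (C.hor x B) : S.H x) : Tan n x) := by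
  simp [act]

lemma act_mem (x : M) (A B : Tan n x) : C.act F x A B ∈ S.H x := by
  rw [act_apply]
  exact Subtype.property _

lemma act_ξ (hξ : C.IsReeb F ξ) {x : M} (hx : x ∈ F.U) (s : Fin 3) (X : S.H x) :
    C.act F x (ξ s x) X = F.I s x X := by
  rw [act_apply, hor_coe]
  simp [η_ξ hξ hx]

lemma smooth_I_hor {X : Π x : M, Tan n x} (hξ : C.IsReeb F ξ) (hX : SmoothField F.U X) (s : Fin 3) :
    SmoothField F.U (fun y ↦ (F.I s y (C.hor y (X y)) : Tan n y)) :=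
  F.smooth_I s F.U F.isOpen_U subset_rfl _ (smooth_hor hξ hX)

lemma smooth_act {X A : Π x : M, Tan n x} (hξ : C.IsReeb F ξ) (hA : SmoothField F.U A)
    (hX : SmoothField F.U X) : SmoothField F.U (fun y ↦ C.act F y (A y) (X y)) := by
  refine (SmoothField.sum (s := Finset.univ) fun s _ ↦ SmoothField.smul
    ((F.smooth_η s).apply hA) (smooth_I_hor hξ hX s)).congr fun y _ ↦ ?_
  rw [act_apply]
  simp

namespace IsCanonical

variable (hcov : C.IsCanonical cov) {X Y A B ζ : Π x : M, Tan n x} {U : Set M} {x : M}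
include hcov

lemma cov_mem_H (hX : SmoothField U X) (hXH : ∀ y ∈ U, X y ∈ S.H y) (hU : IsOpen U) (hx : x ∈ U)
    (u : Tan n x) : cov X x u ∈ S.H x := by
  have e : ∀ y ∈ U, (C.hor y (X y) : Tan n y) = X y := fun y hy ↦ hor_of_mem (hXH y hy)
  rw [← cov_congr cov hX e hU hx]
  exact hcov.preserves_H U hU _ (hX.congr e) x hx u

lemma cov_mem_V (hX : SmoothField U X) (hXV : ∀ y ∈ U, X y ∈ C.V y) (hU : IsOpen U) (hx : x ∈ U)
    (u : Tan n x) : cov X x u ∈ C.V x := by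
  have e : ∀ y ∈ U, (C.ver y (X y) : Tan n y) = X y := fun y hy ↦ ver_of_mem (hXV y hy)
  rw [← cov_congr cov hX e hU hx]
  exact hcov.preserves_V U hU _ (hX.congr e) x hx u

lemma cov_metric (hX : SmoothField U X) (hXH : ∀ y ∈ U, X y ∈ S.H y) (hY : SmoothField U Y)
    (hYH : ∀ y ∈ U, Y y ∈ S.H y) (hU : IsOpen U) (hx : x ∈ U) (u : Tan n x) :
    dirDeriv n (fun y ↦ S.g y (C.hor y (X y)) (C.hor y (Y y))) x u =
      S.g x (C.hor x (cov X x u)) (C.hor x (Y x)) +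
      S.g x (C.hor x (X x)) (C.hor x (cov Y x u)) := by
  have e : ∀ y ∈ U, (C.hor y (X y) : Tan n y) = X y := fun y hy ↦ hor_of_mem (hXH y hy)
  have e' : ∀ y ∈ U, (C.hor y (Y y) : Tan n y) = Y y := fun y hy ↦ hor_of_mem (hYH y hy)
  rw [hcov.metric U hU _ _ (hX.congr e) (hY.congr e') x hx u, cov_congr cov hX e hU hx,
    cov_congr cov hY e' hU hx]

omit hcov in
lemma smooth_g (hX : SmoothField U X) (hXH : ∀ y ∈ U, X y ∈ S.H y) (hY : SmoothField U Y)
    (hYH : ∀ y ∈ U, Y y ∈ S.H y) (hU : IsOpen U) :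
    SmoothFun n U (fun y ↦ S.g y (C.hor y (X y)) (C.hor y (Y y))) :=
  S.g_smooth U hU _ _ (hX.congr fun y hy ↦ hor_of_mem (hXH y hy))
    (hY.congr fun y hy ↦ hor_of_mem (hYH y hy))

/-- `∇φ = 0` as a product rule. Working with `act` on vertical fields, instead of with derivatives
of the `I_s`, avoids introducing connection forms. -/
lemma cov_act (hξ : C.IsReeb F ξ) (hζ : SmoothField F.U ζ) (hζV : ∀ y ∈ F.U, ζ y ∈ C.V y)
    (hX : SmoothField F.U X) (hXH : ∀ y ∈ F.U, X y ∈ S.H y) (hx : x ∈ F.U) (u : Tan n x) :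
    cov (fun y ↦ C.act F y (ζ y) (X y)) x u =
      C.act F x (cov ζ x u) (X x) + C.act F x (ζ x) (cov X x u) := by
  have e : ∀ y ∈ F.U, (C.hor y (X y) : Tan n y) = X y := fun y hy ↦ hor_of_mem (hXH y hy)
  have e' : ∀ y ∈ F.U, (C.ver y (ζ y) : Tan n y) = ζ y := fun y hy ↦ ver_of_mem (hζV y hy)
  have h := hcov.parallel_phi F (fun y ↦ C.ver y (ζ y)) (hζ.congr e') (fun y ↦ C.hor y (X y))
    (hX.congr e) x hx u
  have hs := smooth_act hξ hζ hX
  have h1 := hcov.cov_mem_H hs (fun y _ ↦ act_mem y _ _) F.isOpen_U hx u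
  rw [cov_congr cov hζ e' F.isOpen_U hx, cov_congr cov hX e F.isOpen_U hx,
    cov_congr cov hs (Y := fun y ↦ ((∑ s, F.η s y (C.ver y (ζ y)) • F.I s y (C.hor y (X y)) :
      S.H y) : Tan n y)) (fun y hy ↦ by rw [act_apply]; simp only [e' y hy]) F.isOpen_U hx,
    eq_sub_iff_add_eq] at h
  rw [← hor_of_mem (C := C) h1, ← h, act_apply, act_apply, Submodule.coe_add]
  simp only [e' x hx]

variable [T2Space M]

lemma curv_mem_H (he : ∀ v : Tan n x, SmoothField U (ext v)) (hX : SmoothField U X)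
    (hXH : ∀ y ∈ U, X y ∈ S.H y) (hU : IsOpen U) (hx : x ∈ U) (u v : Tan n x) :
    curv cov x u v (X x) ∈ S.H x := by
  have h := fieldCurv_eq_curv cov hcov.smooth (he u) (he v) hX hU hx
  rw [ext_self, ext_self] at h
  rw [← h]
  have e : ∀ v : Tan n x, ∀ u, cov (fun y ↦ cov X y (ext v y)) x u ∈ S.H x := fun v u ↦
    hcov.cov_mem_H (smoothField_cov cov hcov.smooth hX (he v) hU)
      (fun y hy ↦ hcov.cov_mem_H hX hXH hU hy _) hU hx u
  exact sub_mem (sub_mem (e _ _) (e _ _)) (hcov.cov_mem_H hX hXH hU hx _)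

/-- Apply the product rule `cov_act` twice: the terms containing one derivative of each factor are
symmetric in `u, v` and cancel. -/
lemma curv_act (hξ : C.IsReeb F ξ) (he : ∀ v : Tan n x, SmoothField F.U (ext v))
    (hζ : SmoothField F.U ζ) (hζV : ∀ y ∈ F.U, ζ y ∈ C.V y)
    (hX : SmoothField F.U X) (hXH : ∀ y ∈ F.U, X y ∈ S.H y) (hx : x ∈ F.U) (u v : Tan n x) :
    curv cov x u v (C.act F x (ζ x) (X x)) =
      C.act F x (curv cov x u v (ζ x)) (X x) + C.act F x (ζ x) (curv cov x u v (X x)) := by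
  have hO := F.isOpen_U
  have h1 := fieldCurv_eq_curv cov hcov.smooth (he u) (he v) (smooth_act hξ hζ hX) hO hx
  have h2 := fieldCurv_eq_curv cov hcov.smooth (he u) (he v) hζ hO hx
  have h3 := fieldCurv_eq_curv cov hcov.smooth (he u) (he v) hX hO hx
  rw [ext_self, ext_self] at h1 h2 h3
  have e : ∀ v u : Tan n x, cov (fun y ↦ cov (fun y ↦ C.act F y (ζ y) (X y)) y (ext v y)) x u =
      C.act F x (cov (fun y ↦ cov ζ y (ext v y)) x u) (X x) +
      C.act F x (cov ζ x (ext v x)) (cov X x u) + (C.act F x (cov ζ x u) (cov X x (ext v x)) +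
      C.act F x (ζ x) (cov (fun y ↦ cov X y (ext v y)) x u)) := fun v u ↦ by
    have s1 := smoothField_cov cov hcov.smooth hζ (he v) hO
    have s2 := smoothField_cov cov hcov.smooth hX (he v) hO
    have m1 := fun y hy ↦ hcov.cov_mem_V hζ hζV hO (x := y) hy (ext v y)
    have m2 := fun y hy ↦ hcov.cov_mem_H hX hXH hO (x := y) hy (ext v y)
    rw [cov_congr cov ((smooth_act hξ s1 hX).add (smooth_act hξ hζ s2))
      (fun y hy ↦ hcov.cov_act hξ hζ hζV hX hXH hy (ext v y)) hO hx,
      cov_add cov (smooth_act hξ s1 hX) (smooth_act hξ hζ s2) hO hx,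
      hcov.cov_act hξ s1 m1 hX hXH hx, hcov.cov_act hξ hζ hζV s2 m2 hx]
  rw [← h1, ← h2, ← h3]
  simp only [fieldCurv, ext_self] at e ⊢
  rw [e, e, hcov.cov_act hξ hζ hζV hX hXH hx]
  simp only [map_sub, LinearMap.sub_apply]
  abel

/-- Differentiate `g(X, Y)` twice and antisymmetrise; `dirDeriv_bracket` removes the derivatives of
the function, and the mixed terms cancel. -/
lemma curv_skew (he : ∀ v : Tan n x, SmoothField U (ext v)) (hX : SmoothField U X)
    (hXH : ∀ y ∈ U, X y ∈ S.H y) (hY : SmoothField U Y) (hYH : ∀ y ∈ U, Y y ∈ S.H y)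
    (hU : IsOpen U) (hx : x ∈ U) (u v : Tan n x) :
    S.g x (C.hor x (curv cov x u v (X x))) (C.hor x (Y x)) =
      - S.g x (C.hor x (X x)) (C.hor x (curv cov x u v (Y x))) := by
  have h2 := fieldCurv_eq_curv cov hcov.smooth (he u) (he v) hX hU hx
  have h3 := fieldCurv_eq_curv cov hcov.smooth (he u) (he v) hY hU hx
  rw [ext_self, ext_self] at h2 h3
  rw [← h2, ← h3]
  have hb := dirDeriv_bracket (he u) (he v) (smooth_g (C := C) hX hXH hY hYH hU) hU hx
  have e : ∀ v u : Tan n x, dirDeriv n (fun y ↦ dirDeriv n (fun y ↦ S.g y (C.hor y (X y))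
      (C.hor y (Y y))) y (ext v y)) x u =
      S.g x (C.hor x (cov (fun y ↦ cov X y (ext v y)) x u)) (C.hor x (Y x)) +
      S.g x (C.hor x (cov X x (ext v x))) (C.hor x (cov Y x u)) +
      (S.g x (C.hor x (cov X x u)) (C.hor x (cov Y x (ext v x))) +
      S.g x (C.hor x (X x)) (C.hor x (cov (fun y ↦ cov Y y (ext v y)) x u))) := fun v u ↦ by
    have s1 := smoothField_cov cov hcov.smooth hX (he v) hU
    have s2 := smoothField_cov cov hcov.smooth hY (he v) hU
    have m1 := fun y hy ↦ hcov.cov_mem_H hX hXH hU (x := y) hy (ext v y)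
    have m2 := fun y hy ↦ hcov.cov_mem_H hY hYH hU (x := y) hy (ext v y)
    rw [dirDeriv_congr (fun y hy ↦ hcov.cov_metric hX hXH hY hYH hU hy (ext v y)) hU hx,
      dirDeriv_add (smooth_g s1 m1 hY hYH hU) (smooth_g hX hXH s2 m2 hU) hU hx,
      hcov.cov_metric s1 m1 hY hYH hU hx, hcov.cov_metric hX hXH s2 m2 hU hx]
  rw [hcov.cov_metric hX hXH hY hYH hU hx] at hb
  simp only [fieldCurv, ext_self] at e hb ⊢
  rw [e, e] at hb
  simp only [map_sub, LinearMap.sub_apply]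
  linarith

end IsCanonical

end Complement

end CanonicalConnection

section TorsionFormulas

variable {n : ℕ} {M : Type*} [TopologicalSpace M]
  [ChartedSpace (EuclideanSpace ℝ (Fin (4 * n + 3))) M] [IsManifold (𝓡 (4 * n + 3)) ∞ M]

/-! ### The exterior derivative on fields -/

lemma SmoothForm.mdiffAt_apply {U : Set M} {x : M} {η : Π x : M, Tan n x →L[ℝ] ℝ}
    {X : Π x : M, Tan n x} (hη : SmoothForm U η) (hU : IsOpen U) (hx : x ∈ U)
    (hX : MDifferentiableAt (𝓡 (4 * n + 3)) (𝓡 (4 * n + 3)).tangent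
      (fun x ↦ (⟨x, X x⟩ : TangentBundle (𝓡 (4 * n + 3)) M)) x) :
    MDifferentiableAt (𝓡 (4 * n + 3)) 𝓘(ℝ) (fun y ↦ η y (X y)) x := by
  have h1 := ((hη x hx).contMDiffAt (hU.mem_nhds hx)).mdifferentiableAt (by simp)
  have := MDifferentiableAt.clm_bundle_apply (F₁ := EuclideanSpace ℝ (Fin (4 * n + 3))) (F₂ := ℝ)
    (E₁ := fun x : M ↦ Tan n x) (E₂ := Trivial M ℝ) (ϕ := η) (v := X) (b := fun x ↦ x) h1 hX
  rw [mdifferentiableAt_section] at this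
  exact this

/-- The expression is `(∇_u η)(X)`. It serves to show that `extDer` does not depend on the chosen
extensions. -/
lemma tensorialAt_dirDeriv_sub (cov : Conn n M) {U : Set M} {x : M}
    {η : Π x : M, Tan n x →L[ℝ] ℝ} (hη : SmoothForm U η) (hU : IsOpen U) (hx : x ∈ U)
    (u : Tan n x) : TensorialAt (𝓡 (4 * n + 3)) (EuclideanSpace ℝ (Fin (4 * n + 3)))
      (V := fun x : M ↦ Tan n x)
      (fun X ↦ dirDeriv n (fun y ↦ η y (X y)) x u - η x (cov X x u)) x where
  smul := by
    intro f X hf hX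
    have h1 := congr($(cov.isCovariantDerivativeOn.leibniz hX hf) u)
    have h2 := congr($(mvfderiv_mul hf (hη.mdiffAt_apply hU hx hX)) u)
    have h3 : (fun y ↦ η y ((f • X) y)) = f * fun y ↦ η y (X y) := by
      ext y
      simp
    rw [h3]
    simp only [dirDeriv] at h1 h2 ⊢
    erw [h1, h2]
    simp
    ring
  add := by
    intro X X' hX hX'
    have h1 := congr($(cov.isCovariantDerivativeOn.add hX hX') u)
    have h2 := congr($(mvfderiv_add (hη.mdiffAt_apply hU hx hX) (hη.mdiffAt_apply hU hx hX')) u)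
    have h3 : (fun y ↦ η y ((X + X') y)) = (fun y ↦ η y (X y)) + fun y ↦ η y (X' y) := by
      ext y
      simp
    rw [h3]
    simp only [dirDeriv] at h1 h2 ⊢
    erw [h1, h2]
    simp
    ring

/-- For any connection `dη(X, Y) = (∇_X η)(Y) - (∇_Y η)(X) + η(T(X, Y))`, where every term is
tensorial, so the fields may replace the extensions used in the definition. -/
lemma extDer_eq (cov : Conn n M) {U : Set M} {x : M} {η : Π x : M, Tan n x →L[ℝ] ℝ}
    {X Y : Π x : M, Tan n x} (hη : SmoothForm U η) (hX : SmoothField U X) (hY : SmoothField U Y)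
    (hU : IsOpen U) (hx : x ∈ U) : extDer η x (X x) (Y x) =
      dirDeriv n (fun y ↦ η y (Y y)) x (X x) - dirDeriv n (fun y ↦ η y (X y)) x (Y x) -
        η x (bracket X Y x) := by
  obtain ⟨W, hW, hxW, he⟩ := exists_smooth_ext (n := n) x
  have key : ∀ {X : Π x : M, Tan n x}, SmoothField U X → ∀ u,
    dirDeriv n (fun y ↦ η y (ext (X x) y)) x u - η x (cov (ext (X x)) x u) =
      dirDeriv n (fun y ↦ η y (X y)) x u - η x (cov X x u) := fun hX u ↦
    (tensorialAt_dirDeriv_sub cov hη hU hx u).pointwise ((he _).mdiffAt hW hxW) (hX.mdiffAt hU hx)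
      (ext_self _)
  have t1 := torsion_eq cov hX hY hU hx
  have t2 := torsion_eq cov (he (X x)) (he (Y x)) hW hxW
  rw [ext_self, ext_self, t1] at t2
  have t3 := congrArg (η x) t2
  simp only [map_sub] at t3
  have k1 := key hX (Y x)
  have k2 := key hY (X x)
  rw [extDer]
  linarith

/-! ### The torsion of the canonical connection -/

lemma IsPara.anticomm {W : Type*} [AddCommGroup W] [Module ℝ W] [FiniteDimensional ℝ W]
    {g : LinearMap.BilinForm ℝ W} {I : Fin 3 → Module.End ℝ W} (h : IsPara g I) (r s : Fin 3)
    (X : W) : I r (I s X) + I s (I r X) = if r = s then (2 * eps s) • X else 0 := by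
  rcases fin3_eq r s with rfl | rfl | rfl
  · rw [h.sq, if_pos rfl]
    module
  · rw [h.mul₀₁, h.mul₁₀, if_neg (fin3_ne r).1]
    module
  · rw [h.mul₀₂, h.mul₂₀, if_neg (fin3_ne r).2.1]
    module

variable {S : Structure n M}

namespace Complement

variable {C : Complement S} {F : S.Frame} {ξ : Fin 3 → Π x : M, Tan n x} {cov : Conn n M}

lemma IsReeb.restrict (hξ : C.IsReeb F ξ) {W : Set M} (hW : IsOpen W) :
    C.IsReeb (F.restrict W hW) ξ := fun y hy ↦ hξ y hy.1

namespace IsCanonical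

variable (hcov : C.IsCanonical cov) (hξ : C.IsReeb F ξ) {X Y : Π x : M, Tan n x} {x : M}
include hcov hξ

/-- For horizontal fields `-η_s([X, Y]) = dη_s(X, Y)`, and the contact condition evaluates the right
side. -/
lemma torsion_hor_eq (hx : x ∈ F.U) (X Y : S.H x) : cov.torsion x (X : Tan n x) (Y : Tan n x) =
    ∑ s, (-2 * eps s * S.g x (F.I s x X) Y) • ξ s x := by
  obtain ⟨W, hW, hxW, he⟩ := exists_smooth_ext (n := n) x
  set F' := F.restrict W hW
  have hξ' : C.IsReeb F' ξ := hξ.restrict hW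
  have hx' : x ∈ F'.U := ⟨hx, hxW⟩
  have hs : ∀ X : S.H x, SmoothField F'.U (fun y ↦ (C.hor y (ext (X : Tan n x) y) : Tan n y)) :=
    fun X ↦ smooth_hor hξ' ((he X).mono Set.inter_subset_right)
  have h0 : ∀ X : S.H x, (C.hor x (ext (X : Tan n x) x)) = X := fun X ↦ by
    rw [ext_self, hor_coe]
  have h1 := hcov.torsion_hor F'.U F'.isOpen_U _ _ (hs X) (hs Y) x hx'
  rw [h0, h0] at h1
  rw [← sum_η_of_mem_V hξ hx (A := cov.torsion x (X : Tan n x) (Y : Tan n x))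
    (by rw [h1]; exact neg_mem (C.ver x _).2)]
  refine Finset.sum_congr rfl fun s _ ↦ ?_
  congr 1
  have h2 := extDer_eq cov (F'.smooth_η s) (hs X) (hs Y) F'.isOpen_U hx'
  have h3 : ∀ (X : S.H x) (u : Tan n x), dirDeriv n (fun y ↦ F'.η s y
      (C.hor y (ext (X : Tan n x) y))) x u = 0 := fun X u ↦ by
    rw [dirDeriv_congr (fun y hy ↦ η_of_mem hy (C.hor y _).2 s) F'.isOpen_U hx', dirDeriv_const]
  rw [h3, h3, h0, h0, ← F'.contact x hx'] at h2
  rw [h1, map_neg, η_ver hξ hx]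
  rw [sub_zero, zero_sub] at h2
  exact h2.symm

lemma η_torsion_hor (hx : x ∈ F.U) (X Y : S.H x) (s : Fin 3) :
    F.η s x (cov.torsion x (X : Tan n x) (Y : Tan n x)) =
      -2 * eps s * S.g x (F.I s x X) Y := by
  rw [hcov.torsion_hor_eq hξ hx, η_sum_ξ hξ hx]

lemma cov_ξ_mem (hx : x ∈ F.U) (s : Fin 3) (u : Tan n x) : cov (ξ s) x u ∈ C.V x :=
  hcov.cov_mem_V (smooth_ξ hξ s) (fun _ hy ↦ ξ_mem hξ hy s) F.isOpen_U hx u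

lemma cov_ξ (hx : x ∈ F.U) (s : Fin 3) (u : Tan n x) :
    cov (ξ s) x u = ∑ r, F.η r x (cov (ξ s) x u) • ξ r x :=
  (sum_η_of_mem_V hξ hx (hcov.cov_ξ_mem hξ hx s u)).symm

set_option maxHeartbeats 400000 in
-- Differentiating `I_r I_s + I_s I_r = 2 ε_s δ_{rs}` along `u` and applying the result to a nonzero
-- horizontal vector gives the relation. It says that the metric of the extended type on `V` is
-- parallel.
lemma cov_ξ_skew [Nontrivial (S.H x)] (hx : x ∈ F.U) (r s : Fin 3) (u : Tan n x) :
    eps r * F.η r x (cov (ξ s) x u) + eps s * F.η s x (cov (ξ r) x u) = 0 := by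
  obtain ⟨W, hW, hxW, he⟩ := exists_smooth_ext (n := n) x
  set F' := F.restrict W hW
  have hξ' : C.IsReeb F' ξ := hξ.restrict hW
  have hx' : x ∈ F'.U := ⟨hx, hxW⟩
  have hO := F'.isOpen_U
  obtain ⟨X, hX⟩ := exists_ne (0 : S.H x)
  set Z : Π y : M, Tan n y := fun y ↦ (C.hor y (ext (X : Tan n x) y) : Tan n y)
  have hZx : Z x = X := by simp only [Z]; rw [ext_self, hor_coe]
  have hZ : SmoothField F'.U Z := smooth_hor hξ' ((he X).mono Set.inter_subset_right)
  have hZH : ∀ y ∈ F'.U, Z y ∈ S.H y := fun y _ ↦ (C.hor y _).2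
  have hs := smooth_ξ hξ'
  have hV : ∀ s, ∀ y ∈ F'.U, ξ s y ∈ C.V y := fun s y hy ↦ ξ_mem hξ' hy s
  have e1 : ∀ r s, cov (fun y ↦ C.act F' y (ξ r y) (C.act F' y (ξ s y) (Z y))) x u =
      C.act F' x (cov (ξ r) x u) (C.act F' x (ξ s x) (Z x)) +
      C.act F' x (ξ r x) (C.act F' x (cov (ξ s) x u) (Z x)) +
      C.act F' x (ξ r x) (C.act F' x (ξ s x) (cov Z x u)) := fun r s ↦ by
    rw [hcov.cov_act hξ' (hs r) (hV r) (smooth_act hξ' (hs s) hZ) (fun y _ ↦ act_mem y _ _) hx',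
      hcov.cov_act hξ' (hs s) (hV s) hZ hZH hx', map_add, add_assoc]
  have e2 : ∀ y ∈ F'.U, ∀ A ∈ S.H y, C.act F' y (ξ r y) (C.act F' y (ξ s y) A) +
      C.act F' y (ξ s y) (C.act F' y (ξ r y) A) = (if r = s then 2 * eps s else 0) • A := by
    intro y hy A hA
    have := congrArg Subtype.val ((isPara F' hy).anticomm r s ⟨A, hA⟩)
    rw [act_ξ hξ' hy s ⟨A, hA⟩, act_ξ hξ' hy r ⟨A, hA⟩, act_ξ hξ' hy, act_ξ hξ' hy]
    refine this.trans ?_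
    split_ifs <;> simp
  have sm := fun r s ↦ smooth_act hξ' (hs r) (smooth_act hξ' (hs s) hZ)
  have e3 := cov_congr cov (SmoothField.smul (smoothFun_const (if r = s then 2 * eps s else 0)) hZ)
    (fun y hy ↦ e2 y hy (Z y) (hZH y hy)) hO hx' u
  have hH := hcov.cov_mem_H hZ hZH hO hx' u
  rw [cov_add cov (sm r s) (sm s r) hO hx', e1, e1, cov_smul cov (smoothFun_const _) hZ hO hx',
    dirDeriv_const, zero_smul, add_zero, ← e2 x hx' _ hH, hZx, act_ξ hξ' hx', act_ξ hξ' hx'] at e3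
  have e4 : ∀ r s, C.act F' x (cov (ξ r) x u) (F'.I s x X) +
      C.act F' x (ξ s x) (C.act F' x (cov (ξ r) x u) X) =
      ((2 * eps s * F.η s x (cov (ξ r) x u)) • X : S.H x) := fun r s ↦ by
    conv_lhs => rw [hcov.cov_ξ hξ hx r u]
    simp only [map_sum, map_smul, LinearMap.sum_apply, LinearMap.smul_apply, act_ξ hξ' hx']
    rw [← Finset.sum_add_distrib, Finset.sum_eq_single s]
    · rw [← smul_add, ← Submodule.coe_add, (isPara F' hx').anticomm, if_pos rfl, ← Submodule.coe_smul,
        smul_smul, mul_comm (F.η s x _)]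
    · intro t _ hts
      rw [← smul_add, ← Submodule.coe_add, (isPara F' hx').anticomm, if_neg hts]
      simp
    · simp
  have e5 : ((2 * eps s * F.η s x (cov (ξ r) x u)) • X : S.H x) +
      ((2 * eps r * F.η r x (cov (ξ s) x u)) • X : S.H x) = (0 : Tan n x) := by
    rw [← e4, ← e4, ← sub_eq_zero.2 e3]
    abel
  rw [← Submodule.coe_add, ← add_smul, Submodule.coe_eq_zero] at e5
  have := (smul_eq_zero.1 e5).resolve_right hX
  linarith

/-- On `H` the torsion is `-2 ∑ ε_s ω_s ⊗ ξ_s`. The connection coefficients of the `ξ_s` rotate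
`ω_s` and `ξ_s` simultaneously, and by `cov_ξ_skew` the two effects cancel. -/
lemma covTorsion_hor [Nontrivial (S.H x)] (hX : SmoothField F.U X) (hXH : ∀ y ∈ F.U, X y ∈ S.H y)
    (hY : SmoothField F.U Y) (hYH : ∀ y ∈ F.U, Y y ∈ S.H y) (hx : x ∈ F.U) (u : Tan n x) :
    covTorsion cov X Y x u = 0 := by
  have hO := F.isOpen_U
  have hs := smooth_ξ hξ
  have hV : ∀ s, ∀ y ∈ F.U, ξ s y ∈ C.V y := fun s y hy ↦ ξ_mem hξ hy s
  have tor : ∀ y ∈ F.U, ∀ A ∈ S.H y, ∀ B ∈ S.H y, cov.torsion y A B = ∑ s, (-2 * eps s *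
      S.g y (C.hor y (C.act F y (ξ s y) A)) (C.hor y B)) • ξ s y := fun y hy A hA B hB ↦ by
    rw [hcov.torsion_hor_eq hξ hy ⟨A, hA⟩ ⟨B, hB⟩]
    refine Finset.sum_congr rfl fun s _ ↦ ?_
    rw [act_ξ hξ hy s ⟨A, hA⟩, hor_coe, hor_coe ⟨B, hB⟩]
  have hXu := hcov.cov_mem_H hX hXH hO hx u
  have hYu := hcov.cov_mem_H hY hYH hO hx u
  have sg : ∀ s, SmoothFun n F.U (fun y ↦ S.g y (C.hor y (C.act F y (ξ s y) (X y)))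
      (C.hor y (Y y))) := fun s ↦
    smooth_g (smooth_act hξ (hs s) hX) (fun y _ ↦ act_mem y _ _) hY hYH hO
  have sg' : ∀ s, SmoothFun n F.U (fun y ↦ -2 * eps s * S.g y (C.hor y (C.act F y (ξ s y) (X y)))
      (C.hor y (Y y))) := fun s ↦ (smoothFun_const _).mul (sg s)
  rw [covTorsion, cov_congr cov (SmoothField.sum (s := Finset.univ) fun s _ ↦ (hs s).smul (sg' s))
    (fun y hy ↦ tor y hy _ (hXH y hy) _ (hYH y hy)) hO hx,
    cov_sum cov (fun s _ ↦ (hs s).smul (sg' s)) hO hx, tor x hx _ hXu _ (hYH x hx),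
    tor x hx _ (hXH x hx) _ hYu, ← Finset.sum_sub_distrib, ← Finset.sum_sub_distrib]
  have e : ∀ s, cov (fun y ↦ (-2 * eps s * S.g y (C.hor y (C.act F y (ξ s y) (X y)))
      (C.hor y (Y y))) • ξ s y) x u -
      (-2 * eps s * S.g x (C.hor x (C.act F x (ξ s x) (cov X x u))) (C.hor x (Y x))) • ξ s x -
      (-2 * eps s * S.g x (C.hor x (C.act F x (ξ s x) (X x))) (C.hor x (cov Y x u))) • ξ s x =
      ∑ r, ((-2 * eps s * (F.η r x (cov (ξ s) x u) *
        S.g x (C.hor x (C.act F x (ξ r x) (X x))) (C.hor x (Y x)))) • ξ s x +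
        (-2 * eps s * (F.η r x (cov (ξ s) x u) *
        S.g x (C.hor x (C.act F x (ξ s x) (X x))) (C.hor x (Y x)))) • ξ r x) := fun s ↦ by
    rw [cov_smul cov (sg' s) (hs s) hO hx, dirDeriv_mul (smoothFun_const _) (sg s) hO hx,
      dirDeriv_const, hcov.cov_metric (smooth_act hξ (hs s) hX) (fun y _ ↦ act_mem y _ _) hY hYH
      hO hx, hcov.cov_act hξ (hs s) (hV s) hX hXH hx]
    have h1 : (-2 * eps s * S.g x (C.hor x (C.act F x (ξ s x) (X x))) (C.hor x (Y x))) •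
        cov (ξ s) x u = ∑ r, (-2 * eps s * (F.η r x (cov (ξ s) x u) *
        S.g x (C.hor x (C.act F x (ξ s x) (X x))) (C.hor x (Y x)))) • ξ r x := by
      conv_lhs => rw [hcov.cov_ξ hξ hx s u]
      rw [Finset.smul_sum]
      exact Finset.sum_congr rfl fun r _ ↦ by rw [smul_smul]; congr 1; ring
    have h2 : S.g x (C.hor x (C.act F x (cov (ξ s) x u) (X x))) (C.hor x (Y x)) =
        ∑ r, F.η r x (cov (ξ s) x u) *
          S.g x (C.hor x (C.act F x (ξ r x) (X x))) (C.hor x (Y x)) := by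
      conv_lhs => rw [hcov.cov_ξ hξ hx s u]
      simp only [map_sum, map_smul, LinearMap.sum_apply, LinearMap.smul_apply, smul_eq_mul]
    rw [Finset.sum_add_distrib, ← h1, ← Finset.sum_smul, ← Finset.mul_sum, ← h2]
    simp only [map_add, LinearMap.add_apply]
    module
  -- After the summation indices of one half are exchanged, both halves multiply the same `ξ s` and
  -- cancel for each pair `r, s`.
  simp only [e, Finset.sum_add_distrib]
  rw [Finset.sum_comm (f := fun s r ↦ (-2 * eps s * (F.η r x (cov (ξ s) x u) *
        S.g x (C.hor x (C.act F x (ξ s x) (X x))) (C.hor x (Y x)))) • ξ r x),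
    ← Finset.sum_add_distrib]
  refine Finset.sum_eq_zero fun s _ ↦ ?_
  rw [← Finset.sum_add_distrib]
  refine Finset.sum_eq_zero fun r _ ↦ ?_
  rw [← add_smul]
  convert zero_smul ℝ _
  linear_combination (2 * S.g x (C.hor x (C.act F x (ξ r x) (X x))) (C.hor x (Y x))) *
    (eps s * F.η r x (cov (ξ s) x u) * eps_sq r + eps r * F.η s x (cov (ξ r) x u) * eps_sq s -
      eps r * eps s * hcov.cov_ξ_skew hξ hx r s u)

end IsCanonical

end Complement

end TorsionFormulas

section HorizontalCurvature

variable {n : ℕ} {M : Type*} [TopologicalSpace M] [T2Space M]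
  [ChartedSpace (EuclideanSpace ℝ (Fin (4 * n + 3))) M] [IsManifold (𝓡 (4 * n + 3)) ∞ M]
  {S : Structure n M}

/-! ### The horizontal curvature -/

namespace Complement

variable {C : Complement S} {F : S.Frame} {ξ : Fin 3 → Π x : M, Tan n x} {cov : Conn n M} {x : M}

variable (C) in
/-- The curvature of the connection as an endomorphism of the horizontal space. -/
noncomputable def curvH (hc : cov.ContMDiffCovariantDerivative ∞) (x : M) :
    Tan n x →ₗ[ℝ] Tan n x →ₗ[ℝ] Module.End ℝ (S.H x) :=
  LinearMap.mk₂ ℝ (fun u v ↦ C.hor x ∘ₗ curvLin cov hc x u v ∘ₗ (S.H x).subtype)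
    (fun u u' v ↦ by rw [map_add]; ext; simp) (fun c u v ↦ by rw [map_smul]; ext; simp)
    (fun u v v' ↦ by rw [map_add]; ext; simp) (fun c u v ↦ by rw [map_smul]; ext; simp)

lemma curvH_apply (hc : cov.ContMDiffCovariantDerivative ∞) (u v : Tan n x) (X : S.H x) :
    C.curvH hc x u v X = C.hor x (curv cov x u v X) := rfl

variable (C) in
/-- The horizontal vector field extending a horizontal vector. -/
noncomputable abbrev horExt {x : M} (X : S.H x) : Π y : M, Tan n y :=
  fun y ↦ (C.hor y (ext (X : Tan n x) y) : Tan n y)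

lemma horExt_self (X : S.H x) : C.horExt X x = X := by
  rw [horExt, ext_self, hor_coe]

lemma horExt_mem (X : S.H x) (y : M) : C.horExt X y ∈ S.H y := (C.hor y _).2

lemma smooth_horExt (hξ : C.IsReeb F ξ) (he : ∀ v : Tan n x, SmoothField F.U (ext v))
    (X : S.H x) : SmoothField F.U (C.horExt X) := smooth_hor hξ (he X)

variable (F ξ) in
/-- The normalised scalar curvature `c`, for which `T(ξ_i, ξ_j)_V = ε_k c ξ_k`. -/
noncomputable def normScal (cov : Conn n M) (x : M) : ℝ :=
  eps 2 * F.η 2 x (cov.torsion x (ξ 0 x) (ξ 1 x))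

namespace IsCanonical

variable (hcov : C.IsCanonical cov) (hξ : C.IsReeb F ξ)
  (he : ∀ v : Tan n x, SmoothField F.U (ext v)) (hx : x ∈ F.U)
include hcov hξ

lemma coe_torEnd (hx : x ∈ F.U) (i : Fin 3) (X : S.H x) :
    (C.torEnd cov x (ξ i x) X : Tan n x) = cov.torsion x (ξ i x) X :=
  hor_of_mem (hcov.torsion_mem x _ (ξ_mem hξ hx i) X)

lemma trace_torEnd_I (hx : x ∈ F.U) (i s : Fin 3) :
    LinearMap.trace ℝ (S.H x) (C.torEnd cov x (ξ i x) * F.I s x) = 0 := by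
  have h1 := hcov.torsion_perp x _ (ξ_mem hξ hx i) (F.I s x) (Submodule.mem_sup_right
    (by rw [F.span_I x hx]; exact Submodule.subset_span ⟨s, rfl⟩))
  rw [(isPara F hx).contr_I] at h1
  linarith

lemma trace_torEnd_spn (hx : x ∈ F.U) (i : Fin 3) (B : Module.End ℝ (S.H x))
    (hB : ∀ X Y, S.g x (B X) Y = - S.g x X (B Y))
    (hBI : ∀ s X, B (F.I s x X) = F.I s x (B X)) :
    LinearMap.trace ℝ (S.H x) (C.torEnd cov x (ξ i x) * B) = 0 := by
  have h1 := hcov.torsion_perp x _ (ξ_mem hξ hx i) B (Submodule.mem_sup_left ⟨hB, fun J hJ ↦ by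
    rw [F.span_I x hx] at hJ
    induction hJ using Submodule.span_induction with
    | mem J hJ => obtain ⟨s, rfl⟩ := hJ; exact LinearMap.ext (hBI s)
    | zero => simp
    | add J J' _ _ h h' => rw [mul_add, add_mul, h, h']
    | smul c J _ h => rw [mul_smul_comm, smul_mul_assoc, h]⟩)
  have h := isPara F hx
  rw [LinearMap.trace_mul_comm, ← contr_apply_eq_trace h.symm h.nondeg, ← neg_eq_zero, ← contr_neg,
    ← h1]
  exact contr_congr _ fun e e' ↦ by rw [Module.End.mul_apply, hB, neg_neg]

include he hx

lemma coe_curvH (u v : Tan n x) (X : S.H x) :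
    (C.curvH hcov.smooth x u v X : Tan n x) = curv cov x u v X := by
  have := hcov.curv_mem_H he (smooth_horExt hξ he X) (fun y _ ↦ horExt_mem X y) F.isOpen_U hx u v
  rw [horExt_self] at this
  exact hor_of_mem this

lemma curvH_skew (u v : Tan n x) (X Y : S.H x) :
    S.g x (C.curvH hcov.smooth x u v X) Y = - S.g x X (C.curvH hcov.smooth x u v Y) := by
  have := hcov.curv_skew he (smooth_horExt hξ he X) (fun y _ ↦ horExt_mem X y)
    (smooth_horExt hξ he Y) (fun y _ ↦ horExt_mem Y y) F.isOpen_U hx u v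
  simp only [horExt_self, hor_coe] at this
  exact this

lemma curvH_I (u v : Tan n x) (t : Fin 3) (X : S.H x) :
    C.curvH hcov.smooth x u v (F.I t x X) = F.I t x (C.curvH hcov.smooth x u v X) +
      ∑ s, F.η s x (curv cov x u v (ξ t x)) • F.I s x X := by
  have h := hcov.curv_act hξ he (smooth_ξ hξ t) (fun _ hy ↦ ξ_mem hξ hy t)
    (smooth_horExt hξ he X) (fun y _ ↦ horExt_mem X y) hx u v
  rw [horExt_self, act_ξ hξ hx, act_apply, hor_coe, ← coe_curvH hcov hξ he hx,
    ← coe_curvH hcov hξ he hx, act_ξ hξ hx, ← Submodule.coe_add] at h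
  exact (Subtype.ext h).trans (add_comm _ _)

/-- By `curvH_I` these components are the coefficients of `[R(u,v), I_i]` on `H`, which
`commutator_coeff` computes as traces, that is, as Ricci forms. -/
lemma η_curv_ξ (hn : 1 ≤ n) (u v : Tan n x) (i : Fin 3) :
    F.η i x (curv cov x u v (ξ i x)) = 0 ∧
    F.η (i + 2) x (curv cov x u v (ξ i x)) = 2 * eps i * C.rho F cov (i + 1) x u v ∧
    F.η (i + 1) x (curv cov x u v (ξ i x)) = -(2 * eps i * C.rho F cov (i + 2) x u v) := by
  have hd : (Module.finrank ℝ (S.H x) : ℝ) = 4 * n := by rw [S.finrank_H]; push_cast; rfl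
  have hn' : (n : ℝ) ≠ 0 := by exact_mod_cast (by omega : n ≠ 0)
  obtain ⟨h0, h2, h1⟩ := (isPara F hx).commutator_coeff (by rw [hd]; positivity)
    (B := C.curvH hcov.smooth x u v) (c := fun s i ↦ F.η s x (curv cov x u v (ξ i x)))
    (fun i ↦ by
      ext1 X
      simp only [LinearMap.sub_apply, Module.End.mul_apply, LinearMap.sum_apply,
        LinearMap.smul_apply]
      rw [hcov.curvH_I hξ he hx, add_sub_cancel_left]) i
  rw [hd] at h1 h2
  have hr : ∀ s, C.rho F cov s x u v = 1 / (4 * (n : ℝ)) *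
    contr (S.g x) (fun e e' ↦ S.g x (C.curvH hcov.smooth x u v e) (F.I s x e')) := fun s ↦ rfl
  refine ⟨h0, mul_right_cancel₀ (b := 4 * (n : ℝ)) (by positivity) ?_,
    mul_right_cancel₀ (b := 4 * (n : ℝ)) (by positivity) ?_⟩
  · rw [h2, hr]
    field_simp
  · rw [h1, hr]
    field_simp

omit he hξ in
-- `T(ξ, ·)` preserves `H` and `∇` preserves both summands. Hence these terms disappear from the
-- vertical component of the Bianchi identity.
lemma covTorsion_mixed_mem {ζ Y : Π x : M, Tan n x} (hζ : SmoothField F.U ζ)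
    (hζV : ∀ y ∈ F.U, ζ y ∈ C.V y) (hY : SmoothField F.U Y) (hYH : ∀ y ∈ F.U, Y y ∈ S.H y)
    (u : Tan n x) : covTorsion cov ζ Y x u ∈ S.H x := by
  have hO := F.isOpen_U
  refine sub_mem (sub_mem ?_ ?_) ?_
  · exact hcov.cov_mem_H (smoothField_torsion cov hcov.smooth hζ hY hO)
      (fun y hy ↦ hcov.torsion_mem y _ (hζV y hy) ⟨Y y, hYH y hy⟩) hO hx u
  · exact hcov.torsion_mem x _ (hcov.cov_mem_V hζ hζV hO hx u) ⟨Y x, hYH x hx⟩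
  · exact hcov.torsion_mem x _ (hζV x hx) ⟨_, hcov.cov_mem_H hY hYH hO hx u⟩

omit he hξ hx in
lemma covTorsion_swap {Y Z : Π x : M, Tan n x} (hx : x ∈ F.U) (hY : SmoothField F.U Y)
    (hZ : SmoothField F.U Z) (u : Tan n x) :
    covTorsion cov Y Z x u = - covTorsion cov Z Y x u := by
  rw [covTorsion, covTorsion, cov.torsion_antisymm (cov Y x u), cov.torsion_antisymm (Y x),
    cov_congr cov (smoothField_torsion cov hcov.smooth hZ hY F.isOpen_U).neg
      (fun y _ ↦ cov.torsion_antisymm (Y y) (Z y)) F.isOpen_U hx,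
    cov_neg cov (smoothField_torsion cov hcov.smooth hZ hY F.isOpen_U) F.isOpen_U hx]
  abel

omit he hx in
lemma nontrivial_H (hn : 1 ≤ n) : Nontrivial (S.H x) :=
  Module.nontrivial_of_finrank_pos (R := ℝ) (by rw [S.finrank_H]; omega)

/-- The first Bianchi identity on two horizontal fields and one vertical field. -/
lemma vertical_bianchi (hn : 1 ≤ n) (X Y : S.H x) (i s : Fin 3) :
    F.η s x (curv cov x X Y (ξ i x)) =
      -2 * (∑ r, eps r * F.η s x (cov.torsion x (ξ r x) (ξ i x)) * S.g x (F.I r x X) Y) -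
      2 * eps s * (S.g x (C.torEnd cov x (ξ i x) X) (F.I s x Y) * (-1) +
        S.g x (F.I s x X) (C.torEnd cov x (ξ i x) Y)) := by
  have := hcov.nontrivial_H hξ (x := x) hn
  have hX := smooth_horExt hξ he X
  have hY := smooth_horExt hξ he Y
  have hi := smooth_ξ hξ i
  have hV := fun y hy ↦ ξ_mem hξ (x := y) hy i
  have hXH : ∀ y ∈ F.U, C.horExt X y ∈ S.H y := fun y _ ↦ horExt_mem X y
  have hYH : ∀ y ∈ F.U, C.horExt Y y ∈ S.H y := fun y _ ↦ horExt_mem Y y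
  have b := congrArg (F.η s x) (first_bianchi cov hcov.smooth hX hY hi F.isOpen_U hx)
  rw [hcov.covTorsion_hor hξ hX hXH hY hYH hx, hcov.covTorsion_swap hx hY hi] at b
  simp only [horExt_self, map_add, map_neg, map_zero] at b
  rw [η_of_mem hx (hcov.covTorsion_mixed_mem hx hi hV hX hXH _),
    η_of_mem hx (hcov.covTorsion_mixed_mem hx hi hV hY hYH _),
    ← coe_curvH hcov hξ he hx _ _ X, ← coe_curvH hcov hξ he hx _ _ Y, η_of_mem hx (Subtype.property _),
    η_of_mem hx (Subtype.property _), cov.torsion_antisymm (Y : Tan n x) (ξ i x),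
    ← hcov.coe_torEnd hξ hx, ← hcov.coe_torEnd hξ hx, map_neg, neg_apply, map_neg,
    hcov.η_torsion_hor hξ hx, hcov.η_torsion_hor hξ hx, hcov.torsion_hor_eq hξ hx] at b
  have h := isPara F hx
  rw [h.skew s (C.torEnd cov x (ξ i x) X), h.skew s (C.torEnd cov x (ξ i x) Y), h.symm _ (F.I s x X)] at b
  simp only [map_sum, map_smul, sum_apply, smul_apply, smul_eq_mul, add_zero] at b
  rw [b, Finset.mul_sum]
  have e : ∀ r, -2 * eps r * S.g x (F.I r x X) Y * F.η s x (cov.torsion x (ξ r x) (ξ i x)) =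
      -2 * (eps r * F.η s x (cov.torsion x (ξ r x) (ξ i x)) * S.g x (F.I r x X) Y) := fun r ↦ by ring
  simp only [e]
  ring

/-- The cases `s = i, i + 1, i + 2` of `vertical_bianchi`, with the left side rewritten by
`η_curv_ξ`, are the hypotheses of `exists_ricciForm`. -/
lemma exists_isSplit (hn : 1 ≤ n) : ∃ U N,
    IsSplit (S.g x) (fun s ↦ F.I s x) (fun i ↦ C.torEnd cov x (ξ i x)) U N ∧
    (∀ s (X Y : S.H x), C.rho F cov s x X Y =
      ricciForm (S.g x) (fun s ↦ F.I s x) N U (normScal F ξ cov x) s X Y) ∧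
    ∀ i, F.η i x (cov.torsion x (ξ i x) (ξ (i + 1) x)) = 0 ∧
      F.η (i + 1) x (cov.torsion x (ξ i x) (ξ (i + 1) x)) = 0 ∧
      F.η (i + 2) x (cov.torsion x (ξ i x) (ξ (i + 1) x)) = eps (i + 2) * normScal F ξ cov x := by
  have hd : (Module.finrank ℝ (S.H x) : ℝ) ≠ 0 := by
    rw [S.finrank_H]
    exact_mod_cast (by omega)
  obtain ⟨U, N, hs, hr, ht⟩ := (isPara F hx).exists_ricciForm hd
    (t := fun r i s ↦ F.η s x (cov.torsion x (ξ r x) (ξ i x)))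
    (ρ := fun s X Y ↦ C.rho F cov s x X Y)
    (fun r i s ↦ by rw [cov.torsion_antisymm, map_neg])
    (hcov.trace_torEnd_I hξ hx) (fun i B ↦ hcov.trace_torEnd_spn hξ hx i B)
    (fun i X Y ↦ by
      rw [← hcov.vertical_bianchi hξ he hx hn, (hcov.η_curv_ξ hξ he hx hn X Y i).1])
    (fun i X Y ↦ by
      rw [← hcov.vertical_bianchi hξ he hx hn, (hcov.η_curv_ξ hξ he hx hn X Y i).2.2])
    (fun i X Y ↦ by
      rw [← hcov.vertical_bianchi hξ he hx hn, (hcov.η_curv_ξ hξ he hx hn X Y i).2.1])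
  exact ⟨U, N, hs, hr, ht⟩

omit hξ he hx in
lemma contr_curvH_I (hn : 1 ≤ n) (s : Fin 3) (u v : Tan n x) :
    contr (S.g x) (fun e e' ↦ S.g x (C.curvH hcov.smooth x u v e) (F.I s x e')) =
      Module.finrank ℝ (S.H x) * C.rho F cov s x u v := by
  have hn' : (n : ℝ) ≠ 0 := by exact_mod_cast (by omega : n ≠ 0)
  have e : C.rho F cov s x u v = 1 / (4 * (n : ℝ)) * contr (S.g x)
    (fun e e' ↦ S.g x (C.curvH hcov.smooth x u v e) (F.I s x e')) := rfl
  rw [e, S.finrank_H]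
  push_cast
  field_simp

lemma curvH_bianchi (hn : 1 ≤ n) (X Y Z : S.H x) :
    C.curvH hcov.smooth x X Y Z + C.curvH hcov.smooth x Y Z X + C.curvH hcov.smooth x Z X Y =
      ∑ s, (-2 * eps s) • (S.g x (F.I s x X) Y • C.torEnd cov x (ξ s x) Z +
        S.g x (F.I s x Y) Z • C.torEnd cov x (ξ s x) X +
        S.g x (F.I s x Z) X • C.torEnd cov x (ξ s x) Y) := by
  have := hcov.nontrivial_H hξ (x := x) hn
  have sm := smooth_horExt hξ he
  have mem : ∀ X : S.H x, ∀ y ∈ F.U, C.horExt X y ∈ S.H y := fun X y _ ↦ horExt_mem X y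
  have b := first_bianchi cov hcov.smooth (sm X) (sm Y) (sm Z) F.isOpen_U hx
  rw [hcov.covTorsion_hor hξ (sm X) (mem X) (sm Y) (mem Y) hx,
    hcov.covTorsion_hor hξ (sm Y) (mem Y) (sm Z) (mem Z) hx,
    hcov.covTorsion_hor hξ (sm Z) (mem Z) (sm X) (mem X) hx] at b
  simp only [horExt_self, hcov.torsion_hor_eq hξ hx, map_sum, map_smul, sum_apply, smul_apply,
    ← hcov.coe_torEnd hξ hx] at b
  rw [← coe_curvH hcov hξ he hx X Y Z, ← coe_curvH hcov hξ he hx Y Z X,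
    ← coe_curvH hcov hξ he hx Z X Y] at b
  apply Subtype.ext
  simp only [Submodule.coe_add, AddSubmonoidClass.coe_finsetSum,
    Submodule.coe_smul]
  refine b.trans ?_
  simp only [zero_add, ← Finset.sum_add_distrib]
  refine Finset.sum_congr rfl fun s _ ↦ ?_
  module

lemma isCurv (hn : 1 ≤ n) {U : Module.End ℝ (S.H x)} {N : Fin 3 → Module.End ℝ (S.H x)}
    (hr : ∀ s (X Y : S.H x), C.rho F cov s x X Y =
      ricciForm (S.g x) (fun s ↦ F.I s x) N U (normScal F ξ cov x) s X Y) :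
    IsCurv (S.g x) (fun s ↦ F.I s x) (fun i ↦ C.torEnd cov x (ξ i x)) N U (normScal F ξ cov x)
      ((C.curvH hcov.smooth x).domRestrict₁₂ (S.H x) (S.H x)) where
  alt X Y := by
    ext1 Z
    simp only [LinearMap.domRestrict₁₂_apply, LinearMap.neg_apply, curvH_apply]
    rw [curv_swap, map_neg]
  skew X Y Z V := hcov.curvH_skew hξ he hx X Y Z V
  comm_I X Y i Z := by
    obtain ⟨h0, h2, h1⟩ := hcov.η_curv_ξ hξ he hx hn X Y i
    simp only [LinearMap.domRestrict₁₂_apply]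
    rw [hcov.curvH_I hξ he hx, fin3_sum _ i, h0, h1, h2, hr (i + 1) X Y, hr (i + 2) X Y]
    module
  contr_I X Y s := by
    have e := hcov.contr_curvH_I (F := F) hn s (X : Tan n x) (Y : Tan n x)
    simp only [LinearMap.domRestrict₁₂_apply]
    rw [← hr s X Y]
    exact e
  bianchi X Y Z := hcov.curvH_bianchi hξ he hx hn X Y Z

omit he in
-- `c` is a torsion component on smooth fields. The smoothness of `Scal`, defined through pointwise
-- contractions, is deduced from this.
lemma smooth_normScal : SmoothFun n F.U (normScal F ξ cov) :=
  (smoothFun_const _).mul ((F.smooth_η 2).apply (smoothField_torsion cov hcov.smooth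
    (smooth_ξ hξ 0) (smooth_ξ hξ 1) F.isOpen_U))

end IsCanonical

end Complement

end HorizontalCurvature

section VerticalCurvature

variable {n : ℕ} {M : Type*} [TopologicalSpace M] [T2Space M]
  [ChartedSpace (EuclideanSpace ℝ (Fin (4 * n + 3))) M] [IsManifold (𝓡 (4 * n + 3)) ∞ M]
  {S : Structure n M}

/-! ### Vertical torsion and mixed curvature -/

namespace Complement

variable {C : Complement S} {F : S.Frame} {ξ : Fin 3 → Π x : M, Tan n x} {cov : Conn n M} {x : M}

lemma rho_swap (s : Fin 3) (u v : Tan n x) : C.rho F cov s x u v = - C.rho F cov s x v u := by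
  have e := contr_neg (S.g x) (P := fun e e' ↦ C.curv4 cov x v u e (F.I s x e'))
  rw [rho, rho, ← mul_neg, ← e]
  congr 2
  ext e e'
  rw [curv4, curv4, curv_swap, map_neg, map_neg, LinearMap.neg_apply]

variable (C ξ) in
/-- The horizontal part of `T(ξ_i, ξ_{i+1})`. -/
noncomputable def torH (cov : Conn n M) (i : Fin 3) (x : M) : S.H x :=
  C.hor x (cov.torsion x (ξ i x) (ξ (i + 1) x))

namespace IsCanonical

variable (hcov : C.IsCanonical cov) (hξ : C.IsReeb F ξ) (hn : 1 ≤ n) (hx : x ∈ F.U)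
include hcov hξ hn hx

/-- Splitting of the torsion and algebraic properties of the curvature, without any condition on
the domain of the frame. -/
lemma exists_isSplit_isCurv : ∃ U N,
    IsSplit (S.g x) (fun s ↦ F.I s x) (fun i ↦ C.torEnd cov x (ξ i x)) U N ∧
    (∀ s (X Y : S.H x), C.rho F cov s x X Y =
      ricciForm (S.g x) (fun s ↦ F.I s x) N U (normScal F ξ cov x) s X Y) ∧
    IsCurv (S.g x) (fun s ↦ F.I s x) (fun i ↦ C.torEnd cov x (ξ i x)) N U (normScal F ξ cov x)
      ((C.curvH hcov.smooth x).domRestrict₁₂ (S.H x) (S.H x)) ∧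
    ∀ i, F.η i x (cov.torsion x (ξ i x) (ξ (i + 1) x)) = 0 ∧
      F.η (i + 1) x (cov.torsion x (ξ i x) (ξ (i + 1) x)) = 0 ∧
      F.η (i + 2) x (cov.torsion x (ξ i x) (ξ (i + 1) x)) = eps (i + 2) * normScal F ξ cov x := by
  obtain ⟨W, hW, hxW, he⟩ := exists_smooth_ext (n := n) x
  have he' : ∀ v : Tan n x, SmoothField (F.restrict W hW).U (ext v) := fun v ↦
    (he v).mono Set.inter_subset_right
  obtain ⟨U, N, hs, hr, ht⟩ := hcov.exists_isSplit (hξ.restrict hW) he' ⟨hx, hxW⟩ hn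
  exact ⟨U, N, hs, hr, hcov.isCurv (hξ.restrict hW) he' ⟨hx, hxW⟩ hn hr, ht⟩

lemma η_torsion_ξ (i s : Fin 3) : F.η s x (cov.torsion x (ξ i x) (ξ (i + 1) x)) =
    if s = i + 2 then eps (i + 2) * normScal F ξ cov x else 0 := by
  obtain ⟨U, N, -, -, -, ht⟩ := hcov.exists_isSplit_isCurv hξ hn hx
  obtain ⟨h0, h1, h2⟩ := ht i
  rcases fin3_eq i s with rfl | rfl | rfl
  · rw [h0, if_neg (fin3_ne s).2.1]
  · rw [h1, if_neg (fin3_ne i).2.2]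
  · rw [h2, if_pos rfl]

lemma torsion_ξ (i : Fin 3) : cov.torsion x (ξ i x) (ξ (i + 1) x) =
    (eps (i + 2) * normScal F ξ cov x) • ξ (i + 2) x + (C.torH ξ cov i x : Tan n x) := by
  conv_lhs => rw [← hor_add_sum hξ hx (cov.torsion x (ξ i x) (ξ (i + 1) x))]
  simp only [hcov.η_torsion_ξ hξ hn hx]
  refine (add_comm _ _).trans ?_
  rw [torH]
  congr 1
  rw [Finset.sum_eq_single (i + 2)]
  · rw [if_pos rfl]
  · intro s _ hs
    rw [if_neg hs, zero_smul]
  · simp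

omit hn in
lemma coe_torH (i : Fin 3) : C.torH ξ cov i x = - C.hor x (bracket (ξ i) (ξ (i + 1)) x) := by
  rw [torH, torsion_eq cov (smooth_ξ hξ i) (smooth_ξ hξ (i + 1)) F.isOpen_U hx, map_sub, map_sub,
    hor_of_mem_V (hcov.cov_ξ_mem hξ hx _ _), hor_of_mem_V (hcov.cov_ξ_mem hξ hx _ _)]
  simp

omit hn in
lemma η_cov_ξ_self [Nontrivial (S.H x)] (i : Fin 3) (u : Tan n x) :
    F.η i x (cov (ξ i) x u) = 0 := by
  have := hcov.cov_ξ_skew hξ hx i i u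
  rw [← two_mul] at this
  simpa [eps_ne_zero] using this

omit hn in
lemma cov_ξ_skew' [Nontrivial (S.H x)] (r s : Fin 3) (u : Tan n x) :
    eps s * F.η r x (cov (ξ s) x u) + eps r * F.η s x (cov (ξ r) x u) = 0 := by
  linear_combination eps r * eps s * hcov.cov_ξ_skew hξ hx r s u -
    eps s * F.η r x (cov (ξ s) x u) * eps_sq r - eps r * F.η s x (cov (ξ r) x u) * eps_sq s

set_option maxHeartbeats 400000 in
-- Differentiate `T(ξ_i, ξ_j) = ε_k c ξ_k` plus a horizontal field. The horizontal part stays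
-- horizontal, and the connection coefficients cancel by skewness, so only the derivative of `c`
-- survives.
lemma η_covTorsion_ξ (i s : Fin 3) (u : Tan n x) :
    F.η s x (covTorsion cov (ξ i) (ξ (i + 1)) x u) =
      if s = i + 2 then eps (i + 2) * dirDeriv n (normScal F ξ cov) x u else 0 := by
  have := hcov.nontrivial_H hξ (x := x) hn
  have hO := F.isOpen_U
  have hs := smooth_ξ hξ
  have sc : SmoothFun n F.U (fun y ↦ eps (i + 2) * normScal F ξ cov y) :=
    (smoothFun_const _).mul (hcov.smooth_normScal hξ hx)
  have sT : SmoothField F.U (fun y ↦ (C.torH ξ cov i y : Tan n y)) :=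
    smooth_hor hξ (smoothField_torsion cov hcov.smooth (hs i) (hs (i + 1)) hO)
  have e1 := cov_congr cov (SmoothField.add (.smul sc (hs (i + 2))) sT)
    (fun y hy ↦ hcov.torsion_ξ hξ hn hy i) hO hx u
  have e2 := η_of_mem hx (hcov.cov_mem_H sT (fun y _ ↦ (C.torH ξ cov i y).2) hO hx u) s
  rw [cov_add cov (.smul sc (hs (i + 2))) sT hO hx, cov_smul cov sc (hs (i + 2)) hO hx,
    dirDeriv_mul (smoothFun_const _) (hcov.smooth_normScal hξ hx) hO hx, dirDeriv_const] at e1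
  rw [covTorsion, e1, map_sub, map_sub, map_add, e2, map_add, map_smul, map_smul, η_ξ hξ hx]
  have t0 := hcov.η_torsion_ξ hξ hn hx i s
  have t1 := hcov.η_torsion_ξ hξ hn hx (i + 1) s
  have t2 := hcov.η_torsion_ξ hξ hn hx (i + 2) s
  rw [(fin3_add i).1, (fin3_add i).2.1] at t1
  rw [(fin3_add i).2.2.1, (fin3_add i).2.2.2] at t2
  have e3 : F.η s x (cov.torsion x (cov (ξ i) x u) (ξ (i + 1) x)) =
      - (F.η (i + 2) x (cov (ξ i) x u) * F.η s x (cov.torsion x (ξ (i + 1) x) (ξ (i + 2) x))) := by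
    conv_lhs => rw [hcov.cov_ξ hξ hx i u]
    rw [fin3_sum _ i, hcov.η_cov_ξ_self hξ hx, zero_smul, zero_add, map_add, add_apply, map_smul,
      map_smul, smul_apply, smul_apply, cov.torsion_self, cov.torsion_antisymm (ξ (i + 2) x)]
    simp
  have e4 : F.η s x (cov.torsion x (ξ i x) (cov (ξ (i + 1)) x u)) =
      - (F.η (i + 2) x (cov (ξ (i + 1)) x u) *
        F.η s x (cov.torsion x (ξ (i + 2) x) (ξ i x))) := by
    conv_lhs => rw [hcov.cov_ξ hξ hx (i + 1) u]
    rw [fin3_sum _ i, hcov.η_cov_ξ_self hξ hx, zero_smul, add_zero, map_add, map_smul,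
      map_smul, cov.torsion_self, cov.torsion_antisymm (ξ i x)]
    simp
  rw [e3, e4, t1, t2]
  have k0 := hcov.cov_ξ_skew' hξ hx i (i + 2) u
  have k1 := hcov.cov_ξ_skew' hξ hx (i + 1) (i + 2) u
  have k2 := hcov.η_cov_ξ_self hξ hx (i + 2) u
  have n1 := fin3_ne i
  rcases fin3_eq i s with rfl | rfl | rfl
  · simp only [if_neg n1.1, if_neg n1.2.1, if_true, smul_eq_mul]
    linear_combination normScal F ξ cov x * k0
  · simp only [if_neg n1.1.symm, if_neg n1.2.2, if_true, smul_eq_mul]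
    linear_combination normScal F ξ cov x * k1
  · simp only [if_neg n1.2.1.symm, if_neg n1.2.2.symm, if_true, smul_eq_mul, k2]
    ring

omit hn hξ hx in
lemma torsion_ver_hor_mem (A : Tan n x) (hA : A ∈ C.V x) {Z : Tan n x} (hZ : Z ∈ S.H x) :
    cov.torsion x A Z ∈ S.H x := hcov.torsion_mem x A hA ⟨Z, hZ⟩

omit hn hξ hx in
lemma torsion_hor_ver_mem (A : Tan n x) (hA : A ∈ C.V x) {Z : Tan n x} (hZ : Z ∈ S.H x) :
    cov.torsion x Z A ∈ S.H x := by
  rw [cov.torsion_antisymm]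
  exact neg_mem (hcov.torsion_mem x A hA ⟨Z, hZ⟩)

/-- The first Bianchi identity on one horizontal field and two vertical fields. -/
lemma mixed_bianchi (X : S.H x) (i s : Fin 3) :
    F.η s x (curv cov x (ξ (i + 1) x) X (ξ i x)) + F.η s x (curv cov x X (ξ i x) (ξ (i + 1) x)) =
      (if s = i + 2 then eps (i + 2) * dirDeriv n (normScal F ξ cov) x X else 0) -
        2 * eps s * S.g x (F.I s x (C.torH ξ cov i x)) X := by
  obtain ⟨W, hW, hxW, he⟩ := exists_smooth_ext (n := n) x
  set F' := F.restrict W hW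
  have he' : ∀ v : Tan n x, SmoothField F'.U (ext v) := fun v ↦
    (he v).mono Set.inter_subset_right
  have hξ' : C.IsReeb F' ξ := hξ.restrict hW
  have hx' : x ∈ F'.U := ⟨hx, hxW⟩
  have hO := F'.isOpen_U
  have hX := smooth_horExt hξ' he' X
  have hXH : ∀ y ∈ F'.U, C.horExt X y ∈ S.H y := fun y _ ↦ horExt_mem X y
  have hs := smooth_ξ hξ'
  have hV := fun i y hy ↦ ξ_mem hξ' (x := y) hy i
  have b := congrArg (F'.η s x) (first_bianchi cov hcov.smooth (hs i) (hs (i + 1)) hX hO hx')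
  rw [hcov.covTorsion_swap hx' hX (hs i)] at b
  simp only [horExt_self, map_add, map_neg] at b
  rw [η_of_mem hx' (hcov.covTorsion_mixed_mem hx' (hs i) (hV i) hX hXH _),
    η_of_mem hx' (hcov.covTorsion_mixed_mem hx' (hs (i + 1)) (hV (i + 1)) hX hXH _),
    hcov.η_covTorsion_ξ hξ' hn hx', ← coe_curvH hcov hξ' he' hx' _ _ X,
    η_of_mem hx' (Subtype.property _),
    η_of_mem hx' (hcov.torsion_hor_ver_mem _ (hV i x hx')
      (hcov.torsion_ver_hor_mem _ (hV (i + 1) x hx') X.2)),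
    η_of_mem hx' (hcov.torsion_hor_ver_mem _ (hV (i + 1) x hx')
      (hcov.torsion_hor_ver_mem _ (hV i x hx') X.2)),
    hcov.torsion_ξ hξ' hn hx', map_add, map_smul, add_apply, map_add, smul_apply, map_smul,
    η_of_mem hx' (hcov.torsion_ver_hor_mem _ (hV (i + 2) x hx') X.2),
    hcov.η_torsion_hor hξ' hx'] at b
  simp only [neg_zero, zero_add, add_zero, smul_zero] at b
  refine b.trans ?_
  rw [sub_eq_add_neg]
  congr 1
  change -2 * eps s * S.g x (F.I s x (C.torH ξ cov i x)) X = _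
  ring

/-- The first Bianchi identity on three vertical fields. -/
lemma reeb_bianchi (i s : Fin 3) :
    F.η s x (curv cov x (ξ i x) (ξ (i + 1) x) (ξ (i + 2) x)) +
      F.η s x (curv cov x (ξ (i + 1) x) (ξ (i + 2) x) (ξ i x)) +
      F.η s x (curv cov x (ξ (i + 2) x) (ξ i x) (ξ (i + 1) x)) =
      eps s * dirDeriv n (normScal F ξ cov) x (ξ s x) := by
  have hs := smooth_ξ hξ
  have hV := fun i y hy ↦ ξ_mem hξ (x := y) hy i
  have b := congrArg (F.η s x) (first_bianchi cov hcov.smooth (hs i) (hs (i + 1)) (hs (i + 2))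
    F.isOpen_U hx)
  have t0 := hcov.torsion_ξ hξ hn hx i
  have t1 := hcov.torsion_ξ hξ hn hx (i + 1)
  have t2 := hcov.torsion_ξ hξ hn hx (i + 2)
  have c0 := hcov.η_covTorsion_ξ hξ hn hx i s
  have c1 := hcov.η_covTorsion_ξ hξ hn hx (i + 1) s
  have c2 := hcov.η_covTorsion_ξ hξ hn hx (i + 2) s
  rw [(fin3_add i).1, (fin3_add i).2.1] at t1
  rw [(fin3_add i).2.2.1, (fin3_add i).2.2.2] at t2
  simp only [(fin3_add i).1, (fin3_add i).2.1] at c1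
  simp only [(fin3_add i).2.2.1, (fin3_add i).2.2.2] at c2
  simp only [map_add, t0, t1, t2, c0, c1, c2, add_apply, map_smul, smul_apply, cov.torsion_self,
    smul_zero, zero_add] at b
  rw [η_of_mem hx (hcov.torsion_hor_ver_mem _ (hV _ x hx) (Subtype.property _)),
    η_of_mem hx (hcov.torsion_hor_ver_mem _ (hV _ x hx) (Subtype.property _)),
    η_of_mem hx (hcov.torsion_hor_ver_mem _ (hV _ x hx) (Subtype.property _))] at b
  refine b.trans ?_
  have n1 := fin3_ne i
  rcases fin3_eq i s with rfl | rfl | rfl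
  · simp [n1.1, n1.2.1]
  · simp [n1.1.symm, n1.2.2]
  · simp [n1.2.1.symm, n1.2.2.symm]

lemma η_curv_ξ' (u v : Tan n x) (i : Fin 3) :
    F.η i x (curv cov x u v (ξ i x)) = 0 ∧
    F.η (i + 2) x (curv cov x u v (ξ i x)) = 2 * eps i * C.rho F cov (i + 1) x u v ∧
    F.η (i + 1) x (curv cov x u v (ξ i x)) = -(2 * eps i * C.rho F cov (i + 2) x u v) := by
  obtain ⟨W, hW, hxW, he⟩ := exists_smooth_ext (n := n) x
  have he' : ∀ v : Tan n x, SmoothField (F.restrict W hW).U (ext v) := fun v ↦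
    (he v).mono Set.inter_subset_right
  exact hcov.η_curv_ξ (hξ.restrict hW) he' ⟨hx, hxW⟩ hn u v i

/-- The components `s = i + 1`, `s = i` and `s = i + 2` of `mixed_bianchi`, in this order, with
curvature rewritten by `η_curv_ξ'`. In the first two, one curvature term vanishes. -/
lemma rho_mixed (X : S.H x) (i : Fin 3) :
    C.rho F cov (i + 2) x X (ξ i x) = eps (i + 2) * S.g x (F.I i x (C.torH ξ cov i x)) X ∧
    C.rho F cov (i + 2) x (ξ (i + 1) x) X =
      -(eps (i + 2) * S.g x (F.I (i + 1) x (C.torH ξ cov i x)) X) ∧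
    2 * eps i * C.rho F cov (i + 1) x (ξ (i + 1) x) X -
      2 * eps (i + 1) * C.rho F cov i x X (ξ i x) =
      eps (i + 2) * dirDeriv n (normScal F ξ cov) x X -
        2 * eps (i + 2) * S.g x (F.I (i + 2) x (C.torH ξ cov i x)) X := by
  have b0 := hcov.mixed_bianchi hξ hn hx X i i
  have b1 := hcov.mixed_bianchi hξ hn hx X i (i + 1)
  have b2 := hcov.mixed_bianchi hξ hn hx X i (i + 2)
  obtain ⟨p0, p2, p1⟩ := hcov.η_curv_ξ' hξ hn hx (ξ (i + 1) x) X i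
  obtain ⟨q0, q2, q1⟩ := hcov.η_curv_ξ' hξ hn hx X (ξ i x) (i + 1)
  rw [(fin3_add i).1] at q1
  rw [(fin3_add i).1, (fin3_add i).2.1] at q2
  rw [(fin3_add i).2.1] at q1
  have n1 := fin3_ne i
  rw [p0, q2, if_neg n1.2.1] at b0
  rw [p1, q0, if_neg n1.2.2] at b1
  rw [p2, q1, if_pos rfl] at b2
  refine ⟨?_, ?_, by linarith⟩ <;>
  rcases eps_cases i with ⟨h1, h2, h3⟩ | ⟨h1, h2, h3⟩ | ⟨h1, h2, h3⟩ <;>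
  simp only [h1, h2, h3] at b0 b1 ⊢ <;> linarith

end IsCanonical

end Complement

end VerticalCurvature

/-! ### A trace needed for `λ`. -/

section LinearAlgebra

variable {W : Type*} [AddCommGroup W] [Module ℝ W] [FiniteDimensional ℝ W]
  {g : LinearMap.BilinForm ℝ W} {I : Fin 3 → Module.End ℝ W}

/-- Here the endomorphism is `L_{ξ_i} I_{i+2}` in the form of `lieDer_eq`. The `T` terms contribute
only the trace of `T` against `[I_{i+1}, I_{i+2}]`, a multiple of `I_i`, and this trace is zero. -/
lemma IsPara.contr_bracket_I [Nontrivial W] (h : IsPara g I) (T : Module.End ℝ W) (a : Fin 3 → ℝ)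
    (i : Fin 3) (ht : LinearMap.trace ℝ W (T * I i) = 0) :
    contr g (fun e e' ↦ g ((∑ s, a s • I s - T * I (i + 2) + I (i + 2) * T) e) (I (i + 1) e')) =
      -(a (i + 1) * (eps (i + 1) * Module.finrank ℝ W)) := by
  have m1 : I (i + 2) * I (i + 1) = eps i • I i := LinearMap.ext fun X ↦ h.mul₂₁ i X
  have m2 : I (i + 1) * I (i + 2) = -(eps i • I i) := LinearMap.ext fun X ↦ h.mul₁₂ i X
  have hB : (∑ s, a s • I s - T * I (i + 2) + I (i + 2) * T) * I (i + 1) =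
      (∑ s, a s • I s) * I (i + 1) - T * (I (i + 2) * I (i + 1)) +
        I (i + 2) * (T * I (i + 1)) := by
    rw [add_mul, sub_mul, mul_assoc, mul_assoc]
  rw [h.contr_I, hB, map_add, map_sub, h.trace_sum_smul_mul,
    LinearMap.trace_mul_comm ℝ (I (i + 2)), mul_assoc, m1, m2, mul_neg, mul_smul_comm, map_neg,
    map_smul, ht]
  simp

end LinearAlgebra

section MainFormulas

variable {n : ℕ} {M : Type*} [TopologicalSpace M] [T2Space M]
  [ChartedSpace (EuclideanSpace ℝ (Fin (4 * n + 3))) M] [IsManifold (𝓡 (4 * n + 3)) ∞ M]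
  {S : Structure n M}

/-! ### The scalar curvature, the function `λ` and the Ricci-type tensors -/

namespace Complement

variable {C : Complement S} {F : S.Frame} {ξ : Fin 3 → Π x : M, Tan n x} {cov : Conn n M} {x : M}

namespace IsCanonical

variable (hcov : C.IsCanonical cov) (hξ : C.IsReeb F ξ) (hn : 1 ≤ n) (hx : x ∈ F.U)
include hcov hξ hx

lemma extDer_ξ (s a b : Fin 3) : extDer (F.η s) x (ξ a x) (ξ b x) =
    F.η s x (cov (ξ a) x (ξ b x)) - F.η s x (cov (ξ b) x (ξ a x)) +
      F.η s x (cov.torsion x (ξ a x) (ξ b x)) := by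
  have e : ∀ a, ∀ u : Tan n x, dirDeriv n (fun y ↦ F.η s y (ξ a y)) x u = 0 := fun a u ↦ by
    rw [dirDeriv_congr (fun y hy ↦ η_ξ hξ hy s a) F.isOpen_U hx, dirDeriv_const]
  rw [extDer_eq cov (F.smooth_η s) (smooth_ξ hξ a) (smooth_ξ hξ b) F.isOpen_U hx, e, e,
    torsion_eq cov (smooth_ξ hξ a) (smooth_ξ hξ b) F.isOpen_U hx, map_sub, map_sub]
  ring

lemma hor_bracket_ξ {Y : Π x : M, Tan n x} (hY : SmoothField F.U Y) (i : Fin 3) :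
    C.hor x (bracket (ξ i) Y x) = C.hor x (cov Y x (ξ i x)) -
      C.hor x (cov.torsion x (ξ i x) (Y x)) := by
  rw [torsion_eq cov (smooth_ξ hξ i) hY F.isOpen_U hx, map_sub, map_sub,
    hor_of_mem_V (hcov.cov_ξ_mem hξ hx _ _)]
  abel

/-- On horizontal fields `[ξ_i, ·]_H` is `∇_{ξ_i} - T_i`. So `L_{ξ_i} I_t` is `∇_{ξ_i} I_t - [T_i,
I_t]`, and `∇ I_t` has the same coefficients as `∇ ξ_t`. -/
lemma lieDer_eq (i t : Fin 3) (X : S.H x) : C.lieDer F ξ i t x X =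
    (∑ s, F.η s x (cov (ξ t) x (ξ i x)) • F.I s x -
      C.torEnd cov x (ξ i x) * F.I t x + F.I t x * C.torEnd cov x (ξ i x)) X := by
  obtain ⟨W, hW, hxW, he⟩ := exists_smooth_ext (n := n) x
  set F' := F.restrict W hW
  have he' : ∀ v : Tan n x, SmoothField F'.U (ext v) := fun v ↦
    (he v).mono Set.inter_subset_right
  have hξ' : C.IsReeb F' ξ := hξ.restrict hW
  have hx' : x ∈ F'.U := ⟨hx, hxW⟩
  have hO := F'.isOpen_U
  have hX := smooth_horExt hξ' he' X
  have hXH : ∀ y ∈ F'.U, C.horExt X y ∈ S.H y := fun y _ ↦ horExt_mem X y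
  have hI : SmoothField F'.U (fun y ↦ (F.I t y (C.hor y (ext (X : Tan n x) y)) : Tan n y)) :=
    smooth_I_hor hξ' (he' X) t
  have e1 := hcov.hor_bracket_ξ hξ' hx' hI i
  have e2 := hcov.hor_bracket_ξ hξ' hx' hX i
  have e3 := cov_congr cov (smooth_act hξ' (smooth_ξ hξ' t) hX)
    (Y := fun y ↦ (F.I t y (C.hor y (ext (X : Tan n x) y)) : Tan n y))
    (fun y hy ↦ (act_ξ hξ' hy t _).symm) hO hx' (ξ i x)
  rw [hcov.cov_act hξ' (smooth_ξ hξ' t) (fun y hy ↦ ξ_mem hξ' hy t) hX hXH hx',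
    horExt_self, act_apply, act_apply, hor_coe] at e3
  rw [e3, map_add, hor_coe, hor_coe, ext_self, hor_coe] at e1
  rw [horExt_self] at e2
  have e4 : ∀ Z : S.H x, C.hor x (cov.torsion x (ξ i x) Z) = C.torEnd cov x (ξ i x) Z :=
    fun Z ↦ rfl
  rw [e4] at e1 e2
  rw [lieDer, e1, e2]
  simp only [η_ξ hξ' hx', LinearMap.add_apply, LinearMap.sub_apply, LinearMap.sum_apply,
    LinearMap.smul_apply, Module.End.mul_apply, map_sub, ite_smul, one_smul, zero_smul,
    Finset.sum_ite_eq', Finset.mem_univ, if_true]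
  have hF : F'.η = F.η ∧ F'.I = F.I := ⟨rfl, rfl⟩
  rw [hF.1, hF.2]
  abel

include hn

/-- Both the Lie derivative and the three `dη` terms reduce to connection coefficients of the `ξ_s`
and torsion components. The former cancel by `cov_ξ_skew`; the latter contribute `-c + c + c`. -/
lemma lam_eq (i : Fin 3) : C.lam F ξ i x = normScal F ξ cov x := by
  have := hcov.nontrivial_H hξ (x := x) hn
  have h := isPara F hx
  have hn' : (n : ℝ) ≠ 0 := by exact_mod_cast (by omega : n ≠ 0)
  have e1 : contr (S.g x) (fun e e' ↦ S.g x (C.lieDer F ξ i (i + 2) x e) (F.I (i + 1) x e')) =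
      -(F.η (i + 1) x (cov (ξ (i + 2)) x (ξ i x)) * (eps (i + 1) * (4 * n))) := by
    have hc := h.contr_bracket_I (C.torEnd cov x (ξ i x))
      (fun s ↦ F.η s x (cov (ξ (i + 2)) x (ξ i x))) i (hcov.trace_torEnd_I hξ hx i i)
    rw [S.finrank_H, Nat.cast_mul, Nat.cast_ofNat] at hc
    refine Eq.trans ?_ hc
    exact congrArg (contr (S.g x)) (funext₂ fun e e' ↦ by rw [hcov.lieDer_eq hξ hx])
  have t0 := hcov.η_torsion_ξ hξ hn hx i (i + 2)
  have t1 := hcov.η_torsion_ξ hξ hn hx (i + 1) i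
  have t2 := hcov.η_torsion_ξ hξ hn hx (i + 2) (i + 1)
  simp only [(fin3_add i).1, (fin3_add i).2.1] at t1
  simp only [(fin3_add i).2.2.1, (fin3_add i).2.2.2] at t2
  rw [if_pos rfl] at t0
  rw [if_pos trivial] at t1 t2
  rw [lam, e1, hcov.extDer_ξ hξ hx, hcov.extDer_ξ hξ hx, hcov.extDer_ξ hξ hx, t0, t1, t2]
  have k0 := hcov.cov_ξ_skew hξ hx i (i + 1) (ξ (i + 2) x)
  have k1 := hcov.cov_ξ_skew hξ hx (i + 1) (i + 2) (ξ i x)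
  have k2 := hcov.cov_ξ_skew hξ hx (i + 2) i (ξ (i + 1) x)
  have e2 : 1 / (2 * (n : ℝ)) * -(F.η (i + 1) x (cov (ξ (i + 2)) x (ξ i x)) *
      (eps (i + 1) * (4 * n))) = -2 * eps (i + 1) * F.η (i + 1) x (cov (ξ (i + 2)) x (ξ i x)) := by
    field_simp
    ring
  rw [e2]
  linear_combination k2 - k0 - k1 + normScal F ξ cov x * (eps_sq (i + 1) + eps_sq (i + 2) - eps_sq i)

omit hx in
lemma scal_eq (hx : x ∈ F.U) : C.scal cov x = 8 * n * (n + 2) * normScal F ξ cov x := by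
  obtain ⟨U, N, hs, hr, hR, -⟩ := hcov.exists_isSplit_isCurv hξ hn hx
  have e := hR.scal_eq (isPara F hx) hs
  simp only [LinearMap.domRestrict₁₂_apply, S.finrank_H] at e
  refine Eq.trans (b := contr (S.g x) fun X Y ↦ contr (S.g x) fun e e' ↦
    S.g x (C.curvH hcov.smooth x e X Y) e') rfl (e.trans ?_)
  push_cast
  ring

/-- The tensors of the theorem in terms of the components of the torsion. -/
lemma exists_components : ∃ U N,
    IsSplit (S.g x) (fun s ↦ F.I s x) (fun i ↦ C.torEnd cov x (ξ i x)) U N ∧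
    (∀ X Y, C.tau F ξ cov x X Y = -2 * ∑ s, S.g x (N s (F.I s x X)) Y) ∧
    (∀ r X Y, C.mu F ξ cov r x X Y = S.g x (U X) Y) ∧
    (∀ X Y : S.H x, C.ric cov x X Y = (2 * n + 4) * normScal F ξ cov x * S.g x X Y -
      (4 * n + 4) * ∑ s, S.g x (N s (F.I s x X)) Y + (4 * n + 10) * S.g x (U X) Y) ∧
    ∀ s, ∀ X Y : S.H x, C.rho F cov s x X (F.I s x Y) = eps s * (normScal F ξ cov x * S.g x X Y -
        2 * S.g x (N s (F.I s x X)) Y + 2 * S.g x (U X) Y) ∧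
      C.varrho F cov s x X (F.I s x Y) = eps s * (normScal F ξ cov x * S.g x X Y -
        2 * (n + 2) / n * S.g x (N s (F.I s x X)) Y) ∧
      C.zeta F cov s x X (F.I s x Y) = -(eps s * (1 / 2 * normScal F ξ cov x * S.g x X Y -
        ∑ s, S.g x (N s (F.I s x X)) Y - 1 / n * S.g x (N s (F.I s x X)) Y +
        (2 * n + 1) / (2 * n) * S.g x (U X) Y)) := by
  obtain ⟨U, N, hs, hr, hR, -⟩ := hcov.exists_isSplit_isCurv hξ hn hx
  have h := isPara F hx
  have hn' : (n : ℝ) ≠ 0 := by exact_mod_cast (by omega : n ≠ 0)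
  refine ⟨U, N, hs, hs.tau_eq h, hs.mu_eq h, fun X Y ↦ ?_, fun s X Y ↦ ⟨?_, ?_, ?_⟩⟩
  · have e := hR.ric_eq h hs X Y
    simp only [LinearMap.domRestrict₁₂_apply, S.finrank_H] at e
    refine Eq.trans (b := contr (S.g x) fun e e' ↦ S.g x (C.curvH hcov.smooth x e X Y) e') rfl
      (e.trans ?_)
    simp only [map_add, map_sub, map_smul, map_sum, LinearMap.add_apply, LinearMap.sub_apply,
      LinearMap.smul_apply, LinearMap.sum_apply, smul_eq_mul]
    push_cast
    ring
  · rw [hr s X (F.I s x Y)]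
    exact hs.ricciForm_I h _ s X Y
  · have e := hR.varrho_formula h hs s X Y
    simp only [LinearMap.domRestrict₁₂_apply, S.finrank_H] at e
    refine Eq.trans (b := 1 / (4 * (n : ℝ)) * contr (S.g x) fun e e' ↦
      S.g x (C.curvH hcov.smooth x e (F.I s x e') X) (F.I s x Y)) rfl ?_
    rw [e]
    push_cast
    field_simp
    ring
  · have e := hR.zeta_formula h hs s X Y
    simp only [LinearMap.domRestrict₁₂_apply, S.finrank_H] at e
    refine Eq.trans (b := 1 / (4 * (n : ℝ)) * contr (S.g x) fun e e' ↦
      S.g x (C.curvH hcov.smooth x e X (F.I s x Y)) (F.I s x e')) rfl ?_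
    rw [e]
    push_cast
    field_simp
    ring

end IsCanonical

end Complement

end MainFormulas

/-! ### The individual assertions of the theorem. -/

section Conclusions

variable {n : ℕ} {M : Type*} [TopologicalSpace M] [T2Space M]
  [ChartedSpace (EuclideanSpace ℝ (Fin (4 * n + 3))) M] [IsManifold (𝓡 (4 * n + 3)) ∞ M]
  {S : Structure n M}

namespace Complement

variable {C : Complement S} {F : S.Frame} {ξ : Fin 3 → Π x : M, Tan n x} {cov : Conn n M} {x : M}

namespace IsCanonical

variable (hcov : C.IsCanonical cov) (hξ : C.IsReeb F ξ) (hn : 1 ≤ n)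
include hcov hξ hn

lemma smooth_scal : SmoothFun n F.U (C.scal cov) := fun x hx ↦
  (((smoothFun_const (8 * n * (n + 2) : ℝ)).mul (hcov.smooth_normScal hξ hx)).congr
    fun _ hy ↦ hcov.scal_eq hξ hn hy) x hx

lemma dirDeriv_scal (hx : x ∈ F.U) (u : Tan n x) : dirDeriv n (C.scal cov) x u =
    8 * n * (n + 2) * dirDeriv n (normScal F ξ cov) x u := by
  rw [dirDeriv_congr (fun y hy ↦ hcov.scal_eq hξ hn hy) F.isOpen_U hx,
    dirDeriv_mul (smoothFun_const _) (hcov.smooth_normScal hξ hx) F.isOpen_U hx, dirDeriv_const]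
  ring

variable (hx : x ∈ F.U)
include hx

lemma symmetries (X Y : S.H x) : C.ric cov x X Y = C.ric cov x Y X ∧ ∀ s,
    C.zeta F cov s x X (F.I s x Y) = C.zeta F cov s x Y (F.I s x X) ∧
    C.rho F cov s x X (F.I s x Y) = C.rho F cov s x Y (F.I s x X) ∧
    C.rho F cov s x X (F.I s x Y) = -C.rho F cov s x (F.I s x X) Y ∧
    C.rho F cov s x (F.I s x X) (F.I s x (F.I s x Y)) =
      -(eps s * C.rho F cov s x X (F.I s x Y)) ∧
    C.varrho F cov s x X (F.I s x Y) = C.varrho F cov s x Y (F.I s x X) ∧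
    C.varrho F cov s x X (F.I s x Y) = -C.varrho F cov s x (F.I s x X) Y ∧
    C.varrho F cov s x (F.I s x X) (F.I s x (F.I s x Y)) =
      -(eps s * C.varrho F cov s x X (F.I s x Y)) := by
  obtain ⟨U, N, hs, -, -, hR, hF⟩ := hcov.exists_components hξ hn hx
  have h := isPara F hx
  have hG : ∀ X Y, S.g x X Y = S.g x Y X := S.g_symm x
  have hN : ∀ s X Y, S.g x (N s (F.I s x X)) Y = S.g x (N s (F.I s x Y)) X :=
    IsCurv.g_N_I h hs
  have hU : ∀ X Y, S.g x (U X) Y = S.g x (U Y) X := fun X Y ↦ by rw [hs.U_symm, hG]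
  have hGI : ∀ s X Y, S.g x (F.I s x X) (F.I s x Y) = -(eps s * S.g x X Y) := h.metric
  have hNI : ∀ s X Y, S.g x (N s (F.I s x (F.I s x X))) (F.I s x Y) =
      -(eps s * S.g x (N s (F.I s x X)) Y) := hs.g_N_I_I h
  have hUI : ∀ s X Y, S.g x (U (F.I s x X)) (F.I s x Y) = -(eps s * S.g x (U X) Y) := hs.g_U_I h
  have hsq : ∀ s Y, F.I s x (eps s • F.I s x Y) = Y := fun s Y ↦ by
    rw [map_smul, show F.I s x (F.I s x Y) = eps s • Y from h.sq s Y, smul_smul, eps_sq, one_smul]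
  refine ⟨?_, fun s ↦ ⟨?_, ?_, ?_, ?_, ?_, ?_, ?_⟩⟩
  · rw [hR, hR, hG, hU, Finset.sum_congr rfl fun s _ ↦ hN s X Y]
  · rw [(hF s X Y).2.2, (hF s Y X).2.2, hG, hU, hN s X Y, Finset.sum_congr rfl fun s _ ↦ hN s X Y]
  · rw [(hF s X Y).1, (hF s Y X).1, hG, hU, hN s X Y]
  -- The component formulas treat second arguments of the form `I_s Z`, so `Y` is written as `I_s
  -- (ε_s I_s Y)`.
  · have e := (hF s (F.I s x X) (eps s • F.I s x Y)).1
    rw [hsq] at e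
    rw [(hF s X Y).1, e, map_smul, map_smul, map_smul, hGI, hNI, hUI]
    simp only [smul_eq_mul]
    linear_combination (-eps s * normScal F ξ cov x * S.g x X Y +
      2 * eps s * S.g x (N s (F.I s x X)) Y - 2 * eps s * S.g x (U X) Y) * eps_sq s
  · rw [(hF s X Y).1, (hF s (F.I s x X) (F.I s x Y)).1, hGI, hNI, hUI]
    ring
  · rw [(hF s X Y).2.1, (hF s Y X).2.1, hG, hN s X Y]
  · have e := (hF s (F.I s x X) (eps s • F.I s x Y)).2.1
    rw [hsq] at e
    rw [(hF s X Y).2.1, e, map_smul, map_smul, hGI, hNI]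
    simp only [smul_eq_mul]
    linear_combination (-eps s * normScal F ξ cov x * S.g x X Y +
      2 * (n + 2) / n * eps s * S.g x (N s (F.I s x X)) Y) * eps_sq s
  · rw [(hF s X Y).2.1, (hF s (F.I s x X) (F.I s x Y)).2.1, hGI, hNI]
    ring

lemma ricci_formulas (X Y : S.H x) (r : Fin 3) :
    C.ric cov x X Y = C.scal cov x / (4 * n) * S.g x X Y
      + (2 * n + 2) * C.tau F ξ cov x X Y + (4 * n + 10) * C.mu F ξ cov r x X Y ∧
    ∀ s,
      C.rho F cov s x X (F.I s x Y) =
        eps s * (C.scal cov x / (8 * n * (n + 2))) * S.g x X Y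
        + 1 / 2 * (eps s * C.tau F ξ cov x X Y - C.tau F ξ cov x (F.I s x X) (F.I s x Y))
        + 2 * eps s * C.mu F ξ cov r x X Y ∧
      C.varrho F cov s x X (F.I s x Y) =
        eps s * (C.scal cov x / (8 * n * (n + 2))) * S.g x X Y
        + (n + 2) / (2 * n) *
          (eps s * C.tau F ξ cov x X Y - C.tau F ξ cov x (F.I s x X) (F.I s x Y)) ∧
      -(eps s * C.zeta F cov s x X (F.I s x Y)) =
        C.scal cov x / (16 * n * (n + 2)) * S.g x X Y
        + (2 * n + 1) / (4 * n) * C.tau F ξ cov x X Y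
        - eps s * (1 / (4 * n)) * C.tau F ξ cov x (F.I s x X) (F.I s x Y)
        + (2 * n + 1) / (2 * n) * C.mu F ξ cov r x X Y := by
  obtain ⟨U, N, hs, hτ, hμ, hR, hF⟩ := hcov.exists_components hξ hn hx
  have h := isPara F hx
  have hn' : (n : ℝ) ≠ 0 := by exact_mod_cast (by omega : n ≠ 0)
  have hn2 : (n : ℝ) + 2 ≠ 0 := by positivity
  have hS := hcov.scal_eq hξ hn hx
  have k1 : C.scal cov x / (4 * n) = (2 * n + 4) * normScal F ξ cov x := by
    rw [hS]; field_simp; ring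
  have k2 : C.scal cov x / (8 * n * (n + 2)) = normScal F ξ cov x := by
    rw [hS]; field_simp
  have k3 : C.scal cov x / (16 * n * (n + 2)) = 1 / 2 * normScal F ξ cov x := by
    rw [hS]; field_simp; ring
  have hτI : ∀ s, C.tau F ξ cov x (F.I s x X) (F.I s x Y) =
      2 * eps s * (2 * S.g x (N s (F.I s x X)) Y - ∑ t, S.g x (N t (F.I t x X)) Y) := fun s ↦ by
    rw [hτ, show ∑ t, S.g x (N t (F.I t x (F.I s x X))) (F.I s x Y) = _ from
      hs.sum_g_N_I_I h s X Y]
    ring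
  refine ⟨?_, fun s ↦ ⟨?_, ?_, ?_⟩⟩
  · rw [hR, hτ, hμ, k1]
    ring
  · rw [(hF s X Y).1, hτI, hτ, hμ, k2]
    ring
  · rw [(hF s X Y).2.1, hτI, hτ, k2]
    field_simp
    ring
  · rw [(hF s X Y).2.2, hτI, hτ, hμ, k3]
    rcases eps_cases s with ⟨h1, -⟩ | ⟨h1, -⟩ | ⟨h1, -⟩ <;> rw [h1] <;> field_simp <;> ring

lemma scal_eq_extMetric : C.scal cov x =
    -(8 * n * (n + 2)) * C.extMetric F x (cov.torsion x (ξ 0 x) (ξ 1 x)) (ξ 2 x) := by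
  have e : ∑ s, eps s * F.η s x (cov.torsion x (ξ 0 x) (ξ 1 x)) * F.η s x (ξ 2 x) =
      normScal F ξ cov x := by
    simp [η_ξ hξ hx, normScal]
  rw [extMetric, e, hor_of_mem_V (ξ_mem hξ hx 2), map_zero, hcov.scal_eq hξ hn hx]
  ring

/-- All three quantities are `∓ω_k(T(ξ_i, ξ_j)_H, X)`; in the last two the product of `I_i` and
`I_j` yields `I_k`. -/
lemma mixed_formulas (X : S.H x) (i : Fin 3) :
    C.extMetric F x (cov.torsion x (ξ i x) (ξ (i + 1) x)) (F.I (i + 2) x X) =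
      -S.g x (F.I (i + 2) x (C.torH ξ cov i x)) X ∧
    C.rho F cov (i + 2) x (F.I (i + 1) x X) (ξ i x) =
      -S.g x (F.I (i + 2) x (C.torH ξ cov i x)) X ∧
    C.rho F cov (i + 2) x (F.I i x X) (ξ (i + 1) x) =
      S.g x (F.I (i + 2) x (C.torH ξ cov i x)) X := by
  have h := isPara F hx
  have hI : ∀ s (Z Z' : S.H x), S.g x Z (F.I s x Z') = -S.g x (F.I s x Z) Z' := h.g_I_right
  refine ⟨?_, ?_, ?_⟩
  · have e : ∀ s, F.η s x (F.I (i + 2) x X : Tan n x) = 0 := fun s ↦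
      (F.ker_η x hx _).1 (F.I (i + 2) x X).2 s
    simp only [extMetric, e, mul_zero, Finset.sum_const_zero, sub_zero]
    rw [hor_coe, hI]
    rfl
  · rw [(hcov.rho_mixed hξ hn hx _ i).1, hI,
      show F.I (i + 1) x (F.I i x _) = eps (i + 2) • _ from h.mul₁₀ i _, map_smul,
      LinearMap.smul_apply, smul_eq_mul]
    linear_combination -S.g x (F.I (i + 2) x (C.torH ξ cov i x)) X * eps_sq (i + 2)
  · rw [rho_swap, (hcov.rho_mixed hξ hn hx _ i).2.1, hI,
      show F.I i x (F.I (i + 1) x _) = -(eps (i + 2) • _) from h.mul₀₁ i _, map_neg, map_smul,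
      LinearMap.neg_apply, LinearMap.smul_apply, smul_eq_mul]
    linear_combination S.g x (F.I (i + 2) x (C.torH ξ cov i x)) X * eps_sq (i + 2)

/-- The third identity of `rho_mixed` relates `ρ_i(X, ξ_i)` to `ρ_j(X, ξ_j)`. Its three cyclic
instances form a linear system, which is solved for the first unknown. -/
lemma rho_hor_reeb (X : S.H x) (i : Fin 3) : -(eps i * C.rho F cov i x X (ξ i x)) =
    -(dirDeriv n (C.scal cov) x X / (32 * n * (n + 2)))
    + 1 / 2 * (-C.rho F cov i x (ξ (i + 1) x) (F.I (i + 2) x X)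
      + C.rho F cov (i + 1) x (ξ (i + 2) x) (F.I i x X)
      + C.rho F cov (i + 2) x (ξ i x) (F.I (i + 1) x X)) := by
  have hn' : (n : ℝ) ≠ 0 := by exact_mod_cast (by omega : n ≠ 0)
  have hn2 : (n : ℝ) + 2 ≠ 0 := by positivity
  have hd : dirDeriv n (C.scal cov) x X / (32 * n * (n + 2)) =
      1 / 4 * dirDeriv n (normScal F ξ cov) x X := by
    rw [hcov.dirDeriv_scal hξ hn hx]
    field_simp
    ring
  have m0 := (hcov.mixed_formulas hξ hn hx X i).2.1
  have m1 := (hcov.mixed_formulas hξ hn hx X (i + 1)).2.1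
  have m2 := (hcov.mixed_formulas hξ hn hx X (i + 2)).2.1
  have r0 := (hcov.rho_mixed hξ hn hx X i).2.2
  have r1 := (hcov.rho_mixed hξ hn hx X (i + 1)).2.2
  have r2 := (hcov.rho_mixed hξ hn hx X (i + 2)).2.2
  simp only [(fin3_add i).1, (fin3_add i).2.1, (fin3_add i).2.2.1, (fin3_add i).2.2.2] at m1 m2 r1 r2
  rw [hd, rho_swap i (ξ (i + 1) x), rho_swap (i + 1) (ξ (i + 2) x), rho_swap (i + 2) (ξ i x),
    m0, m1, m2]
  rw [rho_swap (i + 1) (ξ (i + 1) x)] at r0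
  rw [rho_swap (i + 2) (ξ (i + 2) x)] at r1
  rw [rho_swap i (ξ i x)] at r2
  rcases eps_cases i with ⟨h1, h2, h3⟩ | ⟨h1, h2, h3⟩ | ⟨h1, h2, h3⟩ <;>
    simp only [h1, h2, h3] at r0 r1 r2 ⊢ <;> linarith

/-- This is the component `s = i + 1` of `reeb_bianchi`: one of the three curvature terms vanishes
and the other two are Ricci forms. -/
lemma rho_reeb_reeb (i : Fin 3) : -(eps i * C.rho F cov i x (ξ i x) (ξ (i + 1) x))
    - eps (i + 2) * C.rho F cov (i + 2) x (ξ (i + 2) x) (ξ (i + 1) x) =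
      1 / (16 * n * (n + 2)) * dirDeriv n (C.scal cov) x (ξ (i + 1) x) := by
  have hn' : (n : ℝ) ≠ 0 := by exact_mod_cast (by omega : n ≠ 0)
  have hn2 : (n : ℝ) + 2 ≠ 0 := by positivity
  have hd : 1 / (16 * n * (n + 2)) * dirDeriv n (C.scal cov) x (ξ (i + 1) x) =
      1 / 2 * dirDeriv n (normScal F ξ cov) x (ξ (i + 1) x) := by
    rw [hcov.dirDeriv_scal hξ hn hx]
    field_simp
    ring
  have e := hcov.reeb_bianchi hξ hn hx i (i + 1)
  have c0 := (hcov.η_curv_ξ' hξ hn hx (ξ i x) (ξ (i + 1) x) (i + 2)).2.1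
  have c1 := (hcov.η_curv_ξ' hξ hn hx (ξ (i + 1) x) (ξ (i + 2) x) i).2.2
  have c2 := (hcov.η_curv_ξ' hξ hn hx (ξ (i + 2) x) (ξ i x) (i + 1)).1
  simp only [(fin3_add i).2.2.1, (fin3_add i).2.2.2] at c0
  rw [c0, c1, c2, rho_swap (i + 2)] at e
  rw [hd]
  rcases eps_cases i with ⟨h1, h2, h3⟩ | ⟨h1, h2, h3⟩ | ⟨h1, h2, h3⟩ <;>
    simp only [h1, h2, h3] at e ⊢ <;> linarith

lemma torsion_reeb (i : Fin 3) : cov.torsion x (ξ i x) (ξ (i + 1) x) =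
    (eps (i + 2) * (C.scal cov x / (8 * n * (n + 2)))) • ξ (i + 2) x
      - (C.hor x (bracket (ξ i) (ξ (i + 1)) x) : Tan n x) := by
  have hn' : (n : ℝ) ≠ 0 := by exact_mod_cast (by omega : n ≠ 0)
  have hn2 : (n : ℝ) + 2 ≠ 0 := by positivity
  have k2 : C.scal cov x / (8 * n * (n + 2)) = normScal F ξ cov x := by
    rw [hcov.scal_eq hξ hn hx]; field_simp
  rw [hcov.torsion_ξ hξ hn hx, hcov.coe_torH hξ hx, k2, sub_eq_add_neg, Submodule.coe_neg]

lemma mu_eq_zero (h1 : n = 1) (X Y : S.H x) (r : Fin 3) : C.mu F ξ cov r x X Y = 0 := by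
  obtain ⟨U, N, hs, -, hμ, -, -⟩ := hcov.exists_components hξ hn hx
  rw [hμ, hs.U_eq_zero (isPara F hx) (by rw [S.finrank_H, h1]), LinearMap.zero_apply, map_zero,
    LinearMap.zero_apply]

end IsCanonical

end Complement

end Conclusions

end PQC

end

theorem mainTheorem2 (n : ℕ) (hn : 1 ≤ n) {M : Type*} [TopologicalSpace M] [T2Space M]
    [ChartedSpace (EuclideanSpace ℝ (Fin (4 * n + 3))) M] [IsManifold (𝓡 (4 * n + 3)) ∞ M]
    (S : PQC.Structure n M) (C : PQC.Complement S) (cov : PQC.Conn n M)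
    (hcov : C.IsCanonical cov) (F : S.Frame) (ξ : Fin 3 → Π x : M, PQC.Tan n x)
    (hξ : C.IsReeb F ξ) :
    -- the scalar curvature is smooth
    PQC.SmoothFun n F.U (C.scal cov) ∧
    -- symmetries of the horizontal Ricci-type tensors
    (∀ x ∈ F.U, ∀ X Y : S.H x,
      C.ric cov x X Y = C.ric cov x Y X ∧
      ∀ s,
        C.zeta F cov s x X (F.I s x Y) = C.zeta F cov s x Y (F.I s x X) ∧
        C.rho F cov s x X (F.I s x Y) = C.rho F cov s x Y (F.I s x X) ∧
        C.rho F cov s x X (F.I s x Y) = -C.rho F cov s x (F.I s x X) Y ∧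
        C.rho F cov s x (F.I s x X) (F.I s x (F.I s x Y)) =
          -(PQC.eps s * C.rho F cov s x X (F.I s x Y)) ∧
        C.varrho F cov s x X (F.I s x Y) = C.varrho F cov s x Y (F.I s x X) ∧
        C.varrho F cov s x X (F.I s x Y) = -C.varrho F cov s x (F.I s x X) Y ∧
        C.varrho F cov s x (F.I s x X) (F.I s x (F.I s x Y)) =
          -(PQC.eps s * C.varrho F cov s x X (F.I s x Y))) ∧
    -- formulas for the horizontal Ricci-type tensors, with `μ = μ_r` for each `r`
    (∀ x ∈ F.U, ∀ X Y : S.H x, ∀ r,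
      C.ric cov x X Y = C.scal cov x / (4 * n) * S.g x X Y
        + (2 * n + 2) * C.tau F ξ cov x X Y + (4 * n + 10) * C.mu F ξ cov r x X Y ∧
      ∀ s,
        C.rho F cov s x X (F.I s x Y) =
          PQC.eps s * (C.scal cov x / (8 * n * (n + 2))) * S.g x X Y
          + 1 / 2 * (PQC.eps s * C.tau F ξ cov x X Y - C.tau F ξ cov x (F.I s x X) (F.I s x Y))
          + 2 * PQC.eps s * C.mu F ξ cov r x X Y ∧
        C.varrho F cov s x X (F.I s x Y) =
          PQC.eps s * (C.scal cov x / (8 * n * (n + 2))) * S.g x X Y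
          + (n + 2) / (2 * n) *
            (PQC.eps s * C.tau F ξ cov x X Y - C.tau F ξ cov x (F.I s x X) (F.I s x Y)) ∧
        -(PQC.eps s * C.zeta F cov s x X (F.I s x Y)) =
          C.scal cov x / (16 * n * (n + 2)) * S.g x X Y
          + (2 * n + 1) / (4 * n) * C.tau F ξ cov x X Y
          - PQC.eps s * (1 / (4 * n)) * C.tau F ξ cov x (F.I s x X) (F.I s x Y)
          + (2 * n + 1) / (2 * n) * C.mu F ξ cov r x X Y) ∧
    -- the scalar curvature and `λ`
    (∀ x ∈ F.U,
      C.scal cov x =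
        -(8 * n * (n + 2)) * C.extMetric F x (cov.torsion x (ξ 0 x) (ξ 1 x)) (ξ 2 x) ∧
      ∀ i, C.scal cov x = 8 * n * (n + 2) * C.lam F ξ i x) ∧
    -- the vertical torsion and the mixed Ricci 2-forms, for `(i, j, k) = (i, i + 1, i + 2)`
    (∀ x ∈ F.U, ∀ i,
      cov.torsion x (ξ i x) (ξ (i + 1) x) =
        (PQC.eps (i + 2) * (C.scal cov x / (8 * n * (n + 2)))) • ξ (i + 2) x
          - (C.hor x (PQC.bracket (ξ i) (ξ (i + 1)) x) : PQC.Tan n x) ∧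
      (∀ X : S.H x,
        C.extMetric F x (cov.torsion x (ξ i x) (ξ (i + 1) x)) (F.I (i + 2) x X) =
          C.rho F cov (i + 2) x (F.I (i + 1) x X) (ξ i x) ∧
        C.rho F cov (i + 2) x (F.I (i + 1) x X) (ξ i x) =
          -C.rho F cov (i + 2) x (F.I i x X) (ξ (i + 1) x) ∧
        -C.rho F cov (i + 2) x (F.I i x X) (ξ (i + 1) x) =
          S.g x (F.I (i + 2) x (C.hor x (PQC.bracket (ξ i) (ξ (i + 1)) x))) X ∧
        -(PQC.eps i * C.rho F cov i x X (ξ i x)) =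
          -(PQC.dirDeriv n (C.scal cov) x X / (32 * n * (n + 2)))
          + 1 / 2 * (-C.rho F cov i x (ξ (i + 1) x) (F.I (i + 2) x X)
            + C.rho F cov (i + 1) x (ξ (i + 2) x) (F.I i x X)
            + C.rho F cov (i + 2) x (ξ i x) (F.I (i + 1) x X))) ∧
      -(PQC.eps i * C.rho F cov i x (ξ i x) (ξ (i + 1) x))
        - PQC.eps (i + 2) * C.rho F cov (i + 2) x (ξ (i + 2) x) (ξ (i + 1) x) =
          1 / (16 * n * (n + 2)) * PQC.dirDeriv n (C.scal cov) x (ξ (i + 1) x)) ∧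
    -- in dimension seven `μ = 0`
    (n = 1 → ∀ x ∈ F.U, ∀ X Y : S.H x, ∀ r, C.mu F ξ cov r x X Y = 0) := by
  refine ⟨hcov.smooth_scal hξ hn, fun x hx X Y ↦ hcov.symmetries hξ hn hx X Y,
    fun x hx X Y r ↦ hcov.ricci_formulas hξ hn hx X Y r, fun x hx ↦
    ⟨hcov.scal_eq_extMetric hξ hn hx, fun i ↦ ?_⟩, fun x hx i ↦
    ⟨hcov.torsion_reeb hξ hn hx i, fun X ↦ ?_, hcov.rho_reeb_reeb hξ hn hx i⟩,
    fun h1 x hx X Y r ↦ hcov.mu_eq_zero hξ hn hx h1 X Y r⟩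
  · rw [hcov.lam_eq hξ hn hx, hcov.scal_eq hξ hn hx]
  · obtain ⟨h1, h2, h3⟩ := hcov.mixed_formulas hξ hn hx X i
    refine ⟨h1.trans h2.symm, h2.trans (by rw [h3]), ?_, hcov.rho_hor_reeb hξ hn hx X i⟩
    rw [h3, hcov.coe_torH hξ hx, map_neg, map_neg, LinearMap.neg_apply, neg_neg]
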